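/- Let $A$ be a finite alphabet, $A^+$ the set of nonempty finite words and $A^\infty$ the set of infinite words over $A$. An $\omega$-semigroup $(S_+,S_\infty)$ is a semigroup $S_+$ together with a set $S_\infty$, a mixed product $S_+\times S_\infty\to S_\infty$ and an infinite product mapping sequences in $S_+$ to $S_\infty$, satisfying all forms of associativity; $(A^+,A^\infty)$ with concatenation is one, and morphisms preserve all the products. Two sets $L_0,L_1\subseteq A^\infty$ are FO-separable if there is a sentence $\varphi$ of first-order logic over infinite words, with a predicate for each letter and the order $<$ on positions, such that every word of $L_0$ and no word of $L_1$ satisfies $\varphi$; then $\varphi$ is said to define a separator. **Theorem.** Let $L_0=\alpha^{-1}(F_0)$ and $L_1=\alpha^{-1}(F_1)$ be (regular) languages of infinite words recognized by a morphism $\alpha:(A^+,A^\infty)\to(S_+,S_\infty)$ into a finite $\omega$-semigroup, where $F_0,F_1\subseteq S_\infty$. The input $(\alpha,F_0,F_1)$ is presented by the tables of the product of $S_+$, of the mixed product and of the map $s\mapsto s^\infty=sss\cdots$, by the images $\alpha(a)$ of the letters $a\in A$, and by the characteristic sequences of $F_0$ and $F_1$. 1. It is decidable in exponential time with respect to $|S_+|$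 whether $L_0$ and $L_1$ are FO-separable. More precisely, there are polynomials $p,q$ and one random access machine (unit cost, with addition and subtraction as arithmetic operations, the input standing in its memory) that decides this for all $A$, $\alpha$, $F_0$, $F_1$ in at most $2^{p(|S_+|)}\,q(|A|)$ steps. 2. When $L_0$ and $L_1$ are FO-separable, one can construct an actual separator defined by a sentence of quantifier rank at most $|A|\cdot 2^{|S_+|^2}+1$: there is a computable function that maps each input $(\alpha,F_0,F_1)$ for which $L_0$ and $L_1$ are FO-separable to (a code of) such a sentence. -/

import Mathlib

/-! ## ω-semigroups -/

/-- The product `s i * s (i+1) * ⋯ * s (i+l)` of `l + 1` consecutive entries of a sequence. -/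
def blockProd {S : Type*} [Semigroup S] (s : Stream' S) (i : ℕ) : ℕ → S
  | 0 => s.get i
  | l + 1 => blockProd s i l * s.get (i + l + 1)

/-- The sequence whose `n`-th entry is the product of the block of `s` made of the positions `j`
with `k n ≤ j < k (n + 1)`; it is used only for strictly increasing `k`. -/
def blocks {S : Type*} [Semigroup S] (s : Stream' S) (k : ℕ → ℕ) : Stream' S :=
  fun n => blockProd s (k n) (k (n + 1) - k n - 1)

/-- An ω-semigroup `(S, T)`: a semigroup `S`, a set `T`, a mixed product `S × T → T` (written `•`)
and an infinite product from sequences in `S` to `T`, with all forms of associativity. -/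
class OmegaSemigroup (S T : Type*) [Semigroup S] extends SemigroupAction S T where
  /-- the infinite product -/
  iprod : Stream' S → T
  smul_iprod (s : S) (f : Stream' S) : s • iprod f = iprod (f.cons s)
  iprod_blocks (f : Stream' S) (k : ℕ → ℕ) (h0 : k 0 = 0) (hk : StrictMono k) :
    iprod (blocks f k) = iprod f

/-- Morphisms of ω-semigroups: they preserve the three products. -/
structure OmegaHom (S T S' T' : Type*) [Semigroup S] [Semigroup S'] [OmegaSemigroup S T]
    [OmegaSemigroup S' T'] where
  /-- the component on finite products -/
  fin : S →ₙ* S'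
  /-- the component on infinite products -/
  inf : T → T'
  map_smul (s : S) (t : T) : inf (s • t) = fin s • inf t
  map_iprod (f : Stream' S) : inf (OmegaSemigroup.iprod f) = OmegaSemigroup.iprod (f.map fin)

/-! ## Words: `FreeSemigroup A` is the set of nonempty finite words over `A`, and `Stream' A` is
the set of infinite words. Together they form an ω-semigroup. -/

namespace Word

variable {A : Type*}

/-- The list of letters of a nonempty finite word. -/
def letters (u : FreeSemigroup A) : List A := u.head :: u.tail

theorem letters_mul (u v : FreeSemigroup A) : letters (u * v) = letters u ++ letters v := rfl

theorem letters_pos (u : FreeSemigroup A) : 0 < (letters u).length := Nat.succ_pos _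

theorem lt_length_blockProd (u : Stream' (FreeSemigroup A)) (i n : ℕ) :
    n < (letters (blockProd u i n)).length := by
  induction n with
  | zero => exact letters_pos _
  | succ n ih =>
    have := letters_pos (u.get (i + n + 1))
    rw [blockProd, letters_mul, List.length_append]
    omega

/-- The concatenation of infinitely many nonempty words `u 0, u 1, …`: its `n`-th letter is the
`n`-th letter of the finite word `u 0 ⋯ u n`, which has more than `n` letters. -/
def concat (u : Stream' (FreeSemigroup A)) : Stream' A :=
  fun n => (letters (blockProd u 0 n))[n]'(lt_length_blockProd u 0 n)

theorem getElem?_blockProd (u : Stream' (FreeSemigroup A)) (n d : ℕ) :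
    (letters (blockProd u 0 (n + d)))[n]? = some ((concat u).get n) := by
  induction d with
  | zero => exact List.getElem?_eq_getElem (lt_length_blockProd u 0 n)
  | succ d ih =>
    have := lt_length_blockProd u 0 (n + d)
    rw [← Nat.add_assoc, blockProd, letters_mul, List.getElem?_append_left (by omega), ih]

theorem blockProd_append {S : Type*} [Semigroup S] (s : Stream' S) (i l m : ℕ) :
    blockProd s i (l + 1 + m) = blockProd s i l * blockProd s (i + l + 1) m := by
  induction m with
  | zero => rfl
  | succ m ih =>
    rw [← Nat.add_assoc, blockProd, ih, blockProd, mul_assoc]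
    congr 3
    omega

theorem blockProd_blocks {S : Type*} [Semigroup S] (s : Stream' S) (k : ℕ → ℕ) (h0 : k 0 = 0)
    (hk : StrictMono k) (n : ℕ) :
    blockProd (blocks s k) 0 n = blockProd s 0 (k (n + 1) - 1) := by
  induction n with
  | zero =>
    change blockProd s (k 0) (k (0 + 1) - k 0 - 1) = _
    rw [h0, Nat.sub_zero]
  | succ n ih =>
    have h1 := hk (Nat.lt_add_one n)
    have h2 := hk (Nat.lt_add_one (n + 1))
    rw [blockProd, ih]
    change _ * blockProd s (k (0 + n + 1)) (k (0 + n + 1 + 1) - k (0 + n + 1) - 1) = _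
    rw [Nat.zero_add]
    have e1 : k (n + 1) = 0 + (k (n + 1) - 1) + 1 := by omega
    have e2 : k (n + 1 + 1) - 1 = (k (n + 1) - 1) + 1 + (k (n + 1 + 1) - k (n + 1) - 1) := by omega
    rw [e2, blockProd_append, ← e1]

theorem blockProd_cons {S : Type*} [Semigroup S] (s : Stream' S) (a : S) (n : ℕ) :
    blockProd (s.cons a) 0 (n + 1) = a * blockProd s 0 n := by
  induction n with
  | zero => rfl
  | succ n ih =>
    rw [blockProd, ih, blockProd, mul_assoc]
    congr 2

instance : OmegaSemigroup (FreeSemigroup A) (Stream' A) where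
  smul u w := letters u ++ₛ w
  mul_smul u v w := Stream'.append_append_stream (letters u) (letters v) w
  iprod := concat
  smul_iprod u f := by
    change letters u ++ₛ concat f = concat (f.cons u)
    refine Stream'.ext fun n => Option.some_injective _ ?_
    rw [← getElem?_blockProd (f.cons u) n 1, blockProd_cons, letters_mul]
    rcases Nat.lt_or_ge n (letters u).length with h | h
    · rw [Stream'.get_append_left _ _ _ h, List.getElem?_append_left h, List.getElem?_eq_getElem h]
    · obtain ⟨d, rfl⟩ := Nat.exists_eq_add_of_le h
      rw [Stream'.get_append_right, List.getElem?_append_right h, Nat.add_sub_cancel_left,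
        Nat.add_comm, getElem?_blockProd]
  iprod_blocks f k h0 hk := by
    refine Stream'.ext fun n => Option.some_injective _ ?_
    have h := hk.le_apply (x := n + 1)
    obtain ⟨d, hd⟩ := Nat.exists_eq_add_of_le (show n ≤ k (n + 1) - 1 by omega)
    rw [← getElem?_blockProd (blocks f k) n 0, Nat.add_zero, blockProd_blocks f k h0 hk, hd,
      getElem?_blockProd]

end Word

/-! ## First-order logic over infinite words -/

namespace FOWord

open FirstOrder

/-- The relation symbols: a unary predicate for each letter, and the binary symbol `<`. -/
inductive Rel (A : Type*) : ℕ → Type _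
  | letter (a : A) : Rel A 1
  | lt : Rel A 2

/-- The signature of `FO(<)` on words over `A`. -/
def lang (A : Type*) : Language := ⟨fun _ => Empty, Rel A⟩

variable {A : Type*}

/-- An infinite word as a structure whose domain is its set `ℕ` of positions. -/
@[reducible] def structureOf (w : Stream' A) : (lang A).Structure ℕ where
  funMap f := nomatch f
  RelMap R x := match R, x with
    | .letter a, x => w.get (x 0) = a
    | .lt, x => x 0 < x 1

/-- The infinite word `w` satisfies the sentence `φ`. -/
def Models (w : Stream' A) (φ : (lang A).Sentence) : Prop :=
  letI := structureOf w
  ℕ ⊨ φ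

/-- The quantifier rank (the connectives are `⊥` and `→`, and `∃` is `¬ ∀ ¬`). -/
def qrank : {n : ℕ} → (lang A).BoundedFormula Empty n → ℕ
  | _, .falsum => 0
  | _, .equal _ _ => 0
  | _, .rel _ _ => 0
  | _, .imp φ ψ => max (qrank φ) (qrank ψ)
  | _, .all φ => qrank φ + 1

/-- The set of infinite words defined by a sentence. -/
def langOf (φ : (lang A).Sentence) : Set (Stream' A) := {w | Models w φ}

/-- `K` separates `L₀` from `L₁`. -/
def Separates (K L₀ L₁ : Set (Stream' A)) : Prop := L₀ ⊆ K ∧ L₁ ∩ K = ∅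

/-- `L₀` and `L₁` are separable by a first-order definable language. -/
def Separable (L₀ L₁ : Set (Stream' A)) : Prop :=
  ∃ φ : (lang A).Sentence, Separates (langOf φ) L₀ L₁

/-- The index of a variable (the terms of the signature are variables). -/
def varIndex {n : ℕ} : (lang A).Term (Empty ⊕ Fin n) → ℕ
  | .var (.inr i) => i

/-- The code of an atomic formula. -/
def relCode (c : A → ℕ) {l : ℕ} (R : Rel A l) (x : Fin l → ℕ) : List ℕ :=
  match R, x with
  | .letter a, x => [2, c a, x 0]
  | .lt, x => [3, x 0, x 1]

/-- Formulas written out in Polish notation as lists of numbers, `c` being a numbering of the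
letters; bound variables are numbered from the outside. -/
def code (c : A → ℕ) : {n : ℕ} → (lang A).BoundedFormula Empty n → List ℕ
  | _, .falsum => [0]
  | _, .equal s t => [1, varIndex s, varIndex t]
  | _, .rel R ts => relCode c R fun i => varIndex (ts i)
  | _, .imp φ ψ => 4 :: (code c φ ++ code c ψ)
  | _, .all φ => 5 :: code c φ

end FOWord

/-! ## Random access machines -/

namespace RAM

/-- A state: the values of the program's registers, and an addressable memory. -/
@[ext] structure State where
  /-- the registers -/
  reg : ℕ → ℕ
  /-- the memory -/
  mem : ℕ → ℕ

/-- Write `v` into register `x`. -/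
def State.setReg (s : State) (x v : ℕ) : State := { s with reg := Function.update s.reg x v }

/-- Write `v` into the memory cell with address `a`. -/
def State.setMem (s : State) (a v : ℕ) : State := { s with mem := Function.update s.mem a v }

/-- Structured programs of a random access machine with addition and (truncated) subtraction as
arithmetic operations. There is no multiplication, so that unit-cost time is polynomially related
to the time of Turing machines. -/
inductive Prog
  /-- `reg x := c` -/
  | const (x c : ℕ)
  /-- `reg x := reg y + reg z` -/
  | add (x y z : ℕ)
  /-- `reg x := reg y - reg z` -/
  | sub (x y z : ℕ)
  /-- `reg x := mem (reg y)` -/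
  | load (x y : ℕ)
  /-- `mem (reg x) := reg y` -/
  | store (x y : ℕ)
  /-- `P`, then `Q` -/
  | seq (P Q : Prog)
  /-- if `reg x ≠ 0` then `P` else `Q` -/
  | cond (x : ℕ) (P Q : Prog)
  /-- while `reg x ≠ 0` do `P` -/
  | loop (x : ℕ) (P : Prog)

/-- `Runs P s t s'`: started in state `s`, the program `P` halts in state `s'` after exactly `t`
steps, where every elementary instruction and every test is one step. -/
inductive Runs : Prog → State → ℕ → State → Prop
  | const (x c : ℕ) (s : State) : Runs (.const x c) s 1 (s.setReg x c)
  | add (x y z : ℕ) (s : State) : Runs (.add x y z) s 1 (s.setReg x (s.reg y + s.reg z))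
  | sub (x y z : ℕ) (s : State) : Runs (.sub x y z) s 1 (s.setReg x (s.reg y - s.reg z))
  | load (x y : ℕ) (s : State) : Runs (.load x y) s 1 (s.setReg x (s.mem (s.reg y)))
  | store (x y : ℕ) (s : State) : Runs (.store x y) s 1 (s.setMem (s.reg x) (s.reg y))
  | seq {P Q : Prog} {s s' s'' : State} {t t' : ℕ} :
      Runs P s t s' → Runs Q s' t' s'' → Runs (.seq P Q) s (t + t') s''
  | cond_true {x : ℕ} {P Q : Prog} {s s' : State} {t : ℕ} :
      s.reg x ≠ 0 → Runs P s t s' → Runs (.cond x P Q) s (t + 1) s'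
  | cond_false {x : ℕ} {P Q : Prog} {s s' : State} {t : ℕ} :
      s.reg x = 0 → Runs Q s t s' → Runs (.cond x P Q) s (t + 1) s'
  | loop_false {x : ℕ} {P : Prog} {s : State} : s.reg x = 0 → Runs (.loop x P) s 1 s
  | loop_true {x : ℕ} {P : Prog} {s s' s'' : State} {t t' : ℕ} :
      s.reg x ≠ 0 → Runs P s t s' → Runs (.loop x P) s' t' s'' →
      Runs (.loop x P) s (t + t' + 1) s''

theorem Runs.unique {P : Prog} {s s₁ s₂ : State} {t₁ t₂ : ℕ} (h₁ : Runs P s t₁ s₁)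
    (h₂ : Runs P s t₂ s₂) : t₁ = t₂ ∧ s₁ = s₂ := by
  induction h₁ generalizing t₂ s₂ with
  | const | add | sub | load | store => cases h₂; exact ⟨rfl, rfl⟩
  | seq _ _ ih ih' =>
    cases h₂ with
    | seq a b => obtain ⟨rfl, rfl⟩ := ih a; obtain ⟨rfl, rfl⟩ := ih' b; exact ⟨rfl, rfl⟩
  | cond_true h _ ih =>
    cases h₂ with
    | cond_true _ a => obtain ⟨rfl, rfl⟩ := ih a; exact ⟨rfl, rfl⟩
    | cond_false h' _ => exact absurd h' h
  | cond_false h _ ih =>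
    cases h₂ with
    | cond_true h' _ => exact absurd h h'
    | cond_false _ a => obtain ⟨rfl, rfl⟩ := ih a; exact ⟨rfl, rfl⟩
  | loop_false h =>
    cases h₂ with
    | loop_false => exact ⟨rfl, rfl⟩
    | loop_true h' _ _ => exact absurd h h'
  | loop_true h _ _ ih ih' =>
    cases h₂ with
    | loop_false h' => exact absurd h' h
    | loop_true _ a b => obtain ⟨rfl, rfl⟩ := ih a; obtain ⟨rfl, rfl⟩ := ih' b; exact ⟨rfl, rfl⟩

/-- The initial state on an input list: the list stands in memory from address `0` on, register `0`
holds its length, and everything else is `0`. -/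
def init (l : List ℕ) : State where
  reg x := if x = 0 then l.length else 0
  mem i := l.getD i 0

/-- On input `l`, the program `P` halts within `b` steps, and it accepts (that is, register `0`
is not `0` at the end) if and only if `p` holds. -/
def DecidesWithin (P : Prog) (l : List ℕ) (b : ℕ) (p : Prop) : Prop :=
  ∃ (t : ℕ) (s : State), Runs P (init l) t s ∧ t ≤ b ∧ (s.reg 0 ≠ 0 ↔ p)

end RAM

/-! ## Inputs -/

open Classical in
/-- The list of numbers that presents a morphism `α` from the words over a finite alphabet `A` to a
finite ω-semigroup `(S, T)` and two subsets of `T`, once the elements of `A`, `S` and `T` are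
numbered. It consists of the sizes of `S`, `T`, `A`, the tables of the product, of the mixed product
and of the infinite power `s ↦ s s s ⋯`, the images of the letters, and the characteristic
sequences of the subsets. -/
noncomputable def presentation {A S T : Type*} [Semigroup S] [OmegaSemigroup S T] {n m k : ℕ}
    (eA : A ≃ Fin n) (eS : S ≃ Fin m) (eT : T ≃ Fin k)
    (α : OmegaHom (FreeSemigroup A) (Stream' A) S T) (F₀ F₁ : Set T) : List ℕ :=
  [m, k, n]
  ++ ((List.finRange m).flatMap fun i => (List.finRange m).map fun j =>
      (eS (eS.symm i * eS.symm j) : ℕ))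
  ++ ((List.finRange m).flatMap fun i => (List.finRange k).map fun j =>
      (eT (eS.symm i • eT.symm j) : ℕ))
  ++ ((List.finRange m).map fun i =>
      (eT (OmegaSemigroup.iprod (Stream'.const (eS.symm i))) : ℕ))
  ++ ((List.finRange n).map fun a => (eS (α.fin (FreeSemigroup.of (eA.symm a))) : ℕ))
  ++ ((List.finRange k).map fun j => if eT.symm j ∈ F₀ then 1 else 0)
  ++ ((List.finRange k).map fun j => if eT.symm j ∈ F₁ then 1 else 0)

/-!
Call a set of elements of `S₊` saturated if it is obtained from the singletons `{α(a)}` by products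
and by passing from `X` to the union of its powers with exponents in `(2 ^ |S₊|, 2 ^ (|S₊| + 1)]`.
The languages `α⁻¹(F₀)` and `α⁻¹(F₁)` are inseparable if and only if there are saturated sets `X`
and `E` with `x, y ∈ X` and `e, f ∈ E` such that `x e^∞ ∈ F₀` and `y f^∞ ∈ F₁`.

If there are such sets, then for every `k` all elements of `X` are values of words of one and the
same rank-`k` type, because first-order logic does not tell apart large powers of a word; the same
holds for `E`, and therefore no sentence separates.

Conversely, the saturated sets act on the subsets of `S₊` by right multiplication. When such a map
permutes a collection of sets, the union of its powers dominates both the map and the identity, so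
every group in this transformation monoid can be absorbed. By induction on the height of the images
of the monoid in the order of reachability, the values of all finite words of one and the same type,
of a rank that depends only on `|S₊|`, lie in a common saturated set. By Ramsey's theorem, two
infinite words of the same type of slightly larger rank have factorizations in which corresponding
factors are of the same type. A separator of that rank is thus a disjunction of Hintikka formulas,
which describe the types of finitely many ultimately periodic words that reach `F₀`.

There are at most `2 ^ |S₊|` saturated sets. They are computed in exponential time by as many rounds
of closure on a bit mask indexed by the bit masks of subsets of `S₊`.
-/

/-! ## Rank types of words -/

/-- The type of rank-`k` types of words over `A`: a type of rank `k + 1` records, for every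
factorization `x a y` of a word at a letter `a`, the rank-`k` types of `x` and `y`. -/
def RankType.{u} (A : Type u) : ℕ → Type u
  | 0 => PUnit.{u + 1}
  | k + 1 => Set (RankType A k × A × RankType A k)

/-- Finite (possibly empty) or infinite words. -/
inductive AnyWord (A : Type*)
  | fin (l : List A)
  | inf (s : Stream' A)

namespace AnyWord

variable {A B : Type*}

/-- The concatenation of a finite word and a finite or infinite one. -/
def prepend (x : List A) : AnyWord A → AnyWord A
  | fin l => fin (x ++ l)
  | inf s => inf (x ++ₛ s)

/-- The word with first letter `a` followed by `w`. -/
def cons (a : A) (w : AnyWord A) : AnyWord A := prepend [a] w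

theorem prepend_append (x y : List A) (w : AnyWord A) :
    prepend (x ++ y) w = prepend x (prepend y w) := by
  cases w <;> simp [prepend]

@[simp] theorem prepend_nil (w : AnyWord A) : prepend [] w = w := by
  cases w <;> simp [prepend]

theorem prepend_cons (a : A) (x : List A) (w : AnyWord A) :
    prepend (a :: x) w = cons a (prepend x w) :=
  prepend_append [a] x w

@[simp] theorem prepend_fin (x y : List A) : prepend x (fin y) = fin (x ++ y) := rfl

@[simp] theorem prepend_inf (x : List A) (y : Stream' A) :
    prepend x (inf y) = inf (x ++ₛ y) := rfl

@[simp] theorem cons_fin (a : A) (y : List A) : cons a (fin y) = fin (a :: y) := rfl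

theorem cons_inf (a : A) (y : Stream' A) : cons a (inf y) = inf (y.cons a) := rfl

theorem cons_inj {a b : A} {w w' : AnyWord A} : cons a w = cons b w' ↔ a = b ∧ w = w' := by
  cases w <;> cases w' <;> simp [cons_inf, Stream'.cons_injective2.eq_iff]

theorem cons_ne_nil (a : A) (w : AnyWord A) : cons a w ≠ fin [] := by
  cases w <;> simp [cons_fin, cons_inf]

theorem eq_nil_or_eq_cons (w : AnyWord A) : w = fin [] ∨ ∃ a y, w = cons a y := by
  rcases w with (_ | ⟨a, l⟩) | s
  · exact Or.inl rfl
  · exact Or.inr ⟨a, fin l, rfl⟩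
  · exact Or.inr ⟨s.head, inf s.tail, congrArg inf (Stream'.eta s).symm⟩

theorem prepend_eq_prepend_cons_iff {u x : List A} {a : A} {v y : AnyWord A} :
    prepend u v = prepend x (cons a y) ↔
      (∃ z, u = x ++ a :: z ∧ y = prepend z v) ∨ ∃ z, x = u ++ z ∧ v = prepend z (cons a y) := by
  induction u generalizing x with
  | nil => simp
  | cons b u ih =>
    cases x with
    | nil =>
      simp only [prepend_cons, prepend_nil, cons_inj, List.nil_append, List.cons.injEq]
      constructor
      · rintro ⟨rfl, rfl⟩; exact Or.inl ⟨u, ⟨rfl, rfl⟩, rfl⟩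
      · rintro (⟨z, ⟨rfl, rfl⟩, rfl⟩ | ⟨z, h, -⟩)
        · exact ⟨rfl, rfl⟩
        · simp at h
    | cons c x =>
      simp only [prepend_cons, cons_inj, ih, List.cons_append, List.cons.injEq]
      grind

theorem fin_eq_prepend_cons_iff {u x : List A} {a : A} {y : AnyWord A} :
    fin u = prepend x (cons a y) ↔ ∃ z, u = x ++ a :: z ∧ y = fin z := by
  cases y <;> simp [cons_inf]

theorem inf_eq_prepend_cons_iff {u : Stream' A} {x : List A} {a : A} {y : AnyWord A} :
    inf u = prepend x (cons a y) ↔ ∃ z : Stream' A, u = x ++ₛ z.cons a ∧ y = inf z := by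
  cases y <;> simp [cons_inf]

/-- The rank-`k` type of a word. -/
def tp : (k : ℕ) → AnyWord A → RankType A k
  | 0, _ => PUnit.unit
  | k + 1, w => ({z | ∃ x a y, w = prepend x (cons a y) ∧ z = (tp k (fin x), a, tp k y)} : Set _)

/-- Half of the equality of types of rank `k + 1`: the "forth" condition of one round of an
Ehrenfeucht-Fraïssé game. -/
def Forth (k : ℕ) (w w' : AnyWord A) : Prop :=
  ∀ x a y, w = prepend x (cons a y) →
    ∃ x' y', w' = prepend x' (cons a y') ∧ tp k (fin x) = tp k (fin x') ∧ tp k y = tp k y'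

theorem tp_succ_eq_iff_forall {k : ℕ} {w w' : AnyWord A} :
    tp (k + 1) w = tp (k + 1) w' ↔ ∀ z,
      (∃ x a y, w = prepend x (cons a y) ∧ z = (tp k (fin x), a, tp k y)) ↔
      ∃ x a y, w' = prepend x (cons a y) ∧ z = (tp k (fin x), a, tp k y) :=
  Set.ext_iff

theorem forth_of_tp_succ_eq {k : ℕ} {w w' : AnyWord A} (h : tp (k + 1) w = tp (k + 1) w') :
    Forth k w w' := by
  intro x a y hw
  obtain ⟨x', a', y', hw', he⟩ := (tp_succ_eq_iff_forall.1 h _).1 ⟨x, a, y, hw, rfl⟩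
  obtain ⟨hx, rfl, hy⟩ : tp k (fin x) = tp k (fin x') ∧ a = a' ∧ tp k y = tp k y' := by
    simpa only [Prod.mk.injEq] using he
  exact ⟨x', y', hw', hx, hy⟩

theorem tp_succ_eq_iff {k : ℕ} {w w' : AnyWord A} :
    tp (k + 1) w = tp (k + 1) w' ↔ Forth k w w' ∧ Forth k w' w := by
  refine ⟨fun h => ⟨forth_of_tp_succ_eq h, forth_of_tp_succ_eq h.symm⟩, fun ⟨h, h'⟩ =>
    tp_succ_eq_iff_forall.2 fun z => ⟨?_, ?_⟩⟩
  · rintro ⟨x, a, y, hw, rfl⟩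
    obtain ⟨x', y', hw', hx, hy⟩ := h x a y hw
    exact ⟨x', a, y', hw', by rw [hx, hy]⟩
  · rintro ⟨x, a, y, hw, rfl⟩
    obtain ⟨x', y', hw', hx, hy⟩ := h' x a y hw
    exact ⟨x', a, y', hw', by rw [hx, hy]⟩

theorem tp_eq_of_tp_succ_eq {k : ℕ} {w w' : AnyWord A} (h : tp (k + 1) w = tp (k + 1) w') :
    tp k w = tp k w' := by
  induction k generalizing w w' with
  | zero => rfl
  | succ k ih =>
    suffices forth : ∀ w w' : AnyWord A, tp (k + 2) w = tp (k + 2) w' → Forth k w w' from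
      tp_succ_eq_iff.2 ⟨forth _ _ h, forth _ _ h.symm⟩
    intro w w' h x a y hw
    obtain ⟨x', y', hw', hx, hy⟩ := forth_of_tp_succ_eq h x a y hw
    exact ⟨x', y', hw', ih hx, ih hy⟩

theorem tp_eq_of_le {k l : ℕ} (hkl : k ≤ l) {w w' : AnyWord A} (h : tp l w = tp l w') :
    tp k w = tp k w' := by
  induction l, hkl using Nat.le_induction with
  | base => exact h
  | succ l _ ih => exact ih (tp_eq_of_tp_succ_eq h)

theorem tp_prepend_congr {k : ℕ} {u u' : List A} {v v' : AnyWord A}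
    (hu : tp k (fin u) = tp k (fin u')) (hv : tp k v = tp k v') :
    tp k (prepend u v) = tp k (prepend u' v') := by
  induction k generalizing u u' v v' with
  | zero => rfl
  | succ k ih =>
    suffices forth : ∀ (u u' : List A) (v v' : AnyWord A),
        tp (k + 1) (fin u) = tp (k + 1) (fin u') → tp (k + 1) v = tp (k + 1) v' →
        Forth k (prepend u v) (prepend u' v') from
      tp_succ_eq_iff.2 ⟨forth _ _ _ _ hu hv, forth _ _ _ _ hu.symm hv.symm⟩
    intro u u' v v' hu hv x a y hw
    rcases prepend_eq_prepend_cons_iff.1 hw with ⟨z, rfl, rfl⟩ | ⟨z, rfl, rfl⟩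
    · obtain ⟨x', y', hw', hx, hy⟩ := forth_of_tp_succ_eq hu x a (fin z) rfl
      obtain ⟨z', rfl, rfl⟩ := fin_eq_prepend_cons_iff.1 hw'
      refine ⟨x', prepend z' v', ?_, hx, ih hy (tp_eq_of_tp_succ_eq hv)⟩
      rw [prepend_append, prepend_cons]
    · obtain ⟨x', y', rfl, hx, hy⟩ := forth_of_tp_succ_eq hv z a y rfl
      exact ⟨u' ++ x', y', (prepend_append _ _ _).symm,
        ih (v := fin z) (v' := fin x') (tp_eq_of_tp_succ_eq hu) hx, hy⟩

theorem tp_append_congr {k : ℕ} {u u' v v' : List A} (hu : tp k (fin u) = tp k (fin u'))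
    (hv : tp k (fin v) = tp k (fin v')) : tp k (fin (u ++ v)) = tp k (fin (u' ++ v')) :=
  tp_prepend_congr (v := fin v) (v' := fin v') hu hv

theorem eq_nil_of_tp_eq {k : ℕ} {w : AnyWord A} (h : tp (k + 1) w = tp (k + 1) (fin [])) :
    w = fin [] := by
  refine (eq_nil_or_eq_cons w).resolve_right ?_
  rintro ⟨a, y, rfl⟩
  obtain ⟨x', y', hnil, -⟩ := forth_of_tp_succ_eq h [] a y (prepend_nil _).symm
  obtain ⟨z, hz, -⟩ := fin_eq_prepend_cons_iff.1 hnil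
  simp at hz

theorem exists_cons_of_tp_eq {k : ℕ} {a : A} {y w : AnyWord A}
    (h : tp (k + 2) (cons a y) = tp (k + 2) w) :
    ∃ y', w = cons a y' ∧ tp (k + 1) y = tp (k + 1) y' := by
  obtain ⟨x', y', rfl, hx, hy⟩ := forth_of_tp_succ_eq h [] a y (prepend_nil _).symm
  obtain rfl : x' = [] := by simpa using eq_nil_of_tp_eq hx.symm
  exact ⟨y', prepend_nil _, hy⟩

theorem getLast?_eq_of_tp_eq {k : ℕ} {u v : List A}
    (h : tp (k + 2) (fin u) = tp (k + 2) (fin v)) : u.getLast? = v.getLast? := by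
  rcases List.eq_nil_or_concat u with rfl | ⟨x, a, rfl⟩
  · rw [AnyWord.fin.inj (eq_nil_of_tp_eq h.symm)]
  · obtain ⟨x', y', hv, -, hy⟩ := forth_of_tp_succ_eq h x a (fin []) (by simp [cons_fin])
    obtain rfl := eq_nil_of_tp_eq hy.symm
    obtain rfl : v = x' ++ [a] := AnyWord.fin.inj hv
    simp

theorem exists_prepend_of_tp_eq {k : ℕ} {x : List A} {y w : AnyWord A} (hy : y ≠ fin [])
    (h : tp (k + 1) (prepend x y) = tp (k + 1) w) :
    ∃ x' y', w = prepend x' y' ∧ tp k (fin x) = tp k (fin x') ∧ tp k y = tp k y' := by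
  obtain ⟨a, z, rfl⟩ := (eq_nil_or_eq_cons y).resolve_left hy
  obtain ⟨x', y', rfl, hx, hz⟩ := forth_of_tp_succ_eq h x a z rfl
  exact ⟨x', cons a y', rfl, hx, tp_prepend_congr (u := [a]) (u' := [a]) rfl hz⟩

theorem tp_filter_congr (p : A → Bool) {k : ℕ} {u v : List A}
    (h : tp k (fin u) = tp k (fin v)) :
    tp k (fin (u.filter p)) = tp k (fin (v.filter p)) := by
  induction k generalizing u v with
  | zero => rfl
  | succ k ih =>
    suffices forth : ∀ u v : List A, tp (k + 1) (fin u) = tp (k + 1) (fin v) →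
        Forth k (fin (u.filter p)) (fin (v.filter p)) from
      tp_succ_eq_iff.2 ⟨forth _ _ h, forth _ _ h.symm⟩
    intro u v h x a y hw
    obtain ⟨z, hz, rfl⟩ := fin_eq_prepend_cons_iff.1 hw
    obtain ⟨l₁, l₂, rfl, rfl, h₂⟩ := List.filter_eq_append_iff.1 hz
    obtain ⟨l₃, l₄, rfl, h₃, hpa, rfl⟩ := List.filter_eq_cons_iff.1 h₂
    obtain ⟨x', y', hv, hx, hy⟩ := forth_of_tp_succ_eq h (l₁ ++ l₃) a (fin l₄) (by simp)
    obtain ⟨z', rfl, rfl⟩ := fin_eq_prepend_cons_iff.1 hv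
    refine ⟨x'.filter p, fin (z'.filter p), by simp [hpa], ?_, ih hy⟩
    rw [← ih hx, List.filter_append, List.filter_eq_nil_iff.2 h₃, List.append_nil]

/-- The word of the values of `δ` at the pairs of consecutive letters of a word. -/
def pairs (δ : A → A → B) : List A → List B
  | a :: b :: l => δ a b :: pairs δ (b :: l)
  | _ => []

theorem pairs_append (δ : A → A → B) (x : List A) (b : A) (y : List A) :
    pairs δ (x ++ b :: y) = pairs δ (x ++ [b]) ++ pairs δ (b :: y) := by
  induction x with
  | nil => simp [pairs]
  | cons a x ih =>
    cases x with
    | nil => simp [pairs]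
    | cons c x => simpa [pairs] using ih

theorem pairs_eq_append_cons {δ : A → A → B} {N : List A} {x : List B} {c : B} {y : List B}
    (h : pairs δ N = x ++ c :: y) :
    ∃ u a b v, N = u ++ a :: b :: v ∧ pairs δ (u ++ [a]) = x ∧ c = δ a b ∧
      pairs δ (b :: v) = y := by
  induction x generalizing N with
  | nil =>
    match N, h with
    | a :: b :: l, h =>
      simp only [pairs, List.nil_append, List.cons.injEq] at h
      exact ⟨[], a, b, l, rfl, rfl, h.1.symm, h.2⟩
  | cons d x ih =>
    match N, h with
    | a :: b :: l, h =>
      simp only [pairs, List.cons_append, List.cons.injEq] at h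
      obtain ⟨u, a', b', v, hN, hu, hc, hv⟩ := ih h.2
      refine ⟨a :: u, a', b', v, by rw [hN]; rfl, ?_, hc, hv⟩
      cases u with
      | nil => simp_all [pairs]
      | cons e u =>
        simp only [List.cons_append, List.cons.injEq] at hN
        obtain rfl := hN.1
        simp only [List.cons_append, pairs]
        rw [← hu, h.1]; rfl

theorem tp_pairs_congr (δ : A → A → B) {k : ℕ} {u v : List A}
    (h : tp (k + 2) (fin u) = tp (k + 2) (fin v)) :
    tp k (fin (pairs δ u)) = tp k (fin (pairs δ v)) := by
  induction k generalizing u v with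
  | zero => rfl
  | succ k ih =>
    suffices forth : ∀ u v : List A, tp (k + 3) (fin u) = tp (k + 3) (fin v) →
        Forth k (fin (pairs δ u)) (fin (pairs δ v)) from
      tp_succ_eq_iff.2 ⟨forth _ _ h, forth _ _ h.symm⟩
    intro u v h x c y hw
    obtain ⟨z, hz, rfl⟩ := fin_eq_prepend_cons_iff.1 hw
    obtain ⟨l, a, b, r, rfl, rfl, rfl, rfl⟩ := pairs_eq_append_cons hz
    obtain ⟨l', y', hv, hl, hr⟩ := forth_of_tp_succ_eq h l a (fin (b :: r)) rfl
    obtain ⟨z', rfl, rfl⟩ := fin_eq_prepend_cons_iff.1 hv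
    obtain ⟨r', rfl⟩ : ∃ r', z' = b :: r' := by
      obtain ⟨y', hy', -⟩ := exists_cons_of_tp_eq (a := b) (y := fin r) hr
      obtain ⟨r', hr', -⟩ := fin_eq_prepend_cons_iff.1 (hy'.trans (prepend_nil _).symm)
      exact ⟨r', hr'⟩
    refine ⟨pairs δ (l' ++ [a]), fin (pairs δ (b :: r')), ?_, ih (tp_append_congr hl rfl), ih hr⟩
    rw [pairs_append]
    rfl

theorem flatten_eq_append_cons {L : List (List A)} {x z : List A} {a : A}
    (h : L.flatten = x ++ a :: z) :
    ∃ (M₁ : List (List A)) (x₀ z₀ : List A) (M₂ : List (List A)),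
      L = M₁ ++ (x₀ ++ a :: z₀) :: M₂ ∧ x = M₁.flatten ++ x₀ ∧ z = z₀ ++ M₂.flatten := by
  induction L generalizing x with
  | nil => simp at h
  | cons b L ih =>
    have h' : prepend b (fin L.flatten) = prepend x (cons a (fin z)) := by simpa using h
    rcases prepend_eq_prepend_cons_iff.1 h' with ⟨t, rfl, ht⟩ | ⟨t, rfl, ht⟩
    · exact ⟨[], x, t, L, rfl, rfl, by simpa using ht⟩
    · obtain ⟨M₁, x₀, z₀, M₂, rfl, rfl, rfl⟩ := ih (by simpa using ht)
      exact ⟨b :: M₁, x₀, z₀, M₂, rfl, by simp, rfl⟩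

/-- Two exponents that are equal or both at least `2 ^ k - 1`: the `k`-round game does not
distinguish such powers of a word. -/
def AgreeUpTo (k m n : ℕ) : Prop := m = n ∨ 2 ^ k ≤ m + 1 ∧ 2 ^ k ≤ n + 1

theorem AgreeUpTo.symm {k m n : ℕ} (h : AgreeUpTo k m n) : AgreeUpTo k n m :=
  h.imp Eq.symm And.symm

theorem AgreeUpTo.exists_split {k m₁ m₂ n : ℕ} (h : AgreeUpTo (k + 1) (m₁ + 1 + m₂) n) :
    ∃ n₁ n₂, n = n₁ + 1 + n₂ ∧ AgreeUpTo k m₁ n₁ ∧ AgreeUpTo k m₂ n₂ := by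
  have hpos : 0 < 2 ^ k := by positivity
  simp only [AgreeUpTo, pow_succ] at h ⊢
  rcases h with rfl | ⟨hm, hn⟩
  · exact ⟨m₁, m₂, rfl, Or.inl rfl, Or.inl rfl⟩
  by_cases h₁ : m₁ + 1 < 2 ^ k
  · exact ⟨m₁, n - (m₁ + 1), by omega, by omega, by omega⟩
  by_cases h₂ : m₂ + 1 < 2 ^ k
  · exact ⟨n - (m₂ + 1), m₂, by omega, by omega, by omega⟩
  · exact ⟨2 ^ k - 1, n - 2 ^ k, by omega, by omega, by omega⟩

theorem tp_flatten_congr {k : ℕ} {L L' : List (List A)} {v : List A}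
    (hL : ∀ u ∈ L, tp k (fin u) = tp k (fin v)) (hL' : ∀ u ∈ L', tp k (fin u) = tp k (fin v))
    (h : AgreeUpTo k L.length L'.length) :
    tp k (fin L.flatten) = tp k (fin L'.flatten) := by
  induction k generalizing L L' v with
  | zero => rfl
  | succ k ih =>
    suffices forth : ∀ L L' : List (List A), (∀ u ∈ L, tp (k + 1) (fin u) = tp (k + 1) (fin v)) →
        (∀ u ∈ L', tp (k + 1) (fin u) = tp (k + 1) (fin v)) →
        AgreeUpTo (k + 1) L.length L'.length → Forth k (fin L.flatten) (fin L'.flatten) from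
      tp_succ_eq_iff.2 ⟨forth _ _ hL hL' h, forth _ _ hL' hL h.symm⟩
    intro L L' hL hL' h x a y hw
    obtain ⟨z, hz, rfl⟩ := fin_eq_prepend_cons_iff.1 hw
    obtain ⟨M₁, x₀, z₀, M₂, rfl, rfl, rfl⟩ := flatten_eq_append_cons hz
    obtain ⟨n₁, n₂, hn, h₁, h₂⟩ := AgreeUpTo.exists_split (k := k) (m₁ := M₁.length)
      (m₂ := M₂.length) (n := L'.length) (by simpa [add_assoc, add_comm 1] using h)
    obtain ⟨N₁, b, N₂, rfl, rfl, rfl⟩ : ∃ N₁ b N₂,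
        L' = N₁ ++ b :: N₂ ∧ N₁.length = n₁ ∧ N₂.length = n₂ :=
      ⟨L'.take n₁, L'[n₁], L'.drop (n₁ + 1), by simp, by simp; omega, by simp; omega⟩
    obtain ⟨x', y', hb, hx, hy⟩ := forth_of_tp_succ_eq
      ((hL (x₀ ++ a :: z₀) (by simp)).trans (hL' b (by simp)).symm) x₀ a (fin z₀) rfl
    obtain ⟨z', rfl, rfl⟩ := fin_eq_prepend_cons_iff.1 hb
    refine ⟨N₁.flatten ++ x', fin (z' ++ N₂.flatten), by simp,
      tp_append_congr (ih (v := v) ?_ ?_ h₁) hx, tp_append_congr hy (ih (v := v) ?_ ?_ h₂)⟩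
    all_goals intro u hu
    · exact tp_eq_of_tp_succ_eq (hL u (by simp [hu]))
    · exact tp_eq_of_tp_succ_eq (hL' u (by simp [hu]))
    · exact tp_eq_of_tp_succ_eq (hL u (by simp [hu]))
    · exact tp_eq_of_tp_succ_eq (hL' u (by simp [hu]))

open Word

theorem concat_eq_append_concat_tail (f : Stream' (FreeSemigroup A)) :
    concat f = letters f.head ++ₛ concat f.tail := by
  have := OmegaSemigroup.smul_iprod (T := Stream' A) f.head f.tail
  rw [show Stream'.cons f.head f.tail = f from Stream'.eta f] at this
  exact this.symm

theorem inf_concat_eq_prepend_cons {f : Stream' (FreeSemigroup A)} {x : List A} {a : A}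
    {y : AnyWord A} (h : inf (concat f) = prepend x (cons a y)) :
    ∃ b x' z, letters (f.get b) = x' ++ a :: z ∧
      x = ((f.take b).map letters).flatten ++ x' ∧
      y = prepend z (inf (concat (f.drop (b + 1)))) := by
  induction hn : x.length using Nat.strong_induction_on generalizing f x with
  | _ n ih =>
    rw [concat_eq_append_concat_tail, ← prepend_inf, prepend_eq_prepend_cons_iff] at h
    rcases h with ⟨z, hz, rfl⟩ | ⟨z, rfl, hz⟩
    · exact ⟨0, x, z, hz, by simp, rfl⟩
    · have hp := letters_pos f.head
      have hlt : z.length < n := by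
        rw [List.length_append] at hn
        omega
      obtain ⟨b, x', z', h1, rfl, rfl⟩ := ih z.length hlt hz rfl
      exact ⟨b + 1, x', z', h1, by rw [Stream'.take_succ]; simp, rfl⟩

theorem tp_flatten_take_congr {k : ℕ} {f f' : Stream' (FreeSemigroup A)}
    (h : ∀ i, tp k (fin (letters (f.get i))) = tp k (fin (letters (f'.get i)))) (n : ℕ) :
    tp k (fin ((f.take n).map letters).flatten) = tp k (fin ((f'.take n).map letters).flatten) := by
  induction n generalizing f f' with
  | zero => rfl
  | succ n ih =>
    simp only [Stream'.take_succ, List.map_cons, List.flatten_cons]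
    exact tp_append_congr (h 0) (ih (f := f.tail) (f' := f'.tail) fun i => h (i + 1))

theorem concat_eq_flatten_take_append (f : Stream' (FreeSemigroup A)) (n : ℕ) :
    concat f = ((f.take n).map letters).flatten ++ₛ concat (f.drop n) := by
  induction n generalizing f with
  | zero => rfl
  | succ n ih =>
    rw [concat_eq_append_concat_tail, ih f.tail, Stream'.take_succ, List.map_cons,
      List.flatten_cons, Stream'.append_append_stream]
    rfl

theorem tp_concat_congr {k : ℕ} {f f' : Stream' (FreeSemigroup A)}
    (h : ∀ i, tp k (fin (letters (f.get i))) = tp k (fin (letters (f'.get i)))) :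
    tp k (inf (concat f)) = tp k (inf (concat f')) := by
  induction k generalizing f f' with
  | zero => rfl
  | succ k ih =>
    suffices forth : ∀ f f' : Stream' (FreeSemigroup A),
        (∀ i, tp (k + 1) (fin (letters (f.get i))) = tp (k + 1) (fin (letters (f'.get i)))) →
        Forth k (inf (concat f)) (inf (concat f')) from
      tp_succ_eq_iff.2 ⟨forth _ _ h, forth _ _ fun i => (h i).symm⟩
    intro f f' h x a y hw
    obtain ⟨b, x₀, z, hb, rfl, rfl⟩ := inf_concat_eq_prepend_cons hw
    obtain ⟨x', y', hb', hx, hy⟩ := forth_of_tp_succ_eq (hb ▸ h b) x₀ a (fin z) rfl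
    obtain ⟨z', hz', rfl⟩ := fin_eq_prepend_cons_iff.1 hb'
    refine ⟨((f'.take b).map letters).flatten ++ x',
      prepend z' (inf (concat (f'.drop (b + 1)))), ?_,
      tp_append_congr (tp_flatten_take_congr (fun i => tp_eq_of_tp_succ_eq (h i)) b) hx,
      tp_prepend_congr hy (ih fun i => tp_eq_of_tp_succ_eq (h _))⟩
    rw [concat_eq_flatten_take_append f' (b + 1), Stream'.take_succ', List.map_append,
      List.flatten_append]
    simp [hz', Stream'.append_append_stream, cons_inf, Stream'.cons_append_stream]

end AnyWord
/-! ## Domination of paths of the same type -/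

namespace AnyWord

variable {A B : Type*}

/-- The word obtained by applying a map to every letter. -/
def map (g : A → B) : AnyWord A → AnyWord B
  | fin l => fin (l.map g)
  | inf s => inf (s.map g)

theorem map_prepend (g : A → B) (x : List A) (w : AnyWord A) :
    map g (prepend x w) = prepend (x.map g) (map g w) := by
  cases w
  · simp [map]
  · simp [map, Stream'.map_append_stream]

theorem map_cons (g : A → B) (a : A) (w : AnyWord A) : map g (cons a w) = cons (g a) (map g w) :=
  map_prepend g [a] w

theorem exists_of_map_eq_prepend_cons {g : A → B} {w : AnyWord A} {x : List B} {c : B}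
    {y : AnyWord B} (h : map g w = prepend x (cons c y)) :
    ∃ l a r, w = prepend l (cons a r) ∧ l.map g = x ∧ g a = c ∧ map g r = y := by
  induction x generalizing w with
  | nil =>
    rcases eq_nil_or_eq_cons w with rfl | ⟨a, w, rfl⟩
    · exact absurd (h.trans (prepend_nil _)).symm (cons_ne_nil _ _)
    · rw [map_cons, prepend_nil, cons_inj] at h
      exact ⟨[], a, w, (prepend_nil _).symm, rfl, h⟩
  | cons b x ih =>
    rw [prepend_cons] at h
    rcases eq_nil_or_eq_cons w with rfl | ⟨a, w, rfl⟩
    · exact absurd h.symm (cons_ne_nil _ _)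
    · rw [map_cons, cons_inj] at h
      obtain ⟨rfl, h⟩ := h
      obtain ⟨l, a', r, rfl, rfl, rfl, rfl⟩ := ih h
      exact ⟨a :: l, a', r, (prepend_cons ..).symm, rfl, rfl, rfl⟩

theorem tp_map_congr (g : A → B) {k : ℕ} {u v : AnyWord A} (h : tp k u = tp k v) :
    tp k (map g u) = tp k (map g v) := by
  induction k generalizing u v with
  | zero => rfl
  | succ k ih =>
    suffices forth : ∀ u v : AnyWord A, tp (k + 1) u = tp (k + 1) v →
        Forth k (map g u) (map g v) from
      tp_succ_eq_iff.2 ⟨forth _ _ h, forth _ _ h.symm⟩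
    intro u v h x c y hw
    obtain ⟨l, a, r, rfl, rfl, rfl, rfl⟩ := exists_of_map_eq_prepend_cons hw
    obtain ⟨x', y', rfl, hx, hy⟩ := forth_of_tp_succ_eq h l a r rfl
    exact ⟨x'.map g, map g y', by rw [map_prepend, map_cons], ih hx, ih hy⟩

end AnyWord

namespace TransformationMonoid

section Images

variable {Q : Type*}

/-- The images of the maps of a set `F` of self-maps. -/
def images (F : Set (Q → Q)) : Set (Set Q) := Set.range '' F

/-- The preorder on sets of points for which `Y` lies below `X` when some map of `F` sends `X`
onto a superset of `Y`. -/
def Reaches (F : Set (Q → Q)) (X Y : Set Q) : Prop := ∃ f ∈ F, Y ⊆ f '' X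

/-- Each of the two sets is mapped onto the other by a map of `F`. -/
def MutuallyOnto (F : Set (Q → Q)) (X Y : Set Q) : Prop :=
  (∃ f ∈ F, f '' X = Y) ∧ ∃ g ∈ F, g '' Y = X

/-- The number of images strictly below a set for `Reaches`. -/
noncomputable def height (F : Set (Q → Q)) (X : Set Q) : ℕ :=
  {Z ∈ images F | Reaches F X Z ∧ ¬ Reaches F Z X}.ncard

theorem height_lt_ncard [Finite Q] {F : Set (Q → Q)} {X : Set Q} (hX : X ∈ images F) :
    height F X < (images F).ncard := by
  refine Set.ncard_lt_ncard ⟨fun Z hZ => hZ.1, fun hs => ?_⟩ (Set.toFinite _)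
  exact (hs hX).2.2 (hs hX).2.1

theorem mutuallyOnto_and_image_eq_of_reaches [Finite Q] {F : Set (Q → Q)} {X Y : Set Q}
    {f : Q → Q} (hf : f ∈ F) (hXY : f '' X ⊆ Y) (hX : Reaches F (f '' X) X)
    (hY : Reaches F (f '' X) Y) : MutuallyOnto F X Y ∧ f '' X = Y := by
  obtain ⟨g, hg, hX⟩ := hX
  obtain ⟨g', -, hY⟩ := hY
  have card_image_le (h : Q → Q) (Z : Set Q) : (h '' Z).ncard ≤ Z.ncard :=
    Set.ncard_image_le (Set.toFinite _)
  obtain rfl : f '' X = Y := Set.eq_of_subset_of_ncard_le hXY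
    ((Set.ncard_le_ncard hY).trans (card_image_le _ _)) (Set.toFinite _)
  have hback : X = g '' (f '' X) := Set.eq_of_subset_of_ncard_le hX
    ((card_image_le _ _).trans (card_image_le _ _)) (Set.toFinite _)
  exact ⟨⟨⟨f, hf, rfl⟩, ⟨g, hg, hback.symm⟩⟩, rfl⟩

theorem exists_iterate_eq_self [Finite Q] {X : Set Q} {s : Q → Q} (hs : s '' X = X) :
    ∃ n, ∀ x ∈ X, s^[n + 1] x = x := by
  have hmaps : Set.MapsTo s X X := fun x hx => hs ▸ Set.mem_image_of_mem s hx
  have hsurj : Function.Surjective (hmaps.restrict s X X) := by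
    rintro ⟨y, hy⟩
    obtain ⟨x, hx, rfl⟩ := hs.symm ▸ hy
    exact ⟨⟨x, hx⟩, rfl⟩
  let e := Equiv.ofBijective _ (Finite.surjective_iff_bijective.1 hsurj)
  obtain ⟨n, hn, hpow⟩ := (isOfFinOrder_of_finite e).exists_pow_eq_one
  refine ⟨n - 1, fun x hx => ?_⟩
  rw [Nat.sub_add_cancel hn, ← hmaps.coe_iterate_restrict ⟨x, hx⟩ n]
  have hiter : (hmaps.restrict s X X)^[n] = ⇑(e ^ n) := (Equiv.Perm.iterate_eq_pow e n)
  rw [hiter, hpow, Equiv.Perm.one_apply]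

end Images

variable {Q : Type*} [SemilatticeSup Q]

/-- A monoid of sup-preserving maps in which every map `h` is dominated by an inflationary map of
the monoid, simultaneously on all sup-closed sets that `h` permutes. -/
structure IsAbsorbing (F : Set (Q → Q)) : Prop where
  id_mem : id ∈ F
  comp_mem {f g : Q → Q} : f ∈ F → g ∈ F → f ∘ g ∈ F
  map_sup {f : Q → Q} : f ∈ F → ∀ x y, f (x ⊔ y) = f x ⊔ f y
  absorb {h : Q → Q} : h ∈ F → ∃ u ∈ F, ∀ X : Set Q, SupClosed X → h '' X = X →
    ∀ x ∈ X, u x ∈ X ∧ x ≤ u x ∧ h x ≤ u x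

variable {F : Set (Q → Q)}

namespace IsAbsorbing

theorem monotone (hF : IsAbsorbing F) {f : Q → Q} (hf : f ∈ F) : Monotone f := fun x y hxy => by
  rw [← sup_eq_right.2 hxy, hF.map_sup hf]
  exact le_sup_left

theorem supClosed (hF : IsAbsorbing F) {X : Set Q} (hX : X ∈ images F) : SupClosed X := by
  obtain ⟨f, hf, rfl⟩ := hX
  rintro _ ⟨x, rfl⟩ _ ⟨y, rfl⟩
  exact ⟨x ⊔ y, hF.map_sup hf x y⟩

theorem univ_mem_images (hF : IsAbsorbing F) : Set.univ ∈ images F :=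
  ⟨id, hF.id_mem, Set.range_id⟩

theorem image_mem_images (hF : IsAbsorbing F) {X : Set Q} (hX : X ∈ images F) {f : Q → Q}
    (hf : f ∈ F) : f '' X ∈ images F := by
  obtain ⟨g, hg, rfl⟩ := hX
  exact ⟨f ∘ g, hF.comp_mem hf hg, Set.range_comp f g⟩

theorem iterate_mem (hF : IsAbsorbing F) {f : Q → Q} (hf : f ∈ F) (n : ℕ) : f^[n] ∈ F := by
  induction n with
  | zero => exact hF.id_mem
  | succ n ih => exact hF.comp_mem ih hf

theorem reaches_trans (hF : IsAbsorbing F) {X Y Z : Set Q} (hXY : Reaches F X Y)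
    (hYZ : Reaches F Y Z) : Reaches F X Z := by
  obtain ⟨f, hf, hY⟩ := hXY
  obtain ⟨g, hg, hZ⟩ := hYZ
  exact ⟨g ∘ f, hF.comp_mem hg hf, hZ.trans (Set.image_comp g f X ▸ Set.image_mono hY)⟩

theorem mutuallyOnto_refl (hF : IsAbsorbing F) (X : Set Q) : MutuallyOnto F X X :=
  ⟨⟨id, hF.id_mem, Set.image_id X⟩, ⟨id, hF.id_mem, Set.image_id X⟩⟩

theorem mutuallyOnto_trans (hF : IsAbsorbing F) {X Y Z : Set Q} (hXY : MutuallyOnto F X Y)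
    (hYZ : MutuallyOnto F Y Z) : MutuallyOnto F X Z := by
  obtain ⟨⟨f, hf, rfl⟩, ⟨g, hg, hgX⟩⟩ := hXY
  obtain ⟨⟨f', hf', rfl⟩, ⟨g', hg', hgY⟩⟩ := hYZ
  exact ⟨⟨f' ∘ f, hF.comp_mem hf' hf, Set.image_comp _ _ _⟩,
    ⟨g ∘ g', hF.comp_mem hg hg', by rw [Set.image_comp, hgY, hgX]⟩⟩

variable [Finite Q]

theorem height_lt_height (hF : IsAbsorbing F) {X Y : Set Q} (hY : Y ∈ images F)
    (hXY : Reaches F X Y) (hYX : ¬ Reaches F Y X) : height F Y < height F X := by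
  have hmem : Y ∈ {Z ∈ images F | Reaches F X Z ∧ ¬ Reaches F Z X} := ⟨hY, hXY, hYX⟩
  refine Set.ncard_lt_ncard ⟨fun Z hZ => ⟨hZ.1, hF.reaches_trans hXY hZ.2.1, fun hZX =>
    hZ.2.2 (hF.reaches_trans hZX hXY)⟩, fun hs => ?_⟩ (Set.toFinite _)
  exact (hs hmem).2.2 (hs hmem).2.1

theorem height_image_lt (hF : IsAbsorbing F) {X Y : Set Q} (hX : X ∈ images F) {f : Q → Q}
    (hf : f ∈ F) (hXY : f '' X ⊆ Y) (hnot : ¬ (MutuallyOnto F X Y ∧ f '' X = Y)) {d : ℕ}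
    (hXd : height F X < d + 1) (hYd : height F Y < d + 1) : height F (f '' X) < d := by
  have himage := hF.image_mem_images hX hf
  by_cases hback : Reaches F (f '' X) X
  · have hup : ¬ Reaches F (f '' X) Y := fun hup =>
      hnot (mutuallyOnto_and_image_eq_of_reaches hf hXY hback hup)
    have := hF.height_lt_height himage ⟨id, hF.id_mem, by rwa [Set.image_id]⟩ hup
    omega
  · have := hF.height_lt_height himage ⟨f, hf, subset_rfl⟩ hback
    omega

theorem exists_dominating_permutations (hF : IsAbsorbing F) {X : Set Q} (hX : SupClosed X) :
    ∃ V ∈ F, (∀ x ∈ X, V x ∈ X ∧ x ≤ V x) ∧ ∀ h ∈ F, h '' X = X → ∀ x ∈ X, h x ≤ V x := by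
  suffices dominate : ∀ H : Set (Q → Q), H.Finite → (∀ h ∈ H, h ∈ F ∧ h '' X = X) →
      ∃ V ∈ F, (∀ x ∈ X, V x ∈ X ∧ x ≤ V x) ∧ ∀ h ∈ H, ∀ x ∈ X, h x ≤ V x by
    obtain ⟨V, hV, hVX, hdom⟩ :=
      dominate {h | h ∈ F ∧ h '' X = X} (Set.toFinite _) fun h hh => hh
    exact ⟨V, hV, hVX, fun h hh hX => hdom h ⟨hh, hX⟩⟩
  intro H hH
  induction H, hH using Set.Finite.induction_on with
  | empty => exact fun _ => ⟨id, hF.id_mem, fun x hx => ⟨hx, le_rfl⟩, by simp⟩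
  | @insert h H _ _ ih =>
    intro hH
    obtain ⟨V, hV, hVX, hdom⟩ := ih fun h' hh' => hH h' (Or.inr hh')
    obtain ⟨hh, hhX⟩ := hH h (Or.inl rfl)
    obtain ⟨u, hu, habsorb⟩ := hF.absorb hh
    refine ⟨V ∘ u, hF.comp_mem hV hu, fun x hx => ?_, ?_⟩
    · obtain ⟨hux, hle, -⟩ := habsorb X hX hhX x hx
      exact ⟨(hVX _ hux).1, hle.trans (hVX _ hux).2⟩
    · rintro h' (rfl | hh') x hx
      · obtain ⟨hux, -, hle⟩ := habsorb X hX hhX x hx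
        exact hle.trans (hVX _ hux).2
      · exact (hdom h' hh' x hx).trans (hF.monotone hV (habsorb X hX hhX x hx).2.1)

/-- A map `f` from `X` onto `Y` has an inverse `r` on `X`, so that every map `h` from `X` onto `Y`
is `f` after the permutation `r ∘ h` of `X`. -/
theorem exists_connector (hF : IsAbsorbing F) {X Y : Set Q} (hX : SupClosed X)
    (hXY : MutuallyOnto F X Y) : ∃ c ∈ F, Set.MapsTo c X Y ∧
      ∀ h ∈ F, h '' X = Y → ∀ x ∈ X, h x ≤ c x := by
  obtain ⟨⟨f, hf, rfl⟩, ⟨g, hg, hgX⟩⟩ := hXY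
  obtain ⟨V, hV, hVX, hdom⟩ := hF.exists_dominating_permutations hX
  obtain ⟨n, hn⟩ := exists_iterate_eq_self (s := g ∘ f) (X := X) (by rw [Set.image_comp, hgX])
  let r := (g ∘ f)^[n] ∘ g
  have hr : r ∈ F := hF.comp_mem (hF.iterate_mem (hF.comp_mem hg hf) n) hg
  have hrf : ∀ x ∈ X, r (f x) = x := fun x hx => hn x hx
  refine ⟨f ∘ V, hF.comp_mem hf hV, fun x hx => ⟨V x, (hVX x hx).1, rfl⟩,
    fun h hh himage x hx => ?_⟩
  have hfr : f (r (h x)) = h x := by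
    obtain ⟨x', hx', hfx'⟩ : h x ∈ f '' X := himage ▸ Set.mem_image_of_mem h hx
    rw [← hfx', hrf x' hx']
  have hperm : (r ∘ h) '' X = X := by
    rw [Set.image_comp, himage, ← Set.image_comp]
    exact (Set.image_congr hrf).trans (Set.image_id X)
  rw [← hfr]
  exact hF.monotone hf (hdom (r ∘ h) (hF.comp_mem hr hh) hperm x hx)

end IsAbsorbing

/-- A map with a source and a target. -/
structure Arrow (Q : Type*) where
  src : Set Q
  f : Q → Q
  tgt : Set Q

namespace Arrow

section Paths

variable {Q : Type*}

/-- The composite of a word of arrows, applied from left to right. -/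
def run (w : List (Arrow Q)) (x : Q) : Q := w.foldl (fun x n => n.f x) x

/-- The arrows of the word are composable and lead from the first set to the second. -/
def IsPath : Set Q → List (Arrow Q) → Set Q → Prop
  | X, [], Y => X = Y
  | X, n :: w, Y => n.src = X ∧ IsPath n.tgt w Y

theorem isPath_append {X Z : Set Q} {u v : List (Arrow Q)} :
    IsPath X (u ++ v) Z ↔ ∃ Y, IsPath X u Y ∧ IsPath Y v Z := by
  induction u generalizing X with
  | nil => simp [IsPath]
  | cons n u ih => simp only [List.cons_append, IsPath, ih]; grind

theorem run_append_cons (u v : List (Arrow Q)) (n : Arrow Q) (x : Q) :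
    run (u ++ n :: v) x = run v (n.f (run u x)) :=
  List.foldl_append

/-- The arrow is given by a map of `F` between images of `F` of height less than `d`. -/
structure IsBounded (F : Set (Q → Q)) (d : ℕ) (n : Arrow Q) : Prop where
  src_mem : n.src ∈ images F
  tgt_mem : n.tgt ∈ images F
  f_mem : n.f ∈ F
  image_subset : n.f '' n.src ⊆ n.tgt
  src_lt : height F n.src < d
  tgt_lt : height F n.tgt < d

/-- The arrow is onto, and some map of `F` leads back from its target onto its source. -/
def IsTight (F : Set (Q → Q)) (n : Arrow Q) : Prop :=
  MutuallyOnto F n.src n.tgt ∧ n.f '' n.src = n.tgt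

open Classical in
/-- The subword of the arrows that are not tight. -/
noncomputable def loose (F : Set (Q → Q)) (w : List (Arrow Q)) : List (Arrow Q) :=
  w.filter fun n => ¬ IsTight F n

theorem loose_eq_nil_iff {F : Set (Q → Q)} {w : List (Arrow Q)} :
    loose F w = [] ↔ ∀ n ∈ w, IsTight F n := by
  simp [loose, List.filter_eq_nil_iff]

theorem exists_of_loose_eq_cons {F : Set (Q → Q)} {w N : List (Arrow Q)} {n : Arrow Q}
    (h : loose F w = n :: N) :
    ∃ s w', w = s ++ n :: w' ∧ (∀ l ∈ s, IsTight F l) ∧ ¬ IsTight F n ∧ loose F w' = N := by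
  classical
  obtain ⟨s, w', rfl, hs, hn, hN⟩ := List.filter_eq_cons_iff.1 h
  exact ⟨s, w', rfl, fun l hl => by simpa using hs l hl, by simpa using hn, hN⟩

end Paths

open Classical in
/-- A map that dominates all maps of `F` from `X` onto `Y`; the identity if there is none. -/
noncomputable def connector (F : Set (Q → Q)) (X Y : Set Q) : Q → Q :=
  if h : ∃ c ∈ F, Set.MapsTo c X Y ∧ ∀ h ∈ F, h '' X = Y → ∀ x ∈ X, h x ≤ c x then h.choose else id

/-- The arrow between the images of two arrows that are joined by tight arrows. -/
noncomputable def link (F : Set (Q → Q)) (n n' : Arrow Q) : Arrow Q :=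
  ⟨n.f '' n.src, n'.f ∘ connector F n.tgt n'.src, n'.f '' n'.src⟩

theorem monotone_run (hF : IsAbsorbing F) {w : List (Arrow Q)} (hw : ∀ n ∈ w, n.f ∈ F) :
    Monotone (run w) := by
  induction w with
  | nil => exact monotone_id
  | cons n w ih =>
    exact fun x y hxy => ih (fun n hn => hw n (by simp [hn])) (hF.monotone (hw n (by simp)) hxy)

theorem run_onto_of_isTight (hF : IsAbsorbing F) {X Y : Set Q} {w : List (Arrow Q)}
    (hmem : ∀ n ∈ w, n.f ∈ F) (hw : ∀ n ∈ w, IsTight F n) (hp : IsPath X w Y) :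
    run w ∈ F ∧ run w '' X = Y ∧ MutuallyOnto F X Y := by
  induction w generalizing X with
  | nil =>
    obtain rfl : X = Y := hp
    exact ⟨hF.id_mem, Set.image_id X, hF.mutuallyOnto_refl X⟩
  | cons n w ih =>
    obtain ⟨rfl, hp⟩ := hp
    obtain ⟨hrun, honto, hXY⟩ :=
      ih (fun n hn => hmem n (by simp [hn])) (fun n hn => hw n (by simp [hn])) hp
    obtain ⟨hn, himage⟩ := hw n (by simp)
    have hcons : run (n :: w) = run w ∘ n.f := rfl
    exact ⟨hcons ▸ hF.comp_mem hrun (hmem n (by simp)),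
      by rw [hcons, Set.image_comp, himage, honto], hF.mutuallyOnto_trans hn hXY⟩

theorem exists_of_tp_eq_of_loose_eq_cons {k : ℕ} {w w₀ N₀ : List (Arrow Q)} {n : Arrow Q}
    (htp : AnyWord.tp (k + 2) (.fin w) = AnyWord.tp (k + 2) (.fin w₀))
    (hN₀ : loose F w₀ = n :: N₀) :
    ∃ s w', w = s ++ n :: w' ∧ (∀ l ∈ s, IsTight F l) ∧ ¬ IsTight F n ∧
      (loose F w').getLastD n = N₀.getLastD n ∧
      AnyWord.tp k (.fin (AnyWord.pairs (link F) (n :: loose F w'))) =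
        AnyWord.tp k (.fin (AnyWord.pairs (link F) (n :: N₀))) := by
  classical
  have hloose : AnyWord.tp (k + 2) (.fin (loose F w)) = AnyWord.tp (k + 2) (.fin (n :: N₀)) :=
    hN₀ ▸ AnyWord.tp_filter_congr (fun n => ¬ IsTight F n) htp
  obtain ⟨y, hy, -⟩ := AnyWord.exists_cons_of_tp_eq (a := n) (y := .fin N₀) hloose.symm
  obtain ⟨N, hN, -⟩ := AnyWord.fin_eq_prepend_cons_iff.1 (hy.trans (AnyWord.prepend_nil _).symm)
  rw [List.nil_append] at hN
  rw [hN] at hloose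
  obtain ⟨s, w', rfl, hs, hn, rfl⟩ := exists_of_loose_eq_cons hN
  refine ⟨s, w', rfl, hs, hn, ?_, AnyWord.tp_pairs_congr _ hloose⟩
  simpa [List.getLast?_cons] using AnyWord.getLast?_eq_of_tp_eq hloose

variable [Finite Q]

theorem connector_spec (hF : IsAbsorbing F) {X Y : Set Q} (hX : X ∈ images F)
    (hXY : MutuallyOnto F X Y) : connector F X Y ∈ F ∧ Set.MapsTo (connector F X Y) X Y ∧
      ∀ h ∈ F, h '' X = Y → ∀ x ∈ X, h x ≤ connector F X Y x := by
  have hex := hF.exists_connector (hF.supClosed hX) hXY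
  rw [connector, dif_pos hex]
  exact hex.choose_spec

theorem IsBounded.link (hF : IsAbsorbing F) {d : ℕ} {n n' : Arrow Q} (hn : IsBounded F (d + 1) n)
    (hn' : IsBounded F (d + 1) n') (hloose : ¬ IsTight F n) (hloose' : ¬ IsTight F n')
    (hjoin : MutuallyOnto F n.tgt n'.src) : IsBounded F d (link F n n') where
  src_mem := hF.image_mem_images hn.src_mem hn.f_mem
  tgt_mem := hF.image_mem_images hn'.src_mem hn'.f_mem
  f_mem := hF.comp_mem (f := n'.f) hn'.f_mem (connector_spec hF hn.tgt_mem hjoin).1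
  image_subset := by
    rintro _ ⟨y, hy, rfl⟩
    exact ⟨_, (connector_spec hF hn.tgt_mem hjoin).2.1 (hn.image_subset hy), rfl⟩
  src_lt := hF.height_image_lt hn.src_mem hn.f_mem hn.image_subset hloose hn.src_lt hn.tgt_lt
  tgt_lt := hF.height_image_lt hn'.src_mem hn'.f_mem hn'.image_subset hloose' hn'.src_lt hn'.tgt_lt

/-- The loose arrows of a path are turned into a path of links of smaller height, which dominates
the original path: the stretches of tight arrows between loose ones are absorbed by connectors. -/
theorem run_le_run_links (hF : IsAbsorbing F) {d : ℕ} {Y : Set Q} {N w : List (Arrow Q)}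
    {n m : Arrow Q} (hN : loose F w = N) (hm : N.getLastD n = m) (hn : IsBounded F (d + 1) n)
    (hw : ∀ n ∈ w, IsBounded F (d + 1) n) (hloose : ¬ IsTight F n) (hp : IsPath n.tgt w Y) :
    (∀ l ∈ AnyWord.pairs (link F) (n :: N), IsBounded F d l) ∧
    IsPath (n.f '' n.src) (AnyWord.pairs (link F) (n :: N)) (m.f '' m.src) ∧
    IsBounded F (d + 1) m ∧ MutuallyOnto F m.tgt Y ∧
    ∀ y ∈ n.f '' n.src,
      run w y ≤ connector F m.tgt Y (run (AnyWord.pairs (link F) (n :: N)) y) := by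
  induction N generalizing n w with
  | nil =>
    obtain rfl : n = m := hm
    obtain ⟨hrun, honto, hnY⟩ :=
      run_onto_of_isTight hF (fun l hl => (hw l hl).f_mem) (loose_eq_nil_iff.1 hN) hp
    exact ⟨by simp [AnyWord.pairs], rfl, hn, hnY, fun y hy =>
      (connector_spec hF hn.tgt_mem hnY).2.2 _ hrun honto y (hn.image_subset hy)⟩
  | cons n' N ih =>
    obtain ⟨s, w', rfl, hs, hloose', hN'⟩ := exists_of_loose_eq_cons hN
    obtain ⟨_, hps, rfl, hpw'⟩ := isPath_append.1 hp
    have hn' := hw n' (by simp)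
    obtain ⟨hlinks, hpath, hmb, hmY, hle⟩ :=
      ih hN' (by rwa [List.getLastD_cons] at hm) hn' (fun l hl => hw l (by simp [hl])) hloose' hpw'
    obtain ⟨hrun, honto, hjoin⟩ :=
      run_onto_of_isTight hF (fun l hl => (hw l (by simp [hl])).f_mem) hs hps
    obtain ⟨-, hmaps, hdom⟩ := connector_spec hF hn.tgt_mem hjoin
    refine ⟨List.forall_mem_cons.2 ⟨hn.link hF hn' hloose hloose' hjoin, hlinks⟩, ⟨rfl, hpath⟩,
      hmb, hmY, fun y hy => ?_⟩
    have hy := hn.image_subset hy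
    rw [run_append_cons]
    exact (monotone_run hF (fun l hl => (hw l (by simp [hl])).f_mem)
      (hF.monotone hn'.f_mem (hdom _ hrun honto y hy))).trans (hle _ ⟨_, hmaps hy, rfl⟩)

/-- The map `ψ` dominates all paths from `X` to `Y` of type `τ` through images of height less
than `d`. -/
def Dominates (F : Set (Q → Q)) (d : ℕ) {k : ℕ} (τ : RankType (Arrow Q) k) (X Y : Set Q)
    (ψ : Q → Q) : Prop :=
  ∀ w : List (Arrow Q), AnyWord.tp k (.fin w) = τ → (∀ n ∈ w, IsBounded F d n) → IsPath X w Y →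
    ∀ x ∈ X, ψ x ∈ Y ∧ run w x ≤ ψ x

theorem dominates_connector (hF : IsAbsorbing F) {d k : ℕ} {w₀ : List (Arrow Q)} {X Y : Set Q}
    (hX : X ∈ images F) (hw₀ : loose F w₀ = []) :
    Dominates F d (AnyWord.tp (k + 1) (.fin w₀)) X Y (connector F X Y) := by
  classical
  intro w htp hw hp x hx
  have hloose : AnyWord.tp (k + 1) (.fin (loose F w)) = AnyWord.tp (k + 1) (.fin []) :=
    hw₀ ▸ AnyWord.tp_filter_congr (fun n => ¬ IsTight F n) htp
  have hnil : loose F w = [] := AnyWord.fin.inj (AnyWord.eq_nil_of_tp_eq hloose)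
  obtain ⟨hrun, honto, hXY⟩ :=
    run_onto_of_isTight hF (fun l hl => (hw l hl).f_mem) (loose_eq_nil_iff.1 hnil) hp
  obtain ⟨-, hmaps, hdom⟩ := connector_spec hF hX hXY
  exact ⟨hmaps hx, hdom _ hrun honto x hx⟩

theorem Dominates.connector_comp (hF : IsAbsorbing F) {d k : ℕ} {w₀ N₀ : List (Arrow Q)}
    {n m : Arrow Q} {X Y : Set Q} {ψ : Q → Q} (hX : X ∈ images F) (hN₀ : loose F w₀ = n :: N₀)
    (hm : N₀.getLastD n = m)
    (hψ : Dominates F d (AnyWord.tp k (.fin (AnyWord.pairs (link F) (n :: N₀))))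
      (n.f '' n.src) (m.f '' m.src) ψ) :
    Dominates F (d + 1) (AnyWord.tp (k + 2) (.fin w₀)) X Y
      (connector F m.tgt Y ∘ ψ ∘ n.f ∘ connector F X n.src) := by
  intro w htp hw hp x hx
  obtain ⟨s, w', rfl, hs, hloose, hlast, htp'⟩ := exists_of_tp_eq_of_loose_eq_cons htp hN₀
  obtain ⟨_, hps, rfl, hpw'⟩ := isPath_append.1 hp
  have hn := hw n (by simp)
  obtain ⟨hrun, honto, hXn⟩ :=
    run_onto_of_isTight hF (fun l hl => (hw l (by simp [hl])).f_mem) hs hps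
  obtain ⟨hlinks, hpath, hmb, hmY, hle⟩ := run_le_run_links hF rfl (hlast.trans hm) hn
    (fun l hl => hw l (by simp [hl])) hloose hpw'
  obtain ⟨-, hmapsX, hdomX⟩ := connector_spec hF hX hXn
  obtain ⟨hconn, hmapsY, -⟩ := connector_spec hF hmb.tgt_mem hmY
  have hy : n.f (connector F X n.src x) ∈ n.f '' n.src := ⟨_, hmapsX hx, rfl⟩
  obtain ⟨hψm, hψle⟩ := hψ _ htp' hlinks hpath _ hy
  refine ⟨hmapsY (hmb.image_subset hψm), ?_⟩
  rw [run_append_cons]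
  calc run w' (n.f (run s x))
      ≤ run w' (n.f (connector F X n.src x)) :=
        monotone_run hF (fun l hl => (hw l (by simp [hl])).f_mem)
          (hF.monotone hn.f_mem (hdomX _ hrun honto x hx))
    _ ≤ connector F m.tgt Y (run (AnyWord.pairs (link F) (n :: loose F w')) _) := hle _ hy
    _ ≤ connector F m.tgt Y (ψ _) := hF.monotone hconn hψle

theorem exists_dominates (hF : IsAbsorbing F) (d : ℕ) (τ : RankType (Arrow Q) (2 * d)) {X : Set Q}
    (hX : X ∈ images F) (Y : Set Q) : ∃ ψ ∈ F, Dominates F d τ X Y ψ := by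
  induction d generalizing X Y with
  | zero =>
    refine ⟨id, hF.id_mem, fun w _ hw hp x hx => ?_⟩
    cases w with
    | nil => exact ⟨hp ▸ hx, le_rfl⟩
    | cons n w => exact absurd (hw n (by simp)).src_lt (by simp)
  | succ d ih =>
    by_cases hex : ∃ w : List (Arrow Q), AnyWord.tp (2 * (d + 1)) (.fin w) = τ ∧
      (∀ n ∈ w, IsBounded F (d + 1) n) ∧ IsPath X w Y
    swap
    · exact ⟨id, hF.id_mem, fun w hτ hw hp => absurd ⟨w, hτ, hw, hp⟩ hex⟩
    obtain ⟨w, rfl, hw, hp⟩ := hex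
    rcases hN : loose F w with _ | ⟨n, N⟩
    · obtain ⟨-, -, hXY⟩ :=
        run_onto_of_isTight hF (fun l hl => (hw l hl).f_mem) (loose_eq_nil_iff.1 hN) hp
      exact ⟨_, (connector_spec hF hX hXY).1, dominates_connector hF hX hN⟩
    · obtain ⟨s, w', rfl, hs, hloose, hN'⟩ := exists_of_loose_eq_cons hN
      obtain ⟨_, hps, rfl, hpw'⟩ := isPath_append.1 hp
      have hn := hw n (by simp)
      obtain ⟨-, -, hXn⟩ :=
        run_onto_of_isTight hF (fun l hl => (hw l (by simp [hl])).f_mem) hs hps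
      obtain ⟨-, -, hmb, hmY, -⟩ := run_le_run_links hF hN' rfl hn
        (fun l hl => hw l (by simp [hl])) hloose hpw'
      obtain ⟨ψ, hψF, hψ⟩ := ih (AnyWord.tp (2 * d) (.fin (AnyWord.pairs (link F) (n :: N))))
        (hF.image_mem_images hn.src_mem hn.f_mem) _
      exact ⟨_, hF.comp_mem (connector_spec hF hmb.tgt_mem hmY).1 (hF.comp_mem hψF
        (hF.comp_mem hn.f_mem (connector_spec hF hX hXn).1)), hψ.connector_comp hF hX hN rfl⟩

end Arrow

theorem IsAbsorbing.exists_foldl_le [Finite Q] (hF : IsAbsorbing F) {L : Type*} (φ : L → Q → Q)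
    (hφ : ∀ a, φ a ∈ F) (w₀ : List L) : ∃ ψ ∈ F, ∀ w : List L,
      AnyWord.tp (2 * (images F).ncard) (.fin w) = AnyWord.tp (2 * (images F).ncard) (.fin w₀) →
      ∀ x, w.foldl (fun x a => φ a x) x ≤ ψ x := by
  have huniv := hF.univ_mem_images
  let arrow : L → Arrow Q := fun a => ⟨Set.univ, φ a, Set.univ⟩
  obtain ⟨ψ, hψ, hdom⟩ := Arrow.exists_dominates hF _
    (AnyWord.tp (2 * (images F).ncard) (.fin (w₀.map arrow))) huniv Set.univ
  refine ⟨ψ, hψ, fun w hw x => ?_⟩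
  have hpath : ∀ w : List L, Arrow.IsPath Set.univ (w.map arrow) Set.univ := by
    intro w
    induction w with
    | nil => rfl
    | cons a w ih => exact ⟨rfl, ih⟩
  have hbounded : ∀ n ∈ w.map arrow, Arrow.IsBounded F (images F).ncard n := by
    intro n hn
    obtain ⟨a, -, rfl⟩ := List.mem_map.1 hn
    exact ⟨huniv, huniv, hφ a, Set.subset_univ _, height_lt_ncard huniv, height_lt_ncard huniv⟩
  have hle := (hdom _ (AnyWord.tp_map_congr arrow hw) hbounded (hpath w) x trivial).2
  rwa [Arrow.run, List.foldl_map] at hle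

end TransformationMonoid
/-! ## The saturation of the images of the letters -/

namespace Saturation

open scoped Pointwise
open Word

section Powers

variable {S : Type*} [Semigroup S]

/-- The power `X ^ (n + 1)`: a semigroup has no power with exponent `0`. -/
def succPow (X : Set S) : ℕ → Set S
  | 0 => X
  | n + 1 => succPow X n * X

/-- The union of the powers of `X` with exponents in `(N, 2N]`. -/
def unionPow (N : ℕ) (X : Set S) : Set S := {s | ∃ i < N, s ∈ succPow X (N + i)}

theorem mul_succPow (X Y : Set S) (n : ℕ) : Y * succPow X n = (fun Z => Z * X)^[n + 1] Y := by
  induction n with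
  | zero => rfl
  | succ n ih => rw [succPow, ← mul_assoc, ih, Function.iterate_succ_apply' _ (n + 1)]

theorem mul_unionPow (N : ℕ) (X Y : Set S) :
    Y * unionPow N X = ⋃ i < N, (fun Z => Z * X)^[N + i + 1] Y := by
  simp only [← mul_succPow]
  ext s
  simp only [unionPow, Set.mem_mul, Set.mem_ofPred_eq, Set.mem_iUnion]
  grind

theorem succPow_nonempty {X : Set S} (h : X.Nonempty) (n : ℕ) : (succPow X n).Nonempty := by
  induction n with
  | zero => exact h
  | succ n ih => exact ih.mul h

theorem exists_succPow_eq_succPow [Finite S] (X : Set S) :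
    ∃ i j, i < j ∧ j ≤ 2 ^ Nat.card S ∧ succPow X i = succPow X j := by
  have hinj : ¬ Function.Injective fun i : Fin (2 ^ Nat.card S + 1) => succPow X i := by
    have := Fintype.ofFinite S
    intro hinj
    have := Nat.card_le_card_of_injective _ hinj
    simp at this
  obtain ⟨a, b, hab, hne⟩ := Function.not_injective_iff.1 hinj
  rcases lt_or_gt_of_ne hne with h | h
  · exact ⟨a, b, h, by omega, hab⟩
  · exact ⟨b, a, h, by omega, hab.symm⟩

theorem succPow_add_congr {X : Set S} {i j : ℕ} (h : succPow X i = succPow X j) (c : ℕ) :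
    succPow X (i + c) = succPow X (j + c) := by
  induction c with
  | zero => exact h
  | succ c ih => rw [← add_assoc, ← add_assoc, succPow, succPow, ih]

theorem succPow_eq_succPow_add_mul {X : Set S} {i p n : ℕ} (h : succPow X i = succPow X (i + p))
    (hn : i ≤ n) (q : ℕ) : succPow X n = succPow X (n + p * q) := by
  induction q with
  | zero => rfl
  | succ q ih =>
    rw [ih, mul_add, mul_one]
    convert succPow_add_congr h (n + p * q - i) using 2 <;> omega

end Powers

section Absorption

variable {α : Type*} {f : α → α}

theorem iterate_image_eq_self {s : Set α} (hs : f '' s = s) (n : ℕ) : f^[n] '' s = s := by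
  induction n with
  | zero => exact Set.image_id _
  | succ n ih => rw [Function.iterate_succ, Set.image_comp, hs, ih]

theorem isPeriodicPt_of_iterate_eq {s : Set α} (hs : f '' s = s) {i j : ℕ} (hij : i ≤ j)
    (h : f^[i] = f^[j]) {x : α} (hx : x ∈ s) : Function.IsPeriodicPt f (j - i) x := by
  obtain ⟨y, -, rfl⟩ := (iterate_image_eq_self hs i).symm ▸ hx
  rw [Function.IsPeriodicPt, Function.IsFixedPt, ← Function.iterate_add_apply,
    Nat.sub_add_cancel hij, h]

theorem exists_iterate_eq_iterate {x : α} {p : ℕ} (hx : Function.IsPeriodicPt f p x) (hp : 0 < p)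
    {N m : ℕ} (hpN : p ≤ N) (hm : m ≤ N) : ∃ i < N, f^[N + i + 1] x = f^[m] x := by
  have hdiv := Nat.div_add_mod (2 * N - m) p
  have hmod := Nat.mod_lt (2 * N - m) hp
  refine ⟨m + p * ((2 * N - m) / p) - N - 1, by omega, ?_⟩
  rw [show N + (m + p * ((2 * N - m) / p) - N - 1) + 1 = m + p * ((2 * N - m) / p) by omega,
    Function.iterate_add_apply, (hx.mul_const _).eq]

theorem biUnion_mem_of_supClosed {β : Type*} {C : Set (Set β)} (hC : SupClosed C) {N : ℕ}
    (hN : 0 < N) {t : ℕ → Set β} (ht : ∀ i, t i ∈ C) : ⋃ i < N, t i ∈ C := by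
  have hsup := hC.finsetSup'_mem (t := Finset.range N) (Finset.nonempty_range_iff.2 hN.ne')
    (f := t) fun i _ => ht i
  simpa [Finset.sup'_eq_sup, Finset.sup_set_eq_biUnion] using hsup

end Absorption

variable {A S : Type*} [Semigroup S]

/-- The set belongs to the saturation of the images of the letters under products and under
unions of large powers. -/
inductive MemSaturation (g : A → S) : Set S → Prop
  | letter (a : A) : MemSaturation g {g a}
  | mul {X Y : Set S} : MemSaturation g X → MemSaturation g Y → MemSaturation g (X * Y)
  | pow {X : Set S} : MemSaturation g X → MemSaturation g (unionPow (2 ^ Nat.card S) X)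

theorem MemSaturation.nonempty {g : A → S} {X : Set S} (h : MemSaturation g X) : X.Nonempty := by
  induction h with
  | letter a => exact ⟨_, rfl⟩
  | mul _ _ hX hY => exact hX.mul hY
  | pow _ hX =>
    obtain ⟨s, hs⟩ := succPow_nonempty hX (2 ^ Nat.card S + 0)
    exact ⟨s, 0, by positivity, hs⟩

/-- The maps given by right multiplication with the sets of the saturation, and the identity. -/
def rightMultiplications (g : A → S) : Set (Set S → Set S) :=
  insert id ((fun T X => X * T) '' {T | MemSaturation g T})

/-- On a collection of sets permuted by right multiplication with `T`, the powers of this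
permutation with exponents in `(2 ^ |S|, 2 ^ (|S| + 1)]` include its powers `0` and `1`. -/
theorem mul_unionPow_absorbs [Finite S] (T : Set S) {𝒳 : Set (Set S)} (h𝒳 : SupClosed 𝒳)
    (himage : (fun X => X * T) '' 𝒳 = 𝒳) {X : Set S} (hX : X ∈ 𝒳) :
    X * unionPow (2 ^ Nat.card S) T ∈ 𝒳 ∧ X ≤ X * unionPow (2 ^ Nat.card S) T ∧
      X * T ≤ X * unionPow (2 ^ Nat.card S) T := by
  obtain ⟨i, j, hij, hj, hpow⟩ := exists_succPow_eq_succPow T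
  have hiter : (fun Z => Z * T)^[i + 1] = (fun Z => Z * T)^[j + 1] :=
    funext fun Z => by rw [← mul_succPow, ← mul_succPow, hpow]
  have hperiod := isPeriodicPt_of_iterate_eq himage (by omega) hiter hX
  have iterate_le {m : ℕ} (hm : m ≤ 2 ^ Nat.card S) :
      (fun Z => Z * T)^[m] X ≤ X * unionPow (2 ^ Nat.card S) T := by
    obtain ⟨c, hc, hcm⟩ := exists_iterate_eq_iterate hperiod (by omega) (by omega) hm
    rw [mul_unionPow, ← hcm]
    exact Set.subset_biUnion_of_mem (u := fun i => (fun Z => Z * T)^[2 ^ Nat.card S + i + 1] X) hc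
  refine ⟨?_, iterate_le (m := 0) (by positivity), iterate_le (m := 1) Nat.one_le_two_pow⟩
  rw [mul_unionPow]
  exact biUnion_mem_of_supClosed h𝒳 (by positivity) fun n =>
    iterate_image_eq_self himage _ ▸ Set.mem_image_of_mem _ hX

open TransformationMonoid

theorem isAbsorbing_rightMultiplications [Finite S] (g : A → S) :
    IsAbsorbing (rightMultiplications g) where
  id_mem := Or.inl rfl
  comp_mem := by
    rintro _ _ (rfl | ⟨T, hT, rfl⟩) (rfl | ⟨T', hT', rfl⟩)
    · exact Or.inl rfl
    · exact Or.inr ⟨T', hT', rfl⟩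
    · exact Or.inr ⟨T, hT, rfl⟩
    · exact Or.inr ⟨T' * T, hT'.mul hT, funext fun X => (mul_assoc _ _ _).symm⟩
  map_sup := by
    rintro _ (rfl | ⟨T, -, rfl⟩) X Y
    · rfl
    · exact Set.union_mul
  absorb := by
    rintro _ (rfl | ⟨T, hT, rfl⟩)
    · exact ⟨id, Or.inl rfl, fun _ _ _ x hx => ⟨hx, le_rfl, le_rfl⟩⟩
    · exact ⟨_, Or.inr ⟨_, hT.pow, rfl⟩, fun 𝒳 h𝒳 himage X hX =>
        mul_unionPow_absorbs T h𝒳 himage hX⟩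

theorem ncard_images_rightMultiplications_le [Finite S] (g : A → S) :
    (images (rightMultiplications g)).ncard ≤ 2 ^ Nat.card S := by
  have hempty : ∅ ∉ {T | MemSaturation g T} := fun h => Set.not_nonempty_empty h.nonempty
  have hlt : {T | MemSaturation g T}.ncard < 2 ^ Nat.card S :=
    calc {T | MemSaturation g T}.ncard < (Set.univ : Set (Set S)).ncard :=
          Set.ncard_lt_ncard (Set.ssubset_univ_iff.2 fun h => hempty (h ▸ Set.mem_univ _))
      _ = 2 ^ Nat.card S := by
          have := Fintype.ofFinite S
          simp [Set.ncard_univ]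
  calc (images (rightMultiplications g)).ncard
      ≤ (rightMultiplications g).ncard := Set.ncard_image_le (Set.toFinite _)
    _ ≤ ((fun (T X : Set S) => X * T) '' {T | MemSaturation g T}).ncard + 1 :=
        Set.ncard_insert_le _ _
    _ ≤ {T | MemSaturation g T}.ncard + 1 := by gcongr; exact Set.ncard_image_le (Set.toFinite _)
    _ ≤ 2 ^ Nat.card S := hlt

/-- The image of a letter. -/
def letterImage (φ : FreeSemigroup A →ₙ* S) (a : A) : S := φ (FreeSemigroup.of a)

theorem foldl_letterImage (φ : FreeSemigroup A →ₙ* S) (u : FreeSemigroup A) :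
    u.tail.foldl (fun s b => s * letterImage φ b) (letterImage φ u.head) = φ u := by
  obtain ⟨a, l⟩ := u
  change l.foldl (fun s b => s * letterImage φ b) (letterImage φ a) = _
  induction l using List.reverseRecOn with
  | nil => rfl
  | append_singleton l b ih =>
    rw [List.foldl_append, ih]
    exact (map_mul φ ⟨a, l⟩ (FreeSemigroup.of b)).symm

theorem foldl_mul_singleton (g : A → S) (s : S) (l : List A) :
    l.foldl (fun X b => X * {g b}) ({s} : Set S) = {l.foldl (fun s b => s * g b) s} := by
  induction l generalizing s with
  | nil => rfl
  | cons c l ih => rw [List.foldl_cons, Set.singleton_mul_singleton, ih, List.foldl_cons]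

/-- The rank at which the values of words are controlled by the saturation. -/
noncomputable def rank (S : Type*) : ℕ := 2 * 2 ^ Nat.card S + 1

theorem exists_memSaturation_of_tp_eq [Finite S] (φ : FreeSemigroup A →ₙ* S)
    (u₀ : FreeSemigroup A) :
    ∃ T, MemSaturation (letterImage φ) T ∧ ∀ u, AnyWord.tp (rank S) (.fin (letters u)) =
      AnyWord.tp (rank S) (.fin (letters u₀)) → φ u ∈ T := by
  obtain ⟨a, r₀⟩ := u₀
  obtain ⟨ψ, hψ, hle⟩ := (isAbsorbing_rightMultiplications (letterImage φ)).exists_foldl_le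
    (fun b X => X * {letterImage φ b}) (fun b => Or.inr ⟨_, .letter b, rfl⟩) r₀
  refine ⟨ψ {letterImage φ a}, ?_, fun u hu => ?_⟩
  · rcases hψ with rfl | ⟨T, hT, rfl⟩
    · exact .letter a
    · exact (MemSaturation.letter a).mul hT
  · obtain ⟨k, hk⟩ : ∃ k, 2 * 2 ^ Nat.card S = k + 1 :=
      Nat.exists_eq_add_one.2 (by positivity)
    rw [rank, hk] at hu
    obtain ⟨y, hy, htp⟩ := AnyWord.exists_cons_of_tp_eq (a := a) (y := .fin r₀) hu.symm
    obtain ⟨r, hr, rfl⟩ :=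
      AnyWord.fin_eq_prepend_cons_iff.1 (hy.trans (AnyWord.prepend_nil _).symm)
    obtain ⟨b, r'⟩ := u
    obtain ⟨rfl, rfl⟩ : b = a ∧ r' = r := List.cons.inj hr
    have hrank : 2 * (images (rightMultiplications (letterImage φ))).ncard ≤ k + 1 :=
      hk ▸ Nat.mul_le_mul_left 2 (ncard_images_rightMultiplications_le _)
    have hmem := hle r' (AnyWord.tp_eq_of_le hrank htp.symm) {letterImage φ b}
    rw [foldl_mul_singleton] at hmem
    exact foldl_letterImage φ ⟨b, r'⟩ ▸ hmem rfl

theorem exists_flatten_of_mem_succPow {φ : FreeSemigroup A →ₙ* S} {X : Set S} {k : ℕ}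
    {τ : RankType A k} (hτ : ∀ t ∈ X, ∃ u, φ u = t ∧ AnyWord.tp k (.fin (letters u)) = τ) (n : ℕ)
    {s : S} (hs : s ∈ succPow X n) :
    ∃ u L, φ u = s ∧ letters u = List.flatten L ∧ L.length = n + 1 ∧
      ∀ w ∈ L, AnyWord.tp k (.fin w) = τ := by
  induction n generalizing s with
  | zero =>
    obtain ⟨u, rfl, hu⟩ := hτ s hs
    exact ⟨u, [letters u], rfl, by simp, rfl, by simpa using hu⟩
  | succ n ih =>
    obtain ⟨s, hs, t, ht, rfl⟩ := hs
    obtain ⟨u, L, rfl, hflat, hlen, hL⟩ := ih hs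
    obtain ⟨w, rfl, hw⟩ := hτ t ht
    refine ⟨u * w, L ++ [letters w], map_mul φ u w, ?_, by simp [hlen], ?_⟩
    · rw [letters_mul, hflat, List.flatten_append, List.flatten_singleton]
    · rw [List.forall_mem_append]
      exact ⟨hL, by simpa using hw⟩

theorem MemSaturation.exists_words [Finite S] (φ : FreeSemigroup A →ₙ* S) {T : Set S}
    (hT : MemSaturation (letterImage φ) T) (k : ℕ) :
    ∃ τ, ∀ t ∈ T, ∃ u, φ u = t ∧ AnyWord.tp k (.fin (letters u)) = τ := by
  induction hT with
  | letter a => exact ⟨_, fun t ht => ⟨_, (Set.mem_singleton_iff.1 ht).symm, rfl⟩⟩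
  | mul hX hY ih ih' =>
    obtain ⟨σ, hσ⟩ := ih
    obtain ⟨τ, hτ⟩ := ih'
    obtain ⟨u₀, -, hu₀⟩ := hσ _ hX.nonempty.some_mem
    obtain ⟨v₀, -, hv₀⟩ := hτ _ hY.nonempty.some_mem
    refine ⟨AnyWord.tp k (.fin (letters (u₀ * v₀))), ?_⟩
    rintro _ ⟨s, hs, t, ht, rfl⟩
    obtain ⟨u, rfl, hu⟩ := hσ s hs
    obtain ⟨v, rfl, hv⟩ := hτ t ht
    refine ⟨u * v, map_mul φ u v, ?_⟩
    rw [letters_mul, letters_mul]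
    exact AnyWord.tp_append_congr (hu.trans hu₀.symm) (hv.trans hv₀.symm)
  | @pow X hX ih =>
    obtain ⟨τ, hτ⟩ := ih
    obtain ⟨v, -, hv⟩ := hτ _ hX.nonempty.some_mem
    refine ⟨AnyWord.tp k (.fin (List.replicate (2 ^ k) (letters v)).flatten), ?_⟩
    rintro s ⟨i, hi, hs⟩
    obtain ⟨a, b, hab, hb, hpow⟩ := exists_succPow_eq_succPow X
    -- By periodicity the exponent may be taken so large that the number of factors is irrelevant.
    rw [succPow_eq_succPow_add_mul (i := a) (p := b - a) (by rw [hpow]; congr 1; omega) (by omega)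
      (2 ^ k)] at hs
    obtain ⟨u, L, rfl, hflat, hlen, hL⟩ := exists_flatten_of_mem_succPow hτ _ hs
    refine ⟨u, rfl, ?_⟩
    rw [hflat]
    refine AnyWord.tp_flatten_congr (v := letters v) (fun w hw => (hL w hw).trans hv.symm)
      (fun w hw => by rw [List.eq_of_mem_replicate hw]) (Or.inr ?_)
    have : 2 ^ k ≤ (b - a) * 2 ^ k := Nat.le_mul_of_pos_left _ (by omega)
    rw [hlen, List.length_replicate]
    omega

variable {T : Type*} [OmegaSemigroup S T]

/-- Two values of infinite words that the saturation does not tell apart: they are of the form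
`x e e e ⋯` and `y f f f ⋯` with `x, y` in one set of the saturation and `e, f` in another. -/
def Close (g : A → S) (p q : T) : Prop :=
  ∃ X E : Set S, MemSaturation g X ∧ MemSaturation g E ∧ ∃ x ∈ X, ∃ y ∈ X, ∃ e ∈ E, ∃ f ∈ E,
    p = x • (OmegaSemigroup.iprod (Stream'.const e) : T) ∧
    q = y • (OmegaSemigroup.iprod (Stream'.const f) : T)

theorem Close.exists_words [Finite S] {α : OmegaHom (FreeSemigroup A) (Stream' A) S T} {p q : T}
    (h : Close (letterImage α.fin) p q) (k : ℕ) :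
    ∃ w w' : Stream' A, α.inf w = p ∧ α.inf w' = q ∧
      AnyWord.tp k (.inf w) = AnyWord.tp k (.inf w') := by
  obtain ⟨X, E, hX, hE, x, hx, y, hy, e, he, f, hf, rfl, rfl⟩ := h
  obtain ⟨σ, hσ⟩ := hX.exists_words α.fin k
  obtain ⟨τ, hτ⟩ := hE.exists_words α.fin k
  obtain ⟨u, rfl, hu⟩ := hσ x hx
  obtain ⟨u', rfl, hu'⟩ := hσ y hy
  obtain ⟨v, rfl, hv⟩ := hτ e he
  obtain ⟨v', rfl, hv'⟩ := hτ f hf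
  refine ⟨u • OmegaSemigroup.iprod (Stream'.const v),
    u' • OmegaSemigroup.iprod (Stream'.const v'), ?_, ?_, ?_⟩
  · rw [α.map_smul, α.map_iprod, Stream'.map_const]
  · rw [α.map_smul, α.map_iprod, Stream'.map_const]
  · exact AnyWord.tp_prepend_congr (hu.trans hu'.symm)
      (AnyWord.tp_concat_congr (f := Stream'.const v) (f' := Stream'.const v')
        fun i => hv.trans hv'.symm)

end Saturation
/-! ## Infinite words of the same type -/

instance RankType.finite {A : Type*} [Finite A] (k : ℕ) : Finite (RankType A k) := by
  induction k with
  | zero => exact inferInstanceAs (Finite PUnit)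
  | succ k ih => exact inferInstanceAs (Finite (Set (RankType A k × A × RankType A k)))

section Ramsey

variable {C : Type*} [Finite C]

theorem exists_eventually_eq_of_finite {ι : Type*} (l : Ultrafilter ι) (f : ι → C) :
    ∃ γ, ∀ᶠ i in (l : Filter ι), f i = γ := by
  obtain ⟨γ, hγ⟩ := Ultrafilter.eq_pure_of_finite (l.map f)
  have hmem : {γ} ∈ l.map f := hγ ▸ rfl
  exact ⟨γ, hmem⟩

theorem exists_strictMono_homogeneous (c : ℕ → ℕ → C) :
    ∃ (k : ℕ → ℕ) (γ : C), StrictMono k ∧ ∀ i j, i < j → c (k i) (k j) = γ := by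
  choose γ hγ using fun i => exists_eventually_eq_of_finite (Filter.hyperfilter ℕ) (c i)
  obtain ⟨δ, hδ⟩ := exists_eventually_eq_of_finite (Filter.hyperfilter ℕ) γ
  obtain ⟨k, -, hk⟩ := exists_seq_of_forall_finset_exists (fun i => γ i = δ)
    (fun i j => i < j ∧ c i j = δ) fun s hs => by
      have extend : ∀ᶠ j in (Filter.hyperfilter ℕ : Filter ℕ), ∀ i ∈ s, i < j ∧ c i j = δ := by
        rw [Filter.eventually_all_finset]
        intro i hi
        have hgt : ∀ᶠ j in (Filter.hyperfilter ℕ : Filter ℕ), i < j :=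
          Nat.hyperfilter_le_atTop (Filter.eventually_gt_atTop i)
        filter_upwards [hgt, hγ i] with j hij hcolour
        exact ⟨hij, hcolour.trans (hs i hi)⟩
      exact (hδ.and extend).exists
  exact ⟨k, δ, fun i j hij => (hk i j hij).1, fun i j hij => (hk i j hij).2⟩

end Ramsey

namespace Word

variable {A : Type*}

/-- The factor of an infinite word made of the positions `n` with `i ≤ n < j`. -/
def factor (w : Stream' A) (i j : ℕ) : List A := (w.drop i).take (j - i)

theorem length_factor (w : Stream' A) (i j : ℕ) : (factor w i j).length = j - i :=
  Stream'.length_take _ _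

theorem factor_append_factor (w : Stream' A) {i j l : ℕ} (hij : i ≤ j) (hjl : j ≤ l) :
    factor w i j ++ factor w j l = factor w i l := by
  obtain ⟨a, rfl⟩ := Nat.exists_eq_add_of_le hij
  obtain ⟨b, rfl⟩ := Nat.exists_eq_add_of_le hjl
  rw [factor, factor, factor, Nat.add_sub_cancel_left, Nat.add_sub_cancel_left, add_assoc,
    Nat.add_sub_cancel_left, Stream'.take_add, Stream'.drop_drop]

theorem factor_append_drop (w : Stream' A) {i j : ℕ} (hij : i ≤ j) :
    factor w i j ++ₛ w.drop j = w.drop i := by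
  obtain ⟨a, rfl⟩ := Nat.exists_eq_add_of_le hij
  rw [factor, Nat.add_sub_cancel_left, ← Stream'.drop_drop]
  exact Stream'.append_take_drop _ _

theorem eq_take_and_eq_drop_of_eq_append {x : List A} {y w : Stream' A} (h : w = x ++ₛ y) :
    x = w.take x.length ∧ y = w.drop x.length := by
  subst h
  exact ⟨by simpa using Stream'.append_take 0 x y, (Stream'.drop_append_stream _ _).symm⟩

theorem eq_factor_of_append_eq_factor {w : Stream' A} {i j : ℕ} {x y : List A}
    (h : x ++ y = factor w i j) (hij : i ≤ j) :
    i + x.length ≤ j ∧ x = factor w i (i + x.length) ∧ y = factor w (i + x.length) j := by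
  have hlength := congrArg List.length h
  rw [length_factor, List.length_append] at hlength
  have hle : i + x.length ≤ j := by omega
  rw [← factor_append_factor w (Nat.le_add_right i x.length) hle] at h
  exact ⟨hle, List.append_inj h (by rw [length_factor, Nat.add_sub_cancel_left])⟩

theorem eq_of_common_prefixes {w w' : Stream' A}
    (h : ∀ n, ∃ (x : List A) (y y' : Stream' A), n ≤ x.length ∧ w = x ++ₛ y ∧ w' = x ++ₛ y') :
    w = w' := by
  refine Stream'.ext fun n => ?_
  obtain ⟨x, y, y', hn, rfl, rfl⟩ := h (n + 1)
  rw [Stream'.get_append_left _ _ _ hn, Stream'.get_append_left _ _ _ hn]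

/-- The factor between the positions `i < j` as an element of the semigroup of nonempty words;
for `j ≤ i` it is a single letter. -/
def block (w : Stream' A) (i j : ℕ) : FreeSemigroup A := ⟨w.get i, factor w (i + 1) j⟩

theorem letters_block (w : Stream' A) {i j : ℕ} (h : i < j) :
    letters (block w i j) = factor w i j := by
  have hsingle : factor w i i.succ = [w.get i] := by simp [factor, Stream'.take_succ]
  rw [← factor_append_factor w (Nat.le_succ i) h, hsingle]
  rfl

/-- The factors of an infinite word between consecutive positions of a sequence. -/
def factorization (w : Stream' A) (m : ℕ → ℕ) : Stream' (FreeSemigroup A) :=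
  fun i => block w (m i) (m (i + 1))

theorem flatten_take_factorization (w : Stream' A) {m : ℕ → ℕ} (hm : StrictMono m) (n : ℕ) :
    (((factorization w m).take n).map letters).flatten = factor w (m 0) (m n) := by
  induction n with
  | zero => simp [factor]
  | succ n ih =>
    have hlt : m n < m (n + 1) := hm (Nat.lt_succ_self n)
    rw [Stream'.take_succ', List.map_append, List.flatten_append, ih]
    change _ ++ [letters (block w (m n) (m (n + 1)))].flatten = _
    rw [List.flatten_singleton, letters_block w hlt,
      factor_append_factor w (hm.monotone (Nat.zero_le n)) hlt.le]

theorem drop_eq_concat_factorization (w : Stream' A) {m : ℕ → ℕ} (hm : StrictMono m) :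
    w.drop (m 0) = concat (factorization w m) := by
  refine eq_of_common_prefixes fun n => ⟨factor w (m 0) (m n), w.drop (m n),
    concat ((factorization w m).drop n), ?_,
    (factor_append_drop w (hm.monotone (Nat.zero_le n))).symm, ?_⟩
  · have hlen := hm.add_le_nat n 0
    rw [length_factor]
    rw [Nat.add_zero] at hlen
    omega
  · rw [← flatten_take_factorization w hm n]
    exact AnyWord.concat_eq_flatten_take_append _ n

end Word

namespace AnyWord

open Word

variable {A : Type*} {k r : ℕ} {w w' : Stream' A}

theorem exists_position_of_tp_drop_eq {i i' : ℕ}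
    (h : tp (k + 1) (inf (w.drop i)) = tp (k + 1) (inf (w'.drop i'))) {j : ℕ} (hj : i ≤ j) :
    ∃ j', i' ≤ j' ∧ tp k (fin (factor w i j)) = tp k (fin (factor w' i' j')) ∧
      tp k (inf (w.drop j)) = tp k (inf (w'.drop j')) := by
  rw [← factor_append_drop w hj, ← prepend_inf] at h
  obtain ⟨x, y, heq, hx, hy⟩ := exists_prepend_of_tp_eq (by simp) h
  rcases y with y | y
  · simp at heq
  · simp only [prepend_inf, inf.injEq] at heq
    obtain ⟨hxw, hyw⟩ := eq_take_and_eq_drop_of_eq_append heq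
    refine ⟨i' + x.length, Nat.le_add_right _ _, ?_, ?_⟩
    · rw [hx, factor, Nat.add_sub_cancel_left, ← hxw]
    · rw [hy, ← Stream'.drop_drop, ← hyw]

theorem exists_position_of_tp_factor_eq (hr : 0 < r) {i n j i' j' : ℕ} (hin : i ≤ n) (hnj : n < j)
    (hij' : i' ≤ j')
    (h : tp (r + 1) (fin (factor w i j)) = tp (r + 1) (fin (factor w' i' j'))) :
    ∃ n', i' ≤ n' ∧ n' < j' ∧ tp r (fin (factor w i n)) = tp r (fin (factor w' i' n')) ∧
      tp r (fin (factor w n j)) = tp r (fin (factor w' n' j')) := by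
  have hne : factor w n j ≠ [] := by
    rw [← List.length_pos_iff, length_factor]
    omega
  rw [← factor_append_factor w hin hnj.le, ← prepend_fin] at h
  obtain ⟨x, y, heq, hx, hy⟩ := exists_prepend_of_tp_eq (by simpa using hne) h
  rcases y with y | y
  swap
  · simp at heq
  simp only [prepend_fin, fin.injEq] at heq
  obtain ⟨hle, hxw, hyw⟩ := eq_factor_of_append_eq_factor heq.symm hij'
  refine ⟨i' + x.length, Nat.le_add_right _ _, hle.lt_of_ne fun hlast => hne ?_, by rw [← hxw, hx],
    by rw [← hyw, hy]⟩
  have hnil : y = [] := by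
    rw [hyw, ← List.length_eq_zero_iff, length_factor]
    omega
  obtain ⟨r, rfl⟩ := Nat.exists_eq_add_of_lt hr
  rw [hnil] at hy
  simpa using eq_nil_of_tp_eq hy

/-- The congruence of finite words of the same type. -/
def tpCon (A : Type*) (r : ℕ) : Con (FreeMonoid A) where
  r u v := tp r (fin u.toList) = tp r (fin v.toList)
  iseqv := ⟨fun _ => rfl, Eq.symm, Eq.trans⟩
  mul' hu hv := tp_append_congr hu hv

/-- The type of a factor of an infinite word, as an element of the finite monoid of types. -/
def factorType (r : ℕ) (w : Stream' A) (i j : ℕ) : (tpCon A r).Quotient :=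
  (FreeMonoid.ofList (factor w i j) : (tpCon A r).Quotient)

theorem factorType_eq_iff {i j i' j' : ℕ} : factorType r w i j = factorType r w' i' j' ↔
    tp r (fin (factor w i j)) = tp r (fin (factor w' i' j')) :=
  (tpCon A r).eq

theorem factorType_eq_of_tp_eq (hrk : r ≤ k) {i j i' j' : ℕ}
    (h : tp k (fin (factor w i j)) = tp k (fin (factor w' i' j'))) :
    factorType r w i j = factorType r w' i' j' :=
  factorType_eq_iff.2 (tp_eq_of_le hrk h)

theorem factorType_mul (r : ℕ) (w : Stream' A) {i j l : ℕ} (hij : i ≤ j) (hjl : j ≤ l) :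
    factorType r w i j * factorType r w j l = factorType r w i l := by
  rw [factorType, factorType, factorType, ← factor_append_factor w hij hjl]
  rfl

/-- The positions of the sequence cut the word into factors of one and the same type, and this
remains so when consecutive factors are merged. -/
def IsHomogeneous (w : Stream' A) (p : ℕ → ℕ) (τ : (tpCon A r).Quotient) : Prop :=
  StrictMono p ∧ ∀ i j, i < j → factorType r w (p i) (p j) = τ

theorem IsHomogeneous.isIdempotentElem {p : ℕ → ℕ} {τ : (tpCon A r).Quotient}
    (h : IsHomogeneous w p τ) : IsIdempotentElem τ := by
  have hmul := factorType_mul r w (h.1.monotone (Nat.le_add_right 0 1))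
    (h.1.monotone (Nat.le_add_right 1 1))
  rwa [h.2 0 1 (by simp), h.2 1 2 (by simp), h.2 0 2 (by simp)] at hmul

theorem IsHomogeneous.factorType_mul_self {p : ℕ → ℕ} {τ : (tpCon A r).Quotient}
    (h : IsHomogeneous w p τ) {i n : ℕ} (hi : i ≤ p n) :
    factorType r w i (p (n + 1)) * τ = factorType r w i (p (n + 1)) := by
  rw [← factorType_mul r w hi (h.1.monotone n.le_succ), h.2 _ _ n.lt_succ_self, mul_assoc,
    h.isIdempotentElem]

theorem isHomogeneous_of_consecutive {m : ℕ → ℕ} (hm : StrictMono m) {τ : (tpCon A r).Quotient}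
    (hτ : IsIdempotentElem τ) (h : ∀ i, factorType r w (m i) (m (i + 1)) = τ) :
    IsHomogeneous w m τ := by
  refine ⟨hm, fun i j hij => ?_⟩
  induction j, hij using Nat.le_induction with
  | base => exact h i
  | succ j hj ih =>
    rw [← factorType_mul r w (hm.monotone (by omega)) (hm.monotone j.le_succ), ih, h, hτ]

theorem IsHomogeneous.factorType_zero {m : ℕ → ℕ} {σ τ : (tpCon A r).Quotient}
    (h : IsHomogeneous w m τ) (hστ : σ * τ = σ) (h0 : factorType r w 0 (m 0) = σ) (i : ℕ) :
    factorType r w 0 (m i) = σ := by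
  rcases i.eq_zero_or_pos with rfl | hi
  · exact h0
  · rw [← factorType_mul r w (Nat.zero_le _) (h.1.monotone hi.le), h0, h.2 0 i hi, hστ]

theorem mul_eq_of_mul_eq {M : Type*} [Semigroup M] {E Z R τ τ' : M} (hZE : Z * E = τ)
    (hER : E * R = τ') (hEτ : E * τ = E) (hZτ' : Z * τ' = Z) : E * Z = τ' :=
  calc E * Z = E * (Z * (E * R)) := by rw [hER, hZτ']
    _ = E * (Z * E) * R := by simp only [mul_assoc]
    _ = τ' := by rw [hZE, hEτ, hER]

/-- In the game on `w` and `w'` one plays four cuts, alternately far out in the sequences `q` and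
`p`; `mul_eq_of_mul_eq` applies to the types of the factors which the answers delimit. -/
theorem exists_cut_of_isHomogeneous {p q : ℕ → ℕ} {τ τ' : (tpCon A r).Quotient}
    (hp : IsHomogeneous w p τ) (hq : IsHomogeneous w' q τ')
    (h : tp (r + 4) (inf w) = tp (r + 4) (inf w')) :
    ∃ i j n, i < j ∧ 0 < p i ∧ p i ≤ n ∧ n < p j ∧ factorType r w 0 n = factorType r w' 0 (q 2) ∧
      factorType r w n (p j) * factorType r w (p i) n = τ' := by
  have le_p (n : ℕ) : n + 2 ≤ p (n + 2) := hp.1.le_apply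
  have le_q (n : ℕ) : n + 2 ≤ q (n + 2) := hq.1.le_apply
  obtain ⟨s₀, -, hX, h₀⟩ :=
    exists_position_of_tp_drop_eq (i := 0) (i' := 0) h.symm (Nat.zero_le (q 1))
  obtain ⟨s₁, hs₁, hH, h₁⟩ := exists_position_of_tp_drop_eq h₀.symm (j := p (s₀ + 2)) (by grind)
  obtain ⟨s₂, hs₂, hZ, h₂⟩ := exists_position_of_tp_drop_eq h₁.symm (j := q (s₁ + 2)) (by grind)
  obtain ⟨s₃, hs₃, hE, -⟩ := exists_position_of_tp_drop_eq h₂.symm (j := p (s₂ + 2)) (by grind)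
  replace hX := factorType_eq_of_tp_eq (by omega : r ≤ r + 3) hX
  replace hH := factorType_eq_of_tp_eq (by omega : r ≤ r + 2) hH
  replace hZ := factorType_eq_of_tp_eq (by omega : r ≤ r + 1) hZ
  replace hE := factorType_eq_of_tp_eq le_rfl hE
  have hHZ : factorType r w s₀ (p (s₀ + 2)) * factorType r w (p (s₀ + 2)) s₂ = τ' := by
    rw [hH, ← hZ, factorType_mul r w' hs₁ (by grind), hq.2 _ _ (by omega)]
  have hZE : factorType r w (p (s₀ + 2)) s₂ * factorType r w s₂ (p (s₂ + 2)) = τ := by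
    rw [factorType_mul r w hs₂ (by grind), hp.2 _ _ (by grind)]
  have hER : factorType r w s₂ (p (s₂ + 2)) * factorType r w' s₃ (q (s₃ + 2)) = τ' := by
    rw [hE, factorType_mul r w' hs₃ (by grind), hq.2 _ _ (by grind)]
  have hZτ' : factorType r w (p (s₀ + 2)) s₂ * τ' = factorType r w (p (s₀ + 2)) s₂ := by
    rw [← hZ, hq.factorType_mul_self (hq.1.le_apply.trans' (by omega))]
  have hEτ : factorType r w s₂ (p (s₂ + 2)) * τ = factorType r w s₂ (p (s₂ + 2)) :=
    hp.factorType_mul_self (hp.1.le_apply.trans' (by omega))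
  refine ⟨s₀ + 2, s₂ + 2, s₂, by grind, by grind, hs₂, by grind, ?_, ?_⟩
  · rw [← factorType_mul r w (Nat.zero_le s₀) (by grind), ← hX,
      ← factorType_mul r w (by grind : s₀ ≤ p (s₀ + 2)) hs₂, hHZ, ← hq.2 1 2 (by simp),
      factorType_mul r w' (Nat.zero_le _) (hq.1.monotone (by simp))]
  · exact mul_eq_of_mul_eq hZE hER hEτ hZτ'

theorem exists_cuts_of_isHomogeneous (hr : 0 < r) {p : ℕ → ℕ} {σ : (tpCon A (r + 1)).Quotient}
    (hp : IsHomogeneous w p σ) {i j n : ℕ} (hij : i < j) (hin : p i ≤ n) (hnj : n < p j) (l : ℕ) :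
    ∃ n', p (i + l) ≤ n' ∧ n' < p (i + (l + 1)) ∧
      factorType r w (p (i + l)) n' = factorType r w (p i) n ∧
      factorType r w n' (p (i + (l + 1))) = factorType r w n (p j) := by
  have hlt : i + l < i + (l + 1) := by omega
  obtain ⟨n', hle, hlt, hleft, hright⟩ := exists_position_of_tp_factor_eq hr hin hnj
    (hp.1.monotone hlt.le) (factorType_eq_iff.1 ((hp.2 _ _ hij).trans (hp.2 _ _ hlt).symm))
  exact ⟨n', hle, hlt, factorType_eq_iff.2 hleft.symm, factorType_eq_iff.2 hright.symm⟩

theorem exists_isHomogeneous [Finite A] (r : ℕ) (w : Stream' A) :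
    ∃ (p : ℕ → ℕ) (τ : (tpCon A r).Quotient), IsHomogeneous w p τ := by
  obtain ⟨p, γ, hp, hγ⟩ := exists_strictMono_homogeneous fun i j => tp r (fin (factor w i j))
  exact ⟨p, factorType r w (p 0) (p 1), hp, fun i j hij =>
    factorType_eq_iff.2 ((hγ i j hij).trans (hγ 0 1 Nat.zero_lt_one).symm)⟩

theorem IsHomogeneous.of_succ {p : ℕ → ℕ} {σ : (tpCon A (r + 1)).Quotient}
    (h : IsHomogeneous w p σ) : IsHomogeneous w p (factorType r w (p 0) (p 1)) :=
  ⟨h.1, fun i j hij => factorType_eq_of_tp_eq r.le_succ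
    (factorType_eq_iff.1 ((h.2 i j hij).trans (h.2 0 1 Nat.zero_lt_one).symm))⟩

theorem exists_isHomogeneous_of_tp_eq [Finite A] (hr : 0 < r)
    (h : tp (r + 4) (inf w) = tp (r + 4) (inf w')) :
    ∃ (m m' : ℕ → ℕ) (σ τ : (tpCon A r).Quotient), 0 < m 0 ∧ 0 < m' 0 ∧
      IsHomogeneous w m τ ∧ IsHomogeneous w' m' τ ∧
      (∀ i, factorType r w 0 (m i) = σ) ∧ ∀ i, factorType r w' 0 (m' i) = σ := by
  obtain ⟨p, σ, hp⟩ := exists_isHomogeneous (r + 1) w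
  obtain ⟨q, τ', hq⟩ := exists_isHomogeneous r w'
  obtain ⟨i, j, n, hij, hi, hin, hnj, hfirst, hswap⟩ := exists_cut_of_isHomogeneous hp.of_succ hq h
  choose m hle hlt hleft hright using exists_cuts_of_isHomogeneous hr hp hij hin hnj
  have hm : StrictMono m := strictMono_nat_of_lt_succ fun l => (hlt l).trans_le (hle (l + 1))
  have hmτ' : IsHomogeneous w m τ' :=
    isHomogeneous_of_consecutive hm hq.isIdempotentElem fun l => by
      rw [← factorType_mul r w (hlt l).le (hle (l + 1)), hleft, hright, hswap]
  have hq2 : IsHomogeneous w' (fun l => q (2 + l)) τ' :=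
    ⟨fun _ _ hab => hq.1 (by omega), fun _ _ hab => hq.2 _ _ (by omega)⟩
  have habsorb : factorType r w' 0 (q 2) * τ' = factorType r w' 0 (q 2) :=
    hq.factorType_mul_self (Nat.zero_le _)
  refine ⟨m, fun l => q (2 + l), factorType r w' 0 (q 2), τ', hi.trans_le (hle 0),
    (Nat.zero_le _).trans_lt (hq.1 Nat.one_lt_two), hmτ', hq2, hmτ'.factorType_zero habsorb ?_,
    hq2.factorType_zero habsorb rfl⟩
  rw [← factorType_mul r w (Nat.zero_le _) (hle 0), hleft, add_zero,
    factorType_mul r w (Nat.zero_le _) hin, hfirst]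

end AnyWord

namespace Saturation

open Word AnyWord

theorem rank_add_four_le {S : Type*} {a : ℕ} (ha : 1 < a) (hS : 1 < Nat.card S) :
    rank S + 4 ≤ a * 2 ^ (Nat.card S ^ 2) + 1 := by
  have hdouble : 2 ^ (Nat.card S + 1) ≤ 2 ^ (Nat.card S ^ 2) :=
    Nat.pow_le_pow_right (by omega) (by nlinarith)
  have eight_le : 2 ^ 3 ≤ 2 ^ (Nat.card S ^ 2) :=
    Nat.pow_le_pow_right (by omega) (by nlinarith)
  have hmul : 2 * 2 ^ (Nat.card S ^ 2) ≤ a * 2 ^ (Nat.card S ^ 2) := Nat.mul_le_mul_right _ ha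
  rw [pow_succ] at hdouble
  rw [rank]
  omega

variable {A S T : Type*} [Semigroup S] [OmegaSemigroup S T]

theorem exists_value [Finite S] (α : OmegaHom (FreeSemigroup A) (Stream' A) S T) (w : Stream' A)
    {m : ℕ → ℕ} (hm : StrictMono m) (h0 : 0 < m 0) : ∃ a b, a < b ∧
      α.inf w = α.fin (block w 0 (m a)) •
        (OmegaSemigroup.iprod (Stream'.const (α.fin (block w (m a) (m b)))) : T) := by
  obtain ⟨k, e, hk, he⟩ := exists_strictMono_homogeneous fun i j => α.fin (block w (m i) (m j))
  refine ⟨k 0, k 1, hk Nat.zero_lt_one, ?_⟩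
  have hfactorization : w = block w 0 (m (k 0)) •
      (OmegaSemigroup.iprod (factorization w (m ∘ k)) : Stream' A) := by
    have happend := factor_append_drop w (Nat.zero_le (m (k 0)))
    rw [← letters_block w (h0.trans_le (hm.monotone (Nat.zero_le _)))] at happend
    exact happend.symm.trans (congrArg (letters (block w 0 (m (k 0))) ++ₛ ·)
      (drop_eq_concat_factorization w (hm.comp hk)))
  conv_lhs => rw [hfactorization, α.map_smul, α.map_iprod]
  congr 2
  refine funext fun i => ?_
  change α.fin (block w (m (k i)) (m (k (i + 1)))) = α.fin (block w (m (k 0)) (m (k 1)))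
  rw [he _ _ i.lt_succ_self, he _ _ Nat.zero_lt_one]

theorem close_of_tp_rank_eq [Finite A] [Finite S] (α : OmegaHom (FreeSemigroup A) (Stream' A) S T)
    {w w' : Stream' A} (h : tp (rank S + 4) (inf w) = tp (rank S + 4) (inf w')) :
    Close (letterImage α.fin) (α.inf w) (α.inf w') := by
  obtain ⟨m, m', σ, τ, h0, h0', hm, hm', hσ, hσ'⟩ :=
    exists_isHomogeneous_of_tp_eq (by rw [rank]; omega) h
  obtain ⟨a, b, hab, hvalue⟩ := exists_value α w hm.1 h0
  obtain ⟨a', b', hab', hvalue'⟩ := exists_value α w' hm'.1 h0'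
  have ha : 0 < m a := h0.trans_le (hm.1.monotone a.zero_le)
  have ha' : 0 < m' a' := h0'.trans_le (hm'.1.monotone a'.zero_le)
  obtain ⟨X, hX, mem_X⟩ := exists_memSaturation_of_tp_eq α.fin (block w 0 (m a))
  obtain ⟨E, hE, mem_E⟩ := exists_memSaturation_of_tp_eq α.fin (block w (m a) (m b))
  refine ⟨X, E, hX, hE, _, mem_X _ rfl, _, mem_X _ ?_, _, mem_E _ rfl, _, mem_E _ ?_, hvalue,
    hvalue'⟩
  · rw [letters_block w ha, letters_block w' ha']
    exact factorType_eq_iff.1 ((hσ' a').trans (hσ a).symm)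
  · rw [letters_block w (hm.1 hab), letters_block w' (hm'.1 hab')]
    exact factorType_eq_iff.1 ((hm'.2 _ _ hab').trans (hm.2 _ _ hab).symm)

theorem close_self [Finite S] (α : OmegaHom (FreeSemigroup A) (Stream' A) S T) (w : Stream' A) :
    Close (letterImage α.fin) (α.inf w) (α.inf w) := by
  obtain ⟨a, b, -, hvalue⟩ := exists_value α w (m := Nat.succ) Order.succ_strictMono
    Nat.zero_lt_one
  obtain ⟨X, hX, mem_X⟩ := exists_memSaturation_of_tp_eq α.fin (block w 0 (a + 1))
  obtain ⟨E, hE, mem_E⟩ := exists_memSaturation_of_tp_eq α.fin (block w (a + 1) (b + 1))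
  exact ⟨X, E, hX, hE, _, mem_X _ rfl, _, mem_X _ rfl, _, mem_E _ rfl, _, mem_E _ rfl, hvalue,
    hvalue⟩

theorem inf_eq_inf_of_subsingleton [Subsingleton S]
    (α : OmegaHom (FreeSemigroup A) (Stream' A) S T) (w w' : Stream' A) : α.inf w = α.inf w' := by
  have eq_iprod (v : Stream' A) : v = OmegaSemigroup.iprod (factorization v id) :=
    drop_eq_concat_factorization v strictMono_id
  rw [eq_iprod w, eq_iprod w', α.map_iprod, α.map_iprod]
  congr 1
  exact funext fun i => Subsingleton.elim _ _

theorem close_of_tp_eq [Finite A] [Finite S] (α : OmegaHom (FreeSemigroup A) (Stream' A) S T)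
    {w w' : Stream' A} (h : tp (Nat.card A * 2 ^ (Nat.card S ^ 2) + 1) (inf w) =
      tp (Nat.card A * 2 ^ (Nat.card S ^ 2) + 1) (inf w')) :
    Close (letterImage α.fin) (α.inf w) (α.inf w') := by
  rcases le_or_gt (Nat.card A) 1 with hA | hA
  · have := Finite.card_le_one_iff_subsingleton.1 hA
    rw [show w' = w from Stream'.ext fun n => Subsingleton.elim _ _]
    exact close_self α w
  rcases le_or_gt (Nat.card S) 1 with hS | hS
  · have := Finite.card_le_one_iff_subsingleton.1 hS
    rw [inf_eq_inf_of_subsingleton α w' w]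
    exact close_self α w
  exact close_of_tp_rank_eq α (tp_eq_of_le (rank_add_four_le hA hS) h)

end Saturation
/-! ## Sentences and types -/

namespace Word

open AnyWord

variable {A : Type*} {n k : ℕ} {w w' : Stream' A} {a a' : Fin n → ℕ}

theorem inf_eq_prepend_cons_iff_exists_position {x : List A} {a : A} {y : AnyWord A} :
    inf w = prepend x (cons a y) ↔
      ∃ p, x = w.take p ∧ a = w.get p ∧ y = inf (w.drop (p + 1)) := by
  constructor
  · intro h
    obtain ⟨z, rfl, rfl⟩ := inf_eq_prepend_cons_iff.1 h
    obtain ⟨hx, hz⟩ := eq_take_and_eq_drop_of_eq_append (rfl : x ++ₛ z.cons a = x ++ₛ z.cons a)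
    refine ⟨x.length, hx, (Stream'.get_append_right 0 x (z.cons a)).symm, ?_⟩
    rw [← Stream'.drop_drop, ← hz]
    rfl
  · rintro ⟨p, rfl, rfl, rfl⟩
    have hdrop : w.drop p = (w.drop (p + 1)).cons (w.get p) := by
      rw [← Stream'.head_drop, ← Stream'.tail_drop', Stream'.eta]
    rw [cons_inf, prepend_inf, ← hdrop, Stream'.append_take_drop]

theorem exists_position_of_tp_eq (h : tp (k + 1) (inf w) = tp (k + 1) (inf w')) (p : ℕ) :
    ∃ p', tp k (fin (w.take p)) = tp k (fin (w'.take p')) ∧ w.get p = w'.get p' ∧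
      tp k (inf (w.drop (p + 1))) = tp k (inf (w'.drop (p' + 1))) := by
  obtain ⟨x', y', hw, hx, hy⟩ := forth_of_tp_succ_eq h _ _ _
    (inf_eq_prepend_cons_iff_exists_position.2 ⟨p, rfl, rfl, rfl⟩)
  obtain ⟨p', rfl, hget, rfl⟩ := inf_eq_prepend_cons_iff_exists_position.1 hw
  exact ⟨p', hx, hget, hy⟩

/-- An infinite word together with the values of `n` variables, encoded as a word over a larger
alphabet: each letter records which variables have its position as their value. -/
def mark (w : Stream' A) (a : Fin n → ℕ) : Stream' (A × (Fin n → Bool)) :=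
  fun p => (w.get p, fun i => decide (a i = p))

theorem get_mark_snoc (w : Stream' A) (a : Fin n → ℕ) (x p : ℕ) :
    (mark w (Fin.snoc a x : Fin (n + 1) → ℕ)).get p =
      (((mark w a).get p).1, Fin.snoc ((mark w a).get p).2 (decide (x = p))) := by
  refine Prod.ext rfl (funext fun i => ?_)
  refine Fin.lastCases ?_ (fun i => ?_) i <;> simp [mark, Stream'.get]

theorem inf_mark_snoc (w : Stream' A) (a : Fin n → ℕ) (x : ℕ) :
    inf (mark w (Fin.snoc a x : Fin (n + 1) → ℕ)) =
      prepend (((mark w a).take x).map fun c => (c.1, Fin.snoc c.2 false))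
        (cons (((mark w a).get x).1, Fin.snoc ((mark w a).get x).2 true)
          (AnyWord.map (fun c => (c.1, Fin.snoc c.2 false)) (inf ((mark w a).drop (x + 1))))) := by
  refine inf_eq_prepend_cons_iff_exists_position.2 ⟨x, ?_, ?_, ?_⟩
  · refine List.ext_getElem (by simp) fun p hp _ => ?_
    simp only [List.length_map, Stream'.length_take] at hp
    simp only [List.getElem_map, Stream'.take_get, get_mark_snoc]
    simp [show x ≠ p by omega]
  · simp [get_mark_snoc]
  · refine congrArg inf (Stream'.ext fun p => ?_)
    simp only [Stream'.get_map, Stream'.get_drop, get_mark_snoc]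
    simp [show x ≠ x + 1 + p by omega]

theorem exists_tp_mark_snoc_eq (h : tp (k + 1) (inf (mark w a)) = tp (k + 1) (inf (mark w' a')))
    (x : ℕ) : ∃ x', tp k (inf (mark w (Fin.snoc a x : Fin (n + 1) → ℕ))) =
      tp k (inf (mark w' (Fin.snoc a' x' : Fin (n + 1) → ℕ))) := by
  obtain ⟨x', htake, hget, hdrop⟩ := exists_position_of_tp_eq h x
  refine ⟨x', ?_⟩
  rw [inf_mark_snoc, inf_mark_snoc, hget]
  exact tp_prepend_congr (tp_map_congr _ (u := fin _) (v := fin _) htake)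
    (tp_prepend_congr (u := [_]) (u' := [_]) rfl (tp_map_congr _ hdrop))

theorem get_mark_eq_of_get_mark_eq {i : Fin n} {p' : ℕ}
    (h : (mark w a).get (a i) = (mark w' a').get p') :
    p' = a' i ∧ w.get (a i) = w'.get (a' i) ∧ ∀ j, a j = a i ↔ a' j = a' i := by
  simp only [mark, Stream'.get, Prod.mk.injEq, funext_iff, decide_eq_decide] at h
  obtain ⟨hletter, hvalues⟩ := h
  obtain rfl : a' i = p' := (hvalues i).1 rfl
  exact ⟨rfl, hletter, hvalues⟩

theorem get_eq_get_of_tp_mark_eq (h : tp 1 (inf (mark w a)) = tp 1 (inf (mark w' a')))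
    (i : Fin n) : w.get (a i) = w'.get (a' i) := by
  obtain ⟨_, -, hget, -⟩ := exists_position_of_tp_eq h (a i)
  exact (get_mark_eq_of_get_mark_eq hget).2.1

theorem eq_iff_eq_of_tp_mark_eq (h : tp 1 (inf (mark w a)) = tp 1 (inf (mark w' a')))
    (i j : Fin n) : a i = a j ↔ a' i = a' j := by
  obtain ⟨_, -, hget, -⟩ := exists_position_of_tp_eq h (a j)
  exact (get_mark_eq_of_get_mark_eq hget).2.2 i

theorem exists_mem_take_mark_iff {p : ℕ} {i : Fin n} :
    (∃ c ∈ (mark w a).take p, c.2 i = true) ↔ a i < p := by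
  constructor
  · rintro ⟨c, hc, hi⟩
    obtain ⟨q, hq, rfl⟩ := List.getElem_of_mem hc
    rw [Stream'.length_take] at hq
    rw [Stream'.take_get] at hi
    have : a i = q := by simpa [mark, Stream'.get] using hi
    omega
  · intro h
    have hlt : a i < ((mark w a).take p).length := by simpa using h
    refine ⟨_, List.getElem_mem hlt, ?_⟩
    rw [Stream'.take_get]
    simp [mark, Stream'.get]

theorem mem_of_tp_one_eq {u v : List A} (h : tp 1 (fin u) = tp 1 (fin v)) {c : A} (hc : c ∈ u) :
    c ∈ v := by
  obtain ⟨x, y, rfl⟩ := List.append_of_mem hc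
  obtain ⟨x', y', hv, -⟩ := forth_of_tp_succ_eq h x c (fin y) rfl
  obtain ⟨z, rfl, -⟩ := fin_eq_prepend_cons_iff.1 hv
  simp

theorem lt_iff_lt_of_tp_mark_eq (h : tp 2 (inf (mark w a)) = tp 2 (inf (mark w' a')))
    (i j : Fin n) : a i < a j ↔ a' i < a' j := by
  obtain ⟨p', htake, hget, -⟩ := exists_position_of_tp_eq h (a j)
  obtain rfl := (get_mark_eq_of_get_mark_eq hget).1
  rw [← exists_mem_take_mark_iff (w := w), ← exists_mem_take_mark_iff (w := w')]
  exact ⟨fun ⟨c, hc, hi⟩ => ⟨c, mem_of_tp_one_eq htake hc, hi⟩,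
    fun ⟨c, hc, hi⟩ => ⟨c, mem_of_tp_one_eq htake.symm hc, hi⟩⟩

end Word

namespace FOWord

open FirstOrder Word AnyWord

variable {A : Type*}

/-- The truth of a formula in an infinite word. -/
def Holds (w : Stream' A) {n : ℕ} (φ : (lang A).BoundedFormula Empty n) (a : Fin n → ℕ) : Prop :=
  letI := structureOf w
  φ.Realize default a

theorem models_iff (w : Stream' A) (φ : (lang A).Sentence) :
    Models w φ ↔ Holds w φ default := by
  unfold Models Holds Language.Sentence.Realize Language.Formula.Realize
  convert Iff.rfl

section

variable (w : Stream' A) {n : ℕ} (φ ψ : (lang A).BoundedFormula Empty n) (a : Fin n → ℕ)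

theorem holds_falsum : Holds w (.falsum : (lang A).BoundedFormula Empty n) a ↔ False := Iff.rfl

theorem holds_imp : Holds w (.imp φ ψ) a ↔ (Holds w φ a → Holds w ψ a) := Iff.rfl

theorem holds_all (φ : (lang A).BoundedFormula Empty (n + 1)) :
    Holds w (.all φ) a ↔ ∀ x, Holds w φ (Fin.snoc a x) := Iff.rfl

end

theorem exists_eq_var {n : ℕ} (t : (lang A).Term (Empty ⊕ Fin n)) : ∃ i, t = .var (.inr i) := by
  rcases t with (e | i) | f
  · exact e.elim
  · exact ⟨i, rfl⟩
  · exact nomatch f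

theorem holds_rel_iff_of_tp_mark_eq {n l : ℕ} (R : Rel A l)
    (ts : Fin l → (lang A).Term (Empty ⊕ Fin n)) {w w' : Stream' A} {a a' : Fin n → ℕ}
    (h : tp 2 (inf (mark w a)) = tp 2 (inf (mark w' a'))) :
    Holds w (.rel (R : (lang A).Relations l) ts) a ↔
      Holds w' (.rel (R : (lang A).Relations l) ts) a' := by
  choose v hv using fun i => exists_eq_var (ts i)
  obtain rfl : ts = fun i => .var (.inr (v i)) := funext hv
  cases R with
  | letter c =>
    change w.get (a (v 0)) = c ↔ w'.get (a' (v 0)) = c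
    rw [get_eq_get_of_tp_mark_eq (tp_eq_of_tp_succ_eq h)]
  | lt => exact lt_iff_lt_of_tp_mark_eq h (v 0) (v 1)

/-- The atomic formulas are decided by the type of rank `2` of the marked word; every quantifier
costs one more. -/
theorem holds_iff_of_tp_mark_eq {n : ℕ} (φ : (lang A).BoundedFormula Empty n) {k : ℕ}
    (hk : qrank φ ≤ k) {w w' : Stream' A} {a a' : Fin n → ℕ}
    (h : tp (k + 2) (inf (mark w a)) = tp (k + 2) (inf (mark w' a'))) :
    Holds w φ a ↔ Holds w' φ a' := by
  induction φ generalizing k with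
  | falsum => exact Iff.rfl
  | equal s t =>
    obtain ⟨i, rfl⟩ := exists_eq_var s
    obtain ⟨j, rfl⟩ := exists_eq_var t
    exact eq_iff_eq_of_tp_mark_eq (tp_eq_of_le (by omega) h) i j
  | rel R ts => exact holds_rel_iff_of_tp_mark_eq R ts (tp_eq_of_le (by omega) h)
  | imp φ ψ ihφ ihψ =>
    simp only [qrank, max_le_iff] at hk
    rw [holds_imp, holds_imp, ihφ hk.1 h, ihψ hk.2 h]
  | all φ ih =>
    obtain ⟨k, rfl⟩ : ∃ l, k = l + 1 := ⟨k - 1, by simp only [qrank] at hk; omega⟩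
    simp only [qrank, Nat.add_le_add_iff_right] at hk
    rw [holds_all, holds_all]
    constructor
    · intro hall x'
      obtain ⟨x, hx⟩ := exists_tp_mark_snoc_eq h.symm x'
      exact (ih hk hx.symm).1 (hall x)
    · intro hall x
      obtain ⟨x', hx⟩ := exists_tp_mark_snoc_eq h x
      exact (ih hk hx).2 (hall x')

theorem models_iff_of_tp_eq (φ : (lang A).Sentence) {w w' : Stream' A}
    (h : tp (qrank φ + 2) (inf w) = tp (qrank φ + 2) (inf w')) : Models w φ ↔ Models w' φ := by
  rw [models_iff, models_iff]
  refine holds_iff_of_tp_mark_eq φ le_rfl ?_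
  have mark_default (w : Stream' A) : inf (mark w (default : Fin 0 → ℕ)) =
      AnyWord.map (fun c => (c, (Fin.elim0 : Fin 0 → Bool))) (inf w) :=
    congrArg inf (Stream'.ext fun p => Prod.ext rfl (funext fun i => i.elim0))
  rw [mark_default, mark_default]
  exact tp_map_congr _ h

theorem not_close_of_separable {S T : Type*} [Semigroup S] [OmegaSemigroup S T] [Finite S]
    {α : OmegaHom (FreeSemigroup A) (Stream' A) S T} {F₀ F₁ : Set T}
    (h : Separable (α.inf ⁻¹' F₀) (α.inf ⁻¹' F₁)) {p q : T} (hp : p ∈ F₀) (hq : q ∈ F₁) :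
    ¬ Saturation.Close (Saturation.letterImage α.fin) p q := by
  intro hclose
  obtain ⟨φ, hsub, hdisj⟩ := h
  obtain ⟨w, w', rfl, rfl, htp⟩ := hclose.exists_words (qrank φ + 2)
  have hw : Models w φ := hsub hp
  have hw' : w' ∈ α.inf ⁻¹' F₁ ∩ langOf φ := ⟨hq, (models_iff_of_tp_eq φ htp).1 hw⟩
  rwa [hdisj] at hw'

end FOWord
/-! ## Ultimately periodic words -/

namespace AnyWord

open Word

variable {A : Type*}

/-- The factorizations `x a y` of a list around one of its letters `a`. -/
def splits : List A → List (List A × A × List A)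
  | [] => []
  | a :: l => ([], a, l) :: (splits l).map fun s => (a :: s.1, s.2)

theorem mem_splits {l x y : List A} {a : A} : (x, a, y) ∈ splits l ↔ l = x ++ a :: y := by
  induction l generalizing x with
  | nil => simp [splits]
  | cons b l ih =>
    cases x with
    | nil => simp [splits, eq_comm]
    | cons c x => simp [splits, ih, and_comm, eq_comm]

/-- The `t`-th power of a finite word. -/
def power (t : ℕ) (v : List A) : List A := (List.replicate t v).flatten

theorem power_add (s t : ℕ) (v : List A) : power (s + t) v = power s v ++ power t v := by
  rw [power, List.replicate_add, List.flatten_append]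
  rfl

@[simp] theorem power_one (v : List A) : power 1 v = v := by simp [power]

@[simp] theorem power_nil (t : ℕ) : power t ([] : List A) = [] := by simp [power]

theorem power_eq_append_cons {t b : ℕ} (hb : b < t) {v x z : List A} {a : A}
    (h : v = x ++ a :: z) : power t v = power b v ++ x ++ a :: (z ++ power (t - b - 1) v) := by
  have ht : t = b + (1 + (t - b - 1)) := by omega
  conv_lhs => rw [ht]
  rw [power_add, power_add, power_one]
  nth_rw 2 [h]
  simp

theorem flatten_map_take_const (u : FreeSemigroup A) (b : ℕ) :
    (((Stream'.const u).take b).map letters).flatten = power b (letters u) := by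
  rw [power]
  congr 1
  exact List.ext_getElem (by simp) fun i _ _ => by simp [Stream'.take_get]

theorem tp_power_congr {k m n : ℕ} (h : AgreeUpTo k m n) (v : List A) :
    tp k (fin (power m v)) = tp k (fin (power n v)) :=
  tp_flatten_congr (v := v) (fun w hw => by rw [List.eq_of_mem_replicate hw])
    (fun w hw => by rw [List.eq_of_mem_replicate hw]) (by simpa using h)

theorem exists_lt_agreeUpTo {k t : ℕ} (ht : 2 ^ k ≤ t) (b : ℕ) : ∃ b' < t, AgreeUpTo k b b' := by
  rcases lt_or_ge b t with hb | hb
  · exact ⟨b, hb, Or.inl rfl⟩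
  · have : 0 < 2 ^ k := by positivity
    exact ⟨t - 1, by omega, Or.inr ⟨by omega, by omega⟩⟩

/-- The word `u v v v ⋯`, or `u` if `v` is empty. -/
def ultPeriodic (u : List A) : List A → AnyWord A
  | [] => fin u
  | b :: l => inf (u ++ₛ concat (Stream'.const ⟨b, l⟩))

theorem prepend_ultPeriodic (x u v : List A) :
    prepend x (ultPeriodic u v) = ultPeriodic (x ++ u) v := by
  cases v <;> simp [ultPeriodic, Stream'.append_append_stream]

theorem ultPeriodic_append_self (u v : List A) : ultPeriodic (u ++ v) v = ultPeriodic u v := by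
  cases v with
  | nil => rw [List.append_nil]
  | cons b l =>
    have hunroll : concat (Stream'.const (⟨b, l⟩ : FreeSemigroup A)) =
        (b :: l) ++ₛ concat (Stream'.const ⟨b, l⟩) := concat_eq_append_concat_tail _
    rw [ultPeriodic, Stream'.append_append_stream, ← hunroll, ultPeriodic]

theorem ultPeriodic_append_power (t : ℕ) (u v : List A) :
    ultPeriodic (u ++ power t v) v = ultPeriodic u v := by
  induction t with
  | zero => simp [power]
  | succ t ih => rw [power_add, ← List.append_assoc, power_one, ultPeriodic_append_self, ih]

theorem ultPeriodic_eq_prepend_cons {t : ℕ} {u v x y : List A} {a : A}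
    (h : u ++ power t v = x ++ a :: y) :
    ultPeriodic u v = prepend x (cons a (ultPeriodic y v)) := by
  rw [← ultPeriodic_append_power t, h, cons, prepend_ultPeriodic, prepend_ultPeriodic]
  rfl

theorem exists_of_ultPeriodic_nil_eq_prepend_cons {v x : List A} (hv : v ≠ []) {a : A}
    {y : AnyWord A} (h : ultPeriodic [] v = prepend x (cons a y)) :
    ∃ b x' z, v = x' ++ a :: z ∧ x = power b v ++ x' ∧ y = ultPeriodic z v := by
  obtain ⟨c, l, rfl⟩ := List.exists_cons_of_ne_nil hv
  rw [ultPeriodic, Stream'.nil_append_stream] at h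
  obtain ⟨b, x', z, hletters, rfl, rfl⟩ := inf_concat_eq_prepend_cons h
  exact ⟨b, x', z, hletters, by rw [flatten_map_take_const]; rfl, by rw [Stream'.drop_const]; rfl⟩

/-- Up to types of rank `k`, a letter of `u v v v ⋯` stands in the first `2 ^ k` copies of `v`. -/
theorem exists_mem_splits_of_ultPeriodic_eq {k t : ℕ} (ht : 2 ^ k ≤ t) {u v x : List A} {a : A}
    {y : AnyWord A} (h : ultPeriodic u v = prepend x (cons a y)) :
    ∃ x' y', (x', a, y') ∈ splits (u ++ power t v) ∧ tp k (fin x) = tp k (fin x') ∧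
      tp k y = tp k (ultPeriodic y' v) := by
  rcases eq_or_ne v [] with rfl | hv
  · obtain ⟨z, rfl, rfl⟩ := fin_eq_prepend_cons_iff.1 h
    exact ⟨x, z, by simp [mem_splits], rfl, rfl⟩
  · rw [← List.append_nil u, ← prepend_ultPeriodic, prepend_eq_prepend_cons_iff] at h
    rcases h with ⟨z, rfl, rfl⟩ | ⟨z, rfl, h⟩
    · exact ⟨x, z ++ power t v, by simp [mem_splits], rfl,
        by rw [prepend_ultPeriodic, ultPeriodic_append_power, List.append_nil]⟩
    · obtain ⟨b, x', z', hsplit, rfl, rfl⟩ := exists_of_ultPeriodic_nil_eq_prepend_cons hv h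
      obtain ⟨b', hb', hagree⟩ := exists_lt_agreeUpTo ht b
      refine ⟨u ++ (power b' v ++ x'), z' ++ power (t - b' - 1) v, ?_,
        tp_append_congr rfl (tp_append_congr (tp_power_congr hagree v) rfl), ?_⟩
      · rw [mem_splits, power_eq_append_cons hb' hsplit, List.append_assoc, List.append_assoc,
          List.append_assoc]
      · rw [ultPeriodic_append_power]

end AnyWord

/-! ## Formulas that define the types of ultimately periodic words -/

namespace AnyWord

open Word

variable {A : Type*}

/-- The factor of an infinite word from a position to before another one or to infinity. -/
def interval (w : Stream' A) (s : ℕ) : Option ℕ → AnyWord A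
  | none => inf (w.drop s)
  | some e => fin (factor w s e)

theorem factor_eq_append_cons (w : Stream' A) {s z e : ℕ} (hsz : s ≤ z) (hze : z < e) :
    factor w s e = factor w s z ++ w.get z :: factor w (z + 1) e := by
  rw [← factor_append_factor w hsz hze.le, ← factor_append_factor w (Nat.le_succ z) hze]
  simp [factor, Stream'.take_succ]

theorem factor_eq_append_cons_iff {w : Stream' A} {s e : ℕ} {x y : List A} {a : A} :
    factor w s e = x ++ a :: y ↔ ∃ z, s ≤ z ∧ z < e ∧ x = factor w s z ∧ a = w.get z ∧
      y = factor w (z + 1) e := by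
  constructor
  · intro h
    have hlen := congrArg List.length h
    simp only [length_factor, List.length_append, List.length_cons] at hlen
    have hsplit := factor_eq_append_cons w (Nat.le_add_right s x.length)
      (show s + x.length < e by omega)
    obtain ⟨hx, hay⟩ := List.append_inj (h.symm.trans hsplit) (by simp [length_factor])
    obtain ⟨ha, hy⟩ := List.cons.inj hay
    exact ⟨s + x.length, by omega, by omega, hx, ha, hy⟩
  · rintro ⟨z, hsz, hze, rfl, rfl, rfl⟩
    exact factor_eq_append_cons w hsz hze

theorem interval_eq_prepend_cons_iff {w : Stream' A} {s : ℕ} {r : Option ℕ} {x : List A} {a : A}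
    {y : AnyWord A} :
    interval w s r = prepend x (cons a y) ↔ ∃ z, s ≤ z ∧ (∀ e ∈ r, z < e) ∧ x = factor w s z ∧
      a = w.get z ∧ y = interval w (z + 1) r := by
  cases r with
  | none =>
    rw [interval, inf_eq_prepend_cons_iff_exists_position]
    constructor
    · rintro ⟨p, rfl, rfl, rfl⟩
      refine ⟨s + p, by omega, by simp, by simp [factor], by simp [Stream'.get_drop], ?_⟩
      rw [interval, Stream'.drop_drop, Nat.add_assoc]
    · rintro ⟨z, hz, -, rfl, rfl, rfl⟩
      obtain ⟨p, rfl⟩ := Nat.exists_eq_add_of_le hz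
      refine ⟨p, by simp [factor], by simp [Stream'.get_drop], ?_⟩
      rw [interval, Stream'.drop_drop, Nat.add_assoc]
  | some e =>
    rw [interval, fin_eq_prepend_cons_iff]
    constructor
    · rintro ⟨y, h, rfl⟩
      obtain ⟨z, hsz, hze, hx, ha, rfl⟩ := factor_eq_append_cons_iff.1 h
      exact ⟨z, hsz, by simpa using hze, hx, ha, rfl⟩
    · rintro ⟨z, hsz, hze, hx, ha, rfl⟩
      exact ⟨_, factor_eq_append_cons_iff.2 ⟨z, hsz, hze e rfl, hx, ha, rfl⟩, rfl⟩

end AnyWord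
namespace AnyWord

open Word

variable {A : Type*}

theorem tp_succ_interval_eq_iff {t k : ℕ} (ht : 2 ^ k ≤ t) (w : Stream' A) (s : ℕ) (r : Option ℕ)
    (u v : List A) :
    tp (k + 1) (interval w s r) = tp (k + 1) (ultPeriodic u v) ↔
      (∀ p ∈ splits (u ++ power t v), ∃ z, s ≤ z ∧ (∀ e ∈ r, z < e) ∧ w.get z = p.2.1 ∧
        tp k (fin (factor w s z)) = tp k (fin p.1) ∧
        tp k (interval w (z + 1) r) = tp k (ultPeriodic p.2.2 v)) ∧
      ∀ z, s ≤ z → (∀ e ∈ r, z < e) → ∃ p ∈ splits (u ++ power t v), w.get z = p.2.1 ∧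
        tp k (fin (factor w s z)) = tp k (fin p.1) ∧
        tp k (interval w (z + 1) r) = tp k (ultPeriodic p.2.2 v) := by
  rw [tp_succ_eq_iff, and_comm]
  refine and_congr ⟨?_, ?_⟩ ⟨?_, ?_⟩
  · rintro hforth ⟨x, b, y⟩ hp
    obtain ⟨x', y', hw, hx, hy⟩ := hforth _ _ _ (ultPeriodic_eq_prepend_cons (mem_splits.1 hp))
    obtain ⟨z, hsz, hzr, rfl, rfl, rfl⟩ := interval_eq_prepend_cons_iff.1 hw
    exact ⟨z, hsz, hzr, rfl, hx.symm, hy.symm⟩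
  · intro hsplit x b y hw
    obtain ⟨x', y', hp, hx, hy⟩ := exists_mem_splits_of_ultPeriodic_eq ht hw
    obtain ⟨z, hsz, hzr, hb, hx', hy'⟩ := hsplit _ hp
    exact ⟨_, _, interval_eq_prepend_cons_iff.2 ⟨z, hsz, hzr, rfl, hb.symm, rfl⟩,
      hx.trans hx'.symm, hy.trans hy'.symm⟩
  · intro hforth z hsz hzr
    obtain ⟨x, y, hw, hx, hy⟩ :=
      hforth _ _ _ (interval_eq_prepend_cons_iff.2 ⟨z, hsz, hzr, rfl, rfl, rfl⟩)
    obtain ⟨x', y', hp, hx', hy'⟩ := exists_mem_splits_of_ultPeriodic_eq ht hw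
    exact ⟨_, hp, rfl, hx.trans hx', hy.trans hy'⟩
  · intro hsplit x b y hw
    obtain ⟨z, hsz, hzr, rfl, rfl, rfl⟩ := interval_eq_prepend_cons_iff.1 hw
    obtain ⟨⟨x, b, y⟩, hp, rfl, hx, hy⟩ := hsplit z hsz hzr
    exact ⟨x, ultPeriodic y v, ultPeriodic_eq_prepend_cons (mem_splits.1 hp), hx, hy⟩

end AnyWord

namespace FOWord

open FirstOrder AnyWord Word

variable {A : Type*}

/-- Negation. -/
def neg {n : ℕ} (φ : (lang A).BoundedFormula Empty n) : (lang A).BoundedFormula Empty n :=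
  .imp φ .falsum

/-- The conjunction of a list of formulas. -/
def conj {n : ℕ} (l : List ((lang A).BoundedFormula Empty n)) : (lang A).BoundedFormula Empty n :=
  l.foldr (fun φ ψ => neg (.imp φ (neg ψ))) (neg .falsum)

/-- The disjunction of a list of formulas. -/
def disj {n : ℕ} (l : List ((lang A).BoundedFormula Empty n)) : (lang A).BoundedFormula Empty n :=
  l.foldr (fun φ ψ => .imp (neg φ) ψ) .falsum

/-- The position of a variable carries a given letter. -/
def letterAt {n : ℕ} (c : A) (i : Fin n) : (lang A).BoundedFormula Empty n :=
  .rel (.letter c) ![.var (.inr i)]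

/-- The order of two variables. -/
def varLt {n : ℕ} (i j : Fin n) : (lang A).BoundedFormula Empty n :=
  .rel .lt ![.var (.inr i), .var (.inr j)]

/-- Quantification over the positions after `l` (if given) and before `r` (if given). -/
def allBetween {n : ℕ} (l r : Option (Fin n)) (φ : (lang A).BoundedFormula Empty (n + 1)) :
    (lang A).BoundedFormula Empty n :=
  .all (l.elim (r.elim φ fun j => .imp (varLt (Fin.last n) j.castSucc) φ) fun i =>
    .imp (varLt i.castSucc (Fin.last n))
      (r.elim φ fun j => .imp (varLt (Fin.last n) j.castSucc) φ))

/-- Every formula of a list holds at some position between `l` and `r`, and at every such position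
some formula of the list holds. -/
def exactlyBetween {n : ℕ} (l r : Option (Fin n))
    (b : List ((lang A).BoundedFormula Empty (n + 1))) : (lang A).BoundedFormula Empty n :=
  conj (allBetween l r (disj b) :: b.map fun φ => neg (allBetween l r (neg φ)))

section

variable {w : Stream' A} {n : ℕ} {a : Fin n → ℕ}

theorem holds_neg {φ : (lang A).BoundedFormula Empty n} : Holds w (neg φ) a ↔ ¬ Holds w φ a :=
  Iff.rfl

theorem holds_conj {l : List ((lang A).BoundedFormula Empty n)} :
    Holds w (conj l) a ↔ ∀ φ ∈ l, Holds w φ a := by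
  induction l with
  | nil => simp [conj, holds_neg, holds_falsum]
  | cons φ l ih =>
    change Holds w (neg (.imp φ (neg (conj l)))) a ↔ _
    rw [holds_neg, holds_imp, holds_neg, ih]
    simp

theorem holds_disj {l : List ((lang A).BoundedFormula Empty n)} :
    Holds w (disj l) a ↔ ∃ φ ∈ l, Holds w φ a := by
  induction l with
  | nil => simp [disj, holds_falsum]
  | cons φ l ih =>
    change Holds w (.imp (neg φ) (disj l)) a ↔ _
    rw [holds_imp, holds_neg, ih, List.exists_mem_cons_iff, or_iff_not_imp_left]

theorem holds_letterAt {c : A} {i : Fin n} : Holds w (letterAt c i) a ↔ w.get (a i) = c :=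
  Iff.rfl

theorem holds_varLt {i j : Fin n} : Holds w (varLt i j) a ↔ a i < a j :=
  Iff.rfl

theorem holds_allBetween {l r : Option (Fin n)} {φ : (lang A).BoundedFormula Empty (n + 1)} :
    Holds w (allBetween l r φ) a ↔ ∀ z, l.elim 0 (fun i => a i + 1) ≤ z →
      (∀ e ∈ r.map a, z < e) → Holds w φ (Fin.snoc a z) := by
  rw [allBetween, holds_all]
  refine forall_congr' fun z => ?_
  cases l <;> cases r <;> simp [holds_imp, holds_varLt]

theorem holds_exactlyBetween {l r : Option (Fin n)}
    {b : List ((lang A).BoundedFormula Empty (n + 1))} :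
    Holds w (exactlyBetween l r b) a ↔
      (∀ φ ∈ b, ∃ z, l.elim 0 (fun i => a i + 1) ≤ z ∧ (∀ e ∈ r.map a, z < e) ∧
        Holds w φ (Fin.snoc a z)) ∧
      ∀ z, l.elim 0 (fun i => a i + 1) ≤ z → (∀ e ∈ r.map a, z < e) →
        ∃ φ ∈ b, Holds w φ (Fin.snoc a z) := by
  simp only [exactlyBetween, holds_conj, List.forall_mem_cons, List.forall_mem_map, holds_neg,
    holds_allBetween, holds_disj]
  push Not
  exact and_comm

theorem qrank_neg (φ : (lang A).BoundedFormula Empty n) : qrank (neg φ) = qrank φ :=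
  Nat.max_zero _

theorem qrank_conj_le {k : ℕ} {l : List ((lang A).BoundedFormula Empty n)}
    (h : ∀ φ ∈ l, qrank φ ≤ k) : qrank (conj l) ≤ k := by
  induction l with
  | nil => exact Nat.zero_le _
  | cons φ l ih =>
    obtain ⟨hφ, hl⟩ := List.forall_mem_cons.1 h
    change qrank (neg (.imp φ (neg (conj l)))) ≤ k
    simpa [qrank_neg, qrank] using ⟨hφ, ih hl⟩

theorem qrank_disj_le {k : ℕ} {l : List ((lang A).BoundedFormula Empty n)}
    (h : ∀ φ ∈ l, qrank φ ≤ k) : qrank (disj l) ≤ k := by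
  induction l with
  | nil => exact Nat.zero_le _
  | cons φ l ih =>
    obtain ⟨hφ, hl⟩ := List.forall_mem_cons.1 h
    change qrank (.imp (neg φ) (disj l)) ≤ k
    simpa [qrank_neg, qrank] using ⟨hφ, ih hl⟩

theorem qrank_allBetween (l r : Option (Fin n)) (φ : (lang A).BoundedFormula Empty (n + 1)) :
    qrank (allBetween l r φ) = qrank φ + 1 := by
  cases l <;> cases r <;> simp [allBetween, qrank, varLt]

theorem qrank_exactlyBetween_le {k : ℕ} (l r : Option (Fin n))
    {b : List ((lang A).BoundedFormula Empty (n + 1))} (h : ∀ φ ∈ b, qrank φ ≤ k) :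
    qrank (exactlyBetween l r b) ≤ k + 1 := by
  refine qrank_conj_le (List.forall_mem_cons.2 ⟨?_, List.forall_mem_map.2 fun φ hφ => ?_⟩)
  · rw [qrank_allBetween]
    exact Nat.succ_le_succ (qrank_disj_le h)
  · rw [qrank_neg, qrank_allBetween, qrank_neg]
    exact Nat.succ_le_succ (h φ hφ)

end

/-- The Hintikka formula of rank `k` of an ultimately periodic word: it expresses that the positions
after `l` and before `r` form a word with the same rank-`k` type as `u v v v ⋯` (or `u` if `v` is
empty), provided that `2 ^ k ≤ t`. -/
def hintikka (t : ℕ) : (k : ℕ) → {n : ℕ} → (l r : Option (Fin n)) → (u v : List A) →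
    (lang A).BoundedFormula Empty n
  | 0, _, _, _, _, _ => neg .falsum
  | k + 1, n, l, r, u, v => exactlyBetween l r ((splits (u ++ power t v)).map fun s =>
      conj [letterAt s.2.1 (Fin.last n),
        hintikka t k (l.map Fin.castSucc) (some (Fin.last n)) s.1 [],
        hintikka t k (some (Fin.last n)) (r.map Fin.castSucc) s.2.2 v])

theorem qrank_hintikka_le (t k : ℕ) {n : ℕ} (l r : Option (Fin n)) (u v : List A) :
    qrank (hintikka t k l r u v) ≤ k := by
  induction k generalizing n l r u v with
  | zero => exact Nat.zero_le _
  | succ k ih =>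
    refine qrank_exactlyBetween_le l r (List.forall_mem_map.2 fun s _ => qrank_conj_le ?_)
    simp only [List.forall_mem_cons, ih, List.not_mem_nil, false_imp_iff, implies_true, and_true]
    exact Nat.zero_le _

theorem holds_hintikka {t k : ℕ} (ht : 2 ^ k ≤ t) {n : ℕ} (l r : Option (Fin n)) (u v : List A)
    (w : Stream' A) (a : Fin n → ℕ) : Holds w (hintikka t k l r u v) a ↔
      tp k (interval w (l.elim 0 fun i => a i + 1) (r.map a)) = tp k (ultPeriodic u v) := by
  induction k generalizing n l r u v with
  | zero => exact iff_of_true id rfl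
  | succ k ih =>
    have ht' : 2 ^ k ≤ t := (Nat.pow_le_pow_right two_pos (Nat.le_succ k)).trans ht
    have hleft (z : ℕ) : (l.map Fin.castSucc).elim 0
        (fun i => (Fin.snoc a z : Fin (n + 1) → ℕ) i + 1) = l.elim 0 fun i => a i + 1 := by
      cases l <;> simp
    have hright (z : ℕ) :
        (r.map Fin.castSucc).map (Fin.snoc a z : Fin (n + 1) → ℕ) = r.map a := by
      cases r <;> simp
    rw [hintikka, tp_succ_interval_eq_iff ht', holds_exactlyBetween]
    simp only [List.mem_map, forall_exists_index, and_imp, forall_apply_eq_imp_iff₂,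
      exists_exists_and_eq_and, holds_conj,
      List.forall_mem_cons, List.not_mem_nil, false_imp_iff, implies_true, and_true, holds_letterAt,
      ih ht', hleft, hright, Option.elim_some, Option.map_some, Fin.snoc_last]
    rfl

end FOWord
/-! ## Short representatives and the separating sentence -/

/-- The number of rank-`k` types over an alphabet with `n` letters. -/
def numTypes (n : ℕ) : ℕ → ℕ
  | 0 => 1
  | k + 1 => 2 ^ (numTypes n k * (n * numTypes n k))

theorem RankType.card_eq (A : Type*) [Finite A] (k : ℕ) :
    Nat.card (RankType A k) = numTypes (Nat.card A) k := by
  induction k with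
  | zero => exact Nat.card_unique (α := PUnit)
  | succ k ih =>
    have hset : Nat.card (Set (RankType A k × A × RankType A k)) =
        2 ^ Nat.card (RankType A k × A × RankType A k) := by
      have := Fintype.ofFinite (RankType A k × A × RankType A k)
      simp [Nat.card_eq_fintype_card]
    rw [numTypes, ← ih, ← Nat.card_prod, ← Nat.card_prod, ← hset]
    rfl

namespace Saturation

open Word AnyWord OmegaSemigroup

variable {A S T : Type*} [Semigroup S] [OmegaSemigroup S T]

theorem map_eq_of_map_take_eq (φ : FreeSemigroup A →ₙ* S) {a : A} {v : List A} {i j : ℕ}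
    (h : φ ⟨a, v.take i⟩ = φ ⟨a, v.take j⟩) : φ ⟨a, v⟩ = φ ⟨a, v.take i ++ v.drop j⟩ := by
  simp only [← foldl_letterImage] at h ⊢
  rw [List.foldl_append, h, ← List.foldl_append, List.take_append_drop]

theorem exists_shorter_word [Finite A] [Finite S] (φ : FreeSemigroup A →ₙ* S) (k : ℕ)
    {u : FreeSemigroup A} (hu : numTypes (Nat.card A) k * Nat.card S < (letters u).length) :
    ∃ u' : FreeSemigroup A, (letters u').length < (letters u).length ∧
      tp k (fin (letters u)) = tp k (fin (letters u')) ∧ φ u = φ u' := by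
  obtain ⟨a, v⟩ := u
  let prefixClass (i : Fin (v.length + 1)) : RankType A k × S :=
    (tp k (fin (a :: v.take i)), φ ⟨a, v.take i⟩)
  have hrepeat : ¬ Function.Injective prefixClass := by
    intro hinj
    have hcard := Nat.card_le_card_of_injective prefixClass hinj
    rw [Nat.card_prod, RankType.card_eq, Nat.card_fin] at hcard
    exact absurd hu hcard.not_gt
  obtain ⟨i, j, hij, h⟩ : ∃ i j, i < j ∧ prefixClass i = prefixClass j := by
    simp only [Function.Injective, not_forall] at hrepeat
    obtain ⟨i, j, h, hne⟩ := hrepeat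
    rcases lt_or_gt_of_ne hne with hlt | hgt
    exacts [⟨i, j, hlt, h⟩, ⟨j, i, hgt, h.symm⟩]
  obtain ⟨htype, hvalue⟩ := Prod.mk.inj h
  refine ⟨⟨a, v.take i ++ v.drop j⟩, ?_, ?_, map_eq_of_map_take_eq φ hvalue⟩
  · simp only [letters, List.length_cons, List.length_append, List.length_take, List.length_drop]
    omega
  · simpa [letters] using
      tp_append_congr (u := a :: v.take j) (v := v.drop j) htype.symm rfl

theorem exists_short_word [Finite A] [Finite S] (φ : FreeSemigroup A →ₙ* S) (k : ℕ)
    (u : FreeSemigroup A) : ∃ u' : FreeSemigroup A,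
      (letters u').length ≤ numTypes (Nat.card A) k * Nat.card S ∧
      tp k (fin (letters u)) = tp k (fin (letters u')) ∧ φ u = φ u' := by
  induction hl : (letters u).length using Nat.strong_induction_on generalizing u with
  | _ l ih =>
  rcases le_or_gt (letters u).length (numTypes (Nat.card A) k * Nat.card S) with hshort | hlong
  · exact ⟨u, hshort, rfl, rfl⟩
  · obtain ⟨v, hv, htype, hvalue⟩ := exists_shorter_word φ k hlong
    obtain ⟨u', hu', htype', hvalue'⟩ := ih _ (hl ▸ hv) v rfl
    exact ⟨u', hu', htype.trans htype', hvalue.trans hvalue'⟩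

theorem tp_inf_eq_tp_ultPeriodic {w : Stream' A} {k : ℕ} {m : ℕ → ℕ} (hm : StrictMono m)
    {u v : FreeSemigroup A} (hu : tp k (fin (factor w 0 (m 0))) = tp k (fin (letters u)))
    (hv : ∀ i, tp k (fin (factor w (m i) (m (i + 1)))) = tp k (fin (letters v))) :
    tp k (inf w) = tp k (ultPeriodic (letters u) (letters v)) := by
  rw [← Stream'.append_take_drop (m 0) w, drop_eq_concat_factorization w hm, ← prepend_inf]
  refine tp_prepend_congr (v' := inf (concat (Stream'.const v))) hu (tp_concat_congr fun i => ?_)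
  refine Eq.trans ?_ (hv i)
  exact congrArg (fun x => tp k (fin x)) (letters_block w (hm (Nat.lt_succ_self i)))

theorem exists_ultPeriodic [Finite A] [Finite S] (α : OmegaHom (FreeSemigroup A) (Stream' A) S T)
    (k : ℕ) (w : Stream' A) : ∃ u v : FreeSemigroup A,
      (letters u).length ≤ numTypes (Nat.card A) k * Nat.card S ∧
      (letters v).length ≤ numTypes (Nat.card A) k * Nat.card S ∧
      tp k (inf w) = tp k (ultPeriodic (letters u) (letters v)) ∧
      α.inf w = α.fin u • (iprod (Stream'.const (α.fin v)) : T) := by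
  obtain ⟨m, γ, hm, hγ⟩ :=
    exists_strictMono_homogeneous fun i j => tp k (fin (factor w (i + 1) (j + 1)))
  have hcuts : StrictMono fun i => m i + 1 := fun i j h => Nat.succ_lt_succ (hm h)
  obtain ⟨a, b, hab, hw⟩ := exists_value α w hcuts (Nat.succ_pos _)
  obtain ⟨u, hu, hutype, huvalue⟩ := exists_short_word α.fin k (block w 0 (m a + 1))
  obtain ⟨v, hv, hvtype, hvvalue⟩ := exists_short_word α.fin k (block w (m a + 1) (m b + 1))
  rw [letters_block _ (Nat.succ_pos _)] at hutype
  rw [letters_block _ (hcuts hab), hγ _ _ hab] at hvtype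
  refine ⟨u, v, hu, hv, tp_inf_eq_tp_ultPeriodic (m := fun i => m (a + i) + 1)
    (fun i j h => hcuts (Nat.add_lt_add_left h a)) hutype fun i => ?_, by rw [hw, huvalue, hvvalue]⟩
  rw [← hvtype]
  exact hγ _ _ (Nat.lt_succ_self _)

/-- The words of length at most `b` over a list of letters. -/
def wordsUpTo {A : Type*} (L : List A) : ℕ → List (List A)
  | 0 => [[]]
  | b + 1 => [] :: (wordsUpTo L b).flatMap fun w => L.map (· :: w)

theorem mem_wordsUpTo {L : List A} {b : ℕ} {w : List A} (hb : w.length ≤ b) (h : ∀ a ∈ w, a ∈ L) :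
    w ∈ wordsUpTo L b := by
  induction b generalizing w with
  | zero => simp_all [wordsUpTo]
  | succ b ih =>
    rcases w with _ | ⟨a, w⟩
    · simp [wordsUpTo]
    · obtain ⟨ha, hw⟩ := List.forall_mem_cons.1 h
      exact List.mem_cons_of_mem _ (List.mem_flatMap.2
        ⟨w, ih (Nat.le_of_succ_le_succ hb) hw, List.mem_map.2 ⟨a, ha, rfl⟩⟩)

end Saturation

namespace FOWord

open FirstOrder Word AnyWord Saturation OmegaSemigroup

variable {A S T : Type*} [Semigroup S] [OmegaSemigroup S T]

/-- The sentence that the type of a word is that of one of the words `u v v v ⋯`, for `u` and `v` in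
a list, that pass a test. -/
def lassoSentence (t k : ℕ) (W : List (List A)) (test : List A → List A → Bool) :
    (lang A).Sentence :=
  disj (W.flatMap fun u => W.flatMap fun v =>
    if test u v then [hintikka t k none none u v] else [])

theorem mem_flatMap_flatMap_ite {β : Type*} {W : List (List A)} {test : List A → List A → Bool}
    {f : List A → List A → β} {x : β} :
    (x ∈ W.flatMap fun u => W.flatMap fun v => if test u v then [f u v] else []) ↔
      ∃ u ∈ W, ∃ v ∈ W, test u v = true ∧ x = f u v := by
  simp

theorem qrank_lassoSentence_le (t k : ℕ) (W : List (List A)) (test : List A → List A → Bool) :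
    qrank (lassoSentence t k W test) ≤ k := by
  refine qrank_disj_le fun φ hφ => ?_
  obtain ⟨u, -, v, -, -, rfl⟩ := mem_flatMap_flatMap_ite.1 hφ
  exact qrank_hintikka_le t k none none u v

theorem models_lassoSentence_iff {t k : ℕ} (ht : 2 ^ k ≤ t) {W : List (List A)}
    {test : List A → List A → Bool} {w : Stream' A} : Models w (lassoSentence t k W test) ↔
      ∃ u ∈ W, ∃ v ∈ W, test u v = true ∧ tp k (inf w) = tp k (ultPeriodic u v) := by
  rw [models_iff, lassoSentence, holds_disj]
  have hmodels (u v : List A) := holds_hintikka (n := 0) ht none none u v w default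
  constructor
  · rintro ⟨φ, hφ, h⟩
    obtain ⟨u, hu, v, hv, htest, rfl⟩ := mem_flatMap_flatMap_ite.1 hφ
    exact ⟨u, hu, v, hv, htest, (hmodels u v).1 h⟩
  · rintro ⟨u, hu, v, hv, htest, h⟩
    exact ⟨_, mem_flatMap_flatMap_ite.2 ⟨u, hu, v, hv, htest, rfl⟩, (hmodels u v).2 h⟩

theorem inf_append_concat_const (α : OmegaHom (FreeSemigroup A) (Stream' A) S T)
    (u v : FreeSemigroup A) : α.inf (letters u ++ₛ concat (Stream'.const v)) =
      α.fin u • (iprod (Stream'.const (α.fin v)) : T) := by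
  have hmap := α.map_smul u (iprod (Stream'.const v))
  rwa [α.map_iprod] at hmap

theorem separates_lassoSentence [Finite A] [Finite S]
    (α : OmegaHom (FreeSemigroup A) (Stream' A) S T) {F₀ F₁ : Set T}
    (h : ∀ p ∈ F₀, ∀ q ∈ F₁, ¬ Close (letterImage α.fin) p q) {t k : ℕ}
    (hk : k = Nat.card A * 2 ^ (Nat.card S ^ 2) + 1) (ht : 2 ^ k ≤ t) {L : List A}
    (hL : ∀ a, a ∈ L) {test : List A → List A → Bool}
    (htest : ∀ u v, test u v = true ↔ ∃ u' v' : FreeSemigroup A, letters u' = u ∧ letters v' = v ∧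
      α.fin u' • (iprod (Stream'.const (α.fin v')) : T) ∈ F₀) :
    Separates
      (langOf (lassoSentence t k (wordsUpTo L (numTypes (Nat.card A) k * Nat.card S)) test))
      (α.inf ⁻¹' F₀) (α.inf ⁻¹' F₁) := by
  constructor
  · intro w hw
    obtain ⟨u, v, hu, hv, htype, hvalue⟩ := exists_ultPeriodic α k w
    exact (models_lassoSentence_iff ht).2 ⟨_, mem_wordsUpTo hu fun a _ => hL a, _,
      mem_wordsUpTo hv fun a _ => hL a, (htest _ _).2 ⟨u, v, rfl, rfl, hvalue ▸ hw⟩, htype⟩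
  · refine Set.eq_empty_iff_forall_notMem.2 fun w ⟨hw, hmodels⟩ => ?_
    obtain ⟨_, -, _, -, huv, htype⟩ := (models_lassoSentence_iff ht).1 hmodels
    obtain ⟨u, v, rfl, rfl, hF₀⟩ := (htest _ _).1 huv
    refine h _ hF₀ _ hw ?_
    rw [← inf_append_concat_const]
    exact close_of_tp_eq α (hk ▸ htype.symm)

theorem separable_iff [Finite A] [Finite S] (α : OmegaHom (FreeSemigroup A) (Stream' A) S T)
    (F₀ F₁ : Set T) : Separable (α.inf ⁻¹' F₀) (α.inf ⁻¹' F₁) ↔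
      ∀ p ∈ F₀, ∀ q ∈ F₁, ¬ Close (letterImage α.fin) p q := by
  classical
  refine ⟨fun h p hp q hq => not_close_of_separable h hp hq, fun h => ?_⟩
  have := Fintype.ofFinite A
  exact ⟨_, separates_lassoSentence α h rfl le_rfl (L := Finset.univ.toList)
    (test := fun u v => decide (∃ u' v' : FreeSemigroup A, letters u' = u ∧ letters v' = v ∧
      α.fin u' • (iprod (Stream'.const (α.fin v')) : T) ∈ F₀)) (by simp) (by simp)⟩

end FOWord
/-! ## Reading an input -/

section Tables

variable {β : Type*} {m k : ℕ}

theorem getD_append_length_add {l₁ : List β} {p : ℕ} (h : l₁.length = p) (l₂ : List β) (i : ℕ)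
    (d : β) : (l₁ ++ l₂).getD (p + i) d = l₂.getD i d := by
  subst h
  rw [List.getD_append_right _ _ _ _ (Nat.le_add_right _ _), Nat.add_sub_cancel_left]

theorem getD_map_finRange_append (f : Fin m → β) (l : List β) (i : Fin m) (d : β) :
    ((List.finRange m).map f ++ l).getD i d = f i := by
  rw [List.getD_append _ _ _ _ (by simp)]
  simp

theorem length_flatMap_finRange (f : Fin m → Fin k → β) :
    ((List.finRange m).flatMap fun i => (List.finRange k).map (f i)).length = m * k := by
  simp [List.length_flatMap]

theorem getD_flatMap_finRange_append (f : Fin m → Fin k → β) (l : List β) (i : Fin m) (j : Fin k)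
    (d : β) : (((List.finRange m).flatMap fun i => (List.finRange k).map (f i)) ++ l).getD
      (i * k + j) d = f i j := by
  induction m with
  | zero => exact i.elim0
  | succ m ih =>
    rw [List.finRange_succ, List.flatMap_cons, List.append_assoc]
    induction i using Fin.cases with
    | zero => simpa using getD_map_finRange_append (f 0) _ j d
    | succ i =>
      have hindex : (i.succ : ℕ) * k + j = k + (i * k + j) := by rw [Fin.val_succ]; ring
      rw [hindex, getD_append_length_add (by simp)]
      simpa [List.flatMap_map] using ih (fun i => f i.succ) i

end Tables

section

open OmegaSemigroup

variable {A S T : Type*} [Semigroup S] [OmegaSemigroup S T] {n m k : ℕ}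
  (eA : A ≃ Fin n) (eS : S ≃ Fin m) (eT : T ≃ Fin k)
  (α : OmegaHom (FreeSemigroup A) (Stream' A) S T) (F₀ F₁ : Set T)

/-- The tables of an input stand in a memory, at the addresses at which a random access machine
finds them. -/
structure IsPresented (mem : ℕ → ℕ) : Prop where
  size_fin : mem 0 = m
  size_inf : mem 1 = k
  size_letters : mem 2 = n
  mul (s t : S) : mem (3 + (eS s * m + eS t)) = eS (s * t)
  smul (s : S) (t : T) : mem (3 + m * m + (eS s * k + eT t)) = eT (s • t)
  power (s : S) : mem (3 + m * m + m * k + eS s) = eT (iprod (Stream'.const s))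
  letter (a : A) : mem (3 + m * m + m * k + m + eA a) = eS (Saturation.letterImage α.fin a)
  left (t : T) : mem (3 + m * m + m * k + m + n + eT t) = 1 ↔ t ∈ F₀
  right (t : T) : mem (3 + m * m + m * k + m + n + k + eT t) = 1 ↔ t ∈ F₁

theorem isPresented_presentation :
    IsPresented eA eS eT α F₀ F₁ fun i => (presentation eA eS eT α F₀ F₁).getD i 0 := by
  have hsizes (i : ℕ) (l : List ℕ) : ([m, k, n] ++ l).getD (3 + i) 0 = l.getD i 0 :=
    getD_append_length_add rfl l i 0
  constructor
  · rfl
  · rfl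
  · rfl
  all_goals simp only [presentation, List.append_assoc, Nat.add_assoc, hsizes]
  · intro s t
    rw [getD_flatMap_finRange_append]
    simp
  · intro s t
    rw [getD_append_length_add (length_flatMap_finRange _), getD_flatMap_finRange_append]
    simp
  · intro s
    rw [getD_append_length_add (length_flatMap_finRange _),
      getD_append_length_add (length_flatMap_finRange _), getD_map_finRange_append]
    simp
  · intro a
    rw [getD_append_length_add (length_flatMap_finRange _),
      getD_append_length_add (length_flatMap_finRange _), getD_append_length_add (by simp),
      getD_map_finRange_append]
    simp [Saturation.letterImage]
  · intro t
    rw [getD_append_length_add (length_flatMap_finRange _),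
      getD_append_length_add (length_flatMap_finRange _), getD_append_length_add (by simp),
      getD_append_length_add (by simp), getD_map_finRange_append]
    simp
  · intro t
    rw [getD_append_length_add (length_flatMap_finRange _),
      getD_append_length_add (length_flatMap_finRange _), getD_append_length_add (by simp),
      getD_append_length_add (by simp), getD_append_length_add (by simp)]
    simp

end
/-! ## Primitive recursive functions on lists -/

attribute [fun_prop] Primrec

section Primrec

variable {α β σ : Type*} [Primcodable α] [Primcodable β] [Primcodable σ]

@[fun_prop]
theorem primrec_id : Primrec fun a : α => a := Primrec.id

@[fun_prop]
theorem primrec_const (c : β) : Primrec fun _ : α => c := Primrec.const c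

@[fun_prop]
theorem primrec_comp {f : β → σ} {g : α → β} (hf : Primrec f) (hg : Primrec g) :
    Primrec fun a => f (g a) := hf.comp hg

@[fun_prop]
theorem primrec_pair {f : α → β} {g : α → σ} (hf : Primrec f) (hg : Primrec g) :
    Primrec fun a => (f a, g a) := hf.pair hg

@[fun_prop]
theorem primrec_fst {f : α → β × σ} (hf : Primrec f) : Primrec fun a => (f a).1 :=
  Primrec.fst.comp hf

@[fun_prop]
theorem primrec_snd {f : α → β × σ} (hf : Primrec f) : Primrec fun a => (f a).2 :=
  Primrec.snd.comp hf

@[fun_prop]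
theorem primrec_add {f g : α → ℕ} (hf : Primrec f) (hg : Primrec g) :
    Primrec fun a => f a + g a := Primrec.nat_add.comp hf hg

@[fun_prop]
theorem primrec_sub {f g : α → ℕ} (hf : Primrec f) (hg : Primrec g) :
    Primrec fun a => f a - g a := Primrec.nat_sub.comp hf hg

@[fun_prop]
theorem primrec_mul {f g : α → ℕ} (hf : Primrec f) (hg : Primrec g) :
    Primrec fun a => f a * g a := Primrec.nat_mul.comp hf hg

@[fun_prop]
theorem primrec_pow {f g : α → ℕ} (hf : Primrec f) (hg : Primrec g) :
    Primrec fun a => f a ^ g a := (Primrec₂.unpaired'.1 Nat.Primrec.pow).comp hf hg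

@[fun_prop]
theorem primrec_cons {f : α → β} {g : α → List β} (hf : Primrec f) (hg : Primrec g) :
    Primrec fun a => f a :: g a := Primrec.list_cons.comp hf hg

@[fun_prop]
theorem primrec_append {f g : α → List β} (hf : Primrec f) (hg : Primrec g) :
    Primrec fun a => f a ++ g a := Primrec.list_append.comp hf hg

@[fun_prop]
theorem primrec_length {f : α → List β} (hf : Primrec f) :
    Primrec fun a => (f a).length := Primrec.list_length.comp hf

@[fun_prop]
theorem primrec_range {f : α → ℕ} (hf : Primrec f) :
    Primrec fun a => List.range (f a) := Primrec.list_range.comp hf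

@[fun_prop]
theorem primrec_some {f : α → β} (hf : Primrec f) :
    Primrec fun a => some (f a) := Primrec.option_some.comp hf

@[fun_prop]
theorem primrec_map {f : α → List β} {g : α → β → σ} (hf : Primrec f)
    (hg : Primrec fun p : α × β => g p.1 p.2) : Primrec fun a => (f a).map (g a) :=
  Primrec.list_map hf hg

@[fun_prop]
theorem primrec_flatMap {f : α → List β} {g : α → β → List σ} (hf : Primrec f)
    (hg : Primrec fun p : α × β => g p.1 p.2) : Primrec fun a => (f a).flatMap (g a) :=
  Primrec.list_flatMap hf hg

@[fun_prop]
theorem primrec_foldr {f : α → List β} {g : α → σ} {h : α → β → σ → σ} (hf : Primrec f)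
    (hg : Primrec g) (hh : Primrec fun p : α × β × σ => h p.1 p.2.1 p.2.2) :
    Primrec fun a => (f a).foldr (h a) (g a) :=
  Primrec.list_foldr hf hg (h := fun a p => h a p.1 p.2) hh

@[fun_prop]
theorem primrec_foldl {f : α → List β} {g : α → σ} {h : α → σ → β → σ} (hf : Primrec f)
    (hg : Primrec g) (hh : Primrec fun p : α × σ × β => h p.1 p.2.1 p.2.2) :
    Primrec fun a => (f a).foldl (h a) (g a) :=
  Primrec.list_foldl hf hg (h := fun a p => h a p.1 p.2) hh

@[fun_prop]
theorem primrec_getD {f : α → List β} {g : α → ℕ} {d : β} (hf : Primrec f)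
    (hg : Primrec g) : Primrec fun a => (f a).getD (g a) d := (Primrec.list_getD d).comp hf hg

@[fun_prop]
theorem primrec_take {f : α → List β} {g : α → ℕ} (hf : Primrec f)
    (hg : Primrec g) : Primrec fun a => (f a).take (g a) := Primrec.list_take.comp hg hf

@[fun_prop]
theorem primrec_drop {f : α → List β} {g : α → ℕ} (hf : Primrec f)
    (hg : Primrec g) : Primrec fun a => (f a).drop (g a) := Primrec.list_drop.comp hg hf

@[fun_prop]
theorem primrec_elim {o : α → Option β} {f : α → σ} {g : α → β → σ} (ho : Primrec o)
    (hf : Primrec f) (hg : Primrec fun p : α × β => g p.1 p.2) :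
    Primrec fun a => (o a).elim (f a) (g a) :=
  (Primrec.option_casesOn ho hf (g := g) hg).of_eq fun a => by cases o a <;> rfl

@[fun_prop]
theorem primrec_ite_eq {f g : α → ℕ} {x y : α → σ} (hf : Primrec f) (hg : Primrec g)
    (hx : Primrec x) (hy : Primrec y) : Primrec fun a => if f a = g a then x a else y a :=
  Primrec.ite (Primrec.eq.comp hf hg) hx hy

end Primrec

/-! ## Codes of the separating sentences -/

namespace FOWord

open FirstOrder Word AnyWord Saturation OmegaSemigroup

/-- The code of a negation. -/
def negCode (φ : List ℕ) : List ℕ := 4 :: (φ ++ [0])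

/-- The code of a conjunction. -/
def conjCode (l : List (List ℕ)) : List ℕ :=
  l.foldr (fun φ ψ => negCode (4 :: (φ ++ negCode ψ))) (negCode [0])

/-- The code of a disjunction. -/
def disjCode (l : List (List ℕ)) : List ℕ := l.foldr (fun φ ψ => 4 :: (negCode φ ++ ψ)) [0]

/-- The code of a formula `allBetween`; the new variable has number `n`. -/
def allBetweenCode (n : ℕ) (l r : Option ℕ) (φ : List ℕ) : List ℕ :=
  5 :: l.elim (r.elim φ fun j => 4 :: 3 :: n :: j :: φ)
    fun i => 4 :: 3 :: i :: n :: r.elim φ fun j => 4 :: 3 :: n :: j :: φ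

/-- The code of a formula `exactlyBetween`; the new variable has number `n`. -/
def exactlyBetweenCode (n : ℕ) (l r : Option ℕ) (b : List (List ℕ)) : List ℕ :=
  conjCode (allBetweenCode n l r (disjCode b) ::
    b.map fun φ => negCode (allBetweenCode n l r (negCode φ)))

/-- The code of a formula `hintikka`; the outermost quantified variable has number `n`. -/
def hintikkaCode (t : ℕ) : ℕ → ℕ → Option ℕ → Option ℕ → List ℕ → List ℕ → List ℕ
  | 0, _, _, _, _, _ => negCode [0]
  | k + 1, n, l, r, u, v =>
    exactlyBetweenCode n l r ((List.range (u ++ power t v).length).map fun i => conjCode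
      [ [2, (u ++ power t v).getD i 0, n],
        hintikkaCode t k (n + 1) l (some n) ((u ++ power t v).take i) [],
        hintikkaCode t k (n + 1) (some n) r ((u ++ power t v).drop (i + 1)) v])

/-- The arguments of the recursive calls of `hintikkaCode`. -/
def hintikkaCalls (t k n : ℕ) (l r : Option ℕ) (u v : List ℕ) :
    List (ℕ × ℕ × ℕ × Option ℕ × Option ℕ × List ℕ × List ℕ) :=
  if k = 0 then [] else
    ((List.range (u ++ power t v).length).map fun i =>
      (t, k - 1, n + 1, l, some n, (u ++ power t v).take i, [])) ++
    (List.range (u ++ power t v).length).map fun i =>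
      (t, k - 1, n + 1, some n, r, (u ++ power t v).drop (i + 1), v)

/-- The value of `hintikkaCode` in terms of the list `c` of the values of the recursive calls. -/
def hintikkaStep (t k n : ℕ) (l r : Option ℕ) (u v : List ℕ) (c : List (List ℕ)) : List ℕ :=
  if k = 0 then negCode [0] else
    exactlyBetweenCode n l r ((List.range (u ++ power t v).length).map fun i => conjCode
      [ [2, (u ++ power t v).getD i 0, n], c.getD i [], c.getD ((u ++ power t v).length + i) [] ])

theorem hintikkaStep_eq (t k n : ℕ) (l r : Option ℕ) (u v : List ℕ) :
    hintikkaStep t k n l r u v ((hintikkaCalls t k n l r u v).map fun b =>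
      hintikkaCode b.1 b.2.1 b.2.2.1 b.2.2.2.1 b.2.2.2.2.1 b.2.2.2.2.2.1 b.2.2.2.2.2.2) =
    hintikkaCode t k n l r u v := by
  cases k with
  | zero => rfl
  | succ k =>
    rw [hintikkaStep, if_neg k.succ_ne_zero, hintikkaCode]
    refine congrArg (exactlyBetweenCode n l r) (List.map_congr_left fun i hi => ?_)
    have hi := List.mem_range.1 hi
    rw [hintikkaCalls, if_neg k.succ_ne_zero, List.map_append,
      List.getD_append _ _ ([] : List ℕ) _ (by simpa using hi), getD_append_length_add (by simp)]
    generalize u ++ power t v = w at hi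
    simp [hi]

section

variable {α : Type*} [Primcodable α]

@[fun_prop]
theorem primrec_power {f : α → ℕ} {g : α → List ℕ} (hf : Primrec f) (hg : Primrec g) :
    Primrec fun a => power (f a) (g a) := by
  have hflatMap : Primrec fun a => (List.range (f a)).flatMap fun _ => g a := by fun_prop
  refine hflatMap.of_eq fun a => ?_
  rw [power, List.flatMap_def, List.map_const', List.length_range]

@[fun_prop]
theorem primrec_negCode {f : α → List ℕ} (hf : Primrec f) : Primrec fun a => negCode (f a) := by
  unfold negCode; fun_prop

@[fun_prop]
theorem primrec_conjCode {f : α → List (List ℕ)} (hf : Primrec f) :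
    Primrec fun a => conjCode (f a) := by
  unfold conjCode; fun_prop

@[fun_prop]
theorem primrec_disjCode {f : α → List (List ℕ)} (hf : Primrec f) :
    Primrec fun a => disjCode (f a) := by
  unfold disjCode; fun_prop

@[fun_prop]
theorem primrec_allBetweenCode {n : α → ℕ} {l r : α → Option ℕ} {f : α → List ℕ}
    (hn : Primrec n) (hl : Primrec l) (hr : Primrec r) (hf : Primrec f) :
    Primrec fun a => allBetweenCode (n a) (l a) (r a) (f a) := by
  unfold allBetweenCode; fun_prop

@[fun_prop]
theorem primrec_exactlyBetweenCode {n : α → ℕ} {l r : α → Option ℕ} {f : α → List (List ℕ)}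
    (hn : Primrec n) (hl : Primrec l) (hr : Primrec r) (hf : Primrec f) :
    Primrec fun a => exactlyBetweenCode (n a) (l a) (r a) (f a) := by
  unfold exactlyBetweenCode; fun_prop

@[fun_prop]
theorem primrec_hintikkaCode {t k n : α → ℕ} {l r : α → Option ℕ} {u v : α → List ℕ}
    (ht : Primrec t) (hk : Primrec k) (hn : Primrec n) (hl : Primrec l) (hr : Primrec r)
    (hu : Primrec u) (hv : Primrec v) :
    Primrec fun a => hintikkaCode (t a) (k a) (n a) (l a) (r a) (u a) (v a) := by
  suffices Primrec fun b : ℕ × ℕ × ℕ × Option ℕ × Option ℕ × List ℕ × List ℕ =>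
      hintikkaCode b.1 b.2.1 b.2.2.1 b.2.2.2.1 b.2.2.2.2.1 b.2.2.2.2.2.1 b.2.2.2.2.2.2 from
    this.comp (g := fun a => (t a, k a, n a, l a, r a, u a, v a)) (by fun_prop)
  refine Primrec.nat_omega_rec' _ (m := fun b => b.2.1)
    (l := fun b =>
      hintikkaCalls b.1 b.2.1 b.2.2.1 b.2.2.2.1 b.2.2.2.2.1 b.2.2.2.2.2.1 b.2.2.2.2.2.2)
    (g := fun b c => some
      (hintikkaStep b.1 b.2.1 b.2.2.1 b.2.2.2.1 b.2.2.2.2.1 b.2.2.2.2.2.1 b.2.2.2.2.2.2 c))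
    (by fun_prop) ?_ (Primrec₂.mk ?_) ?_ fun _ => congrArg some (hintikkaStep_eq ..)
  · unfold hintikkaCalls; fun_prop
  · unfold hintikkaStep; fun_prop
  · rintro ⟨t, k, n, l, r, u, v⟩ b hb
    rcases Nat.eq_zero_or_pos k with rfl | hk
    · simp [hintikkaCalls] at hb
    · rw [hintikkaCalls, if_neg hk.ne', List.mem_append, List.mem_map, List.mem_map] at hb
      rcases hb with ⟨i, -, rfl⟩ | ⟨i, -, rfl⟩ <;> exact Nat.sub_lt hk one_pos

end

section

variable {A : Type*} (c : A → ℕ)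

theorem code_neg {n : ℕ} (φ : (lang A).BoundedFormula Empty n) :
    code c (neg φ) = negCode (code c φ) := rfl

theorem code_conj {n : ℕ} (l : List ((lang A).BoundedFormula Empty n)) :
    code c (conj l) = conjCode (l.map (code c)) := by
  induction l with
  | nil => rfl
  | cons φ l ih =>
    change negCode (4 :: (code c φ ++ negCode (code c (conj l)))) = _
    rw [ih]
    rfl

theorem code_disj {n : ℕ} (l : List ((lang A).BoundedFormula Empty n)) :
    code c (disj l) = disjCode (l.map (code c)) := by
  induction l with
  | nil => rfl
  | cons φ l ih =>
    change 4 :: (negCode (code c φ) ++ code c (disj l)) = _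
    rw [ih]
    rfl

theorem code_allBetween {n : ℕ} (l r : Option (Fin n))
    (φ : (lang A).BoundedFormula Empty (n + 1)) :
    code c (allBetween l r φ) = allBetweenCode n (l.map Fin.val) (r.map Fin.val) (code c φ) := by
  cases l <;> cases r <;> rfl

theorem code_exactlyBetween {n : ℕ} (l r : Option (Fin n))
    (b : List ((lang A).BoundedFormula Empty (n + 1))) :
    code c (exactlyBetween l r b) =
      exactlyBetweenCode n (l.map Fin.val) (r.map Fin.val) (b.map (code c)) := by
  rw [exactlyBetween, exactlyBetweenCode, code_conj]
  simp only [List.map_cons, List.map_map, Function.comp_def, code_allBetween, code_disj, code_neg]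

theorem map_splits {β : Type*} (l : List A) (f : List ℕ → ℕ → List ℕ → β) :
    (splits l).map (fun s => f (s.1.map c) (c s.2.1) (s.2.2.map c)) =
      (List.range (l.map c).length).map fun i =>
        f ((l.map c).take i) ((l.map c).getD i 0) ((l.map c).drop (i + 1)) := by
  induction l generalizing f with
  | nil => rfl
  | cons a l ih =>
    rw [splits, List.map_cons, List.map_map, List.map_cons, List.length_cons,
      List.range_succ_eq_map, List.map_cons, List.map_map]
    exact congrArg₂ _ rfl (ih fun x b y => f (c a :: x) b y)

theorem map_power (t : ℕ) (v : List A) : (power t v).map c = power t (v.map c) := by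
  simp [power, List.map_flatten]

theorem code_hintikka (t k : ℕ) {n : ℕ} (l r : Option (Fin n)) (u v : List A) :
    code c (hintikka t k l r u v) =
      hintikkaCode t k n (l.map Fin.val) (r.map Fin.val) (u.map c) (v.map c) := by
  induction k generalizing n l r u v with
  | zero => rfl
  | succ k ih =>
    have hcast (i : Option (Fin n)) : (i.map Fin.castSucc).map Fin.val = i.map Fin.val := by
      cases i <;> rfl
    rw [hintikka, code_exactlyBetween, hintikkaCode, ← map_power, ← List.map_append,
      ← map_splits c _ fun x b y => conjCode [ [2, b, n],
        hintikkaCode t k (n + 1) (l.map Fin.val) (some n) x [],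
        hintikkaCode t k (n + 1) (some n) (r.map Fin.val) y (v.map c)], List.map_map]
    refine congrArg _ (List.map_congr_left fun s _ => ?_)
    simp only [Function.comp, code_conj, List.map_cons, List.map_nil, ih, hcast]
    rfl

end

end FOWord
/-! ## Computing the code of a separating sentence -/

namespace FOWord

open FirstOrder Word AnyWord Saturation OmegaSemigroup

section Input

variable (l : List ℕ)

/-- The entry of the product table of the input `l` for the elements number `s` and `t`. -/
def mulEntry (s t : ℕ) : ℕ := l.getD (3 + (s * l.getD 0 0 + t)) 0

/-- The entry of the table of the mixed product of the input `l` for the elements number `s`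
and `t`. -/
def smulEntry (s t : ℕ) : ℕ :=
  l.getD (3 + l.getD 0 0 * l.getD 0 0 + (s * l.getD 1 0 + t)) 0

/-- The entry of the table of infinite powers of the input `l` for the element number `s`. -/
def powerEntry (s : ℕ) : ℕ :=
  l.getD (3 + l.getD 0 0 * l.getD 0 0 + l.getD 0 0 * l.getD 1 0 + s) 0

/-- The image of the letter number `a` in the input `l`. -/
def letterEntry (a : ℕ) : ℕ :=
  l.getD (3 + l.getD 0 0 * l.getD 0 0 + l.getD 0 0 * l.getD 1 0 + l.getD 0 0 + a) 0

/-- The entry number `t` of the characteristic sequence of the first set of the input `l`. -/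
def leftEntry (t : ℕ) : ℕ :=
  l.getD (3 + l.getD 0 0 * l.getD 0 0 + l.getD 0 0 * l.getD 1 0 + l.getD 0 0 + l.getD 2 0 + t) 0

/-- The number of the value of a nonempty word in the finite part of the `ω`-semigroup. -/
def wordValue (u : List ℕ) : ℕ :=
  (u.drop 1).foldl (fun s b => mulEntry l s (letterEntry l b)) (letterEntry l (u.getD 0 0))

/-- The value `1` if the words `u` and `v` are nonempty and the value of `u v v v ⋯` is in the
first set of the input `l`. -/
def lassoValue (u v : List ℕ) : ℕ :=
  if u.length = 0 then 0 else if v.length = 0 then 0 else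
    leftEntry l (smulEntry l (wordValue l u) (powerEntry l (wordValue l v)))

/-- The quantifier rank of the separating sentence. -/
def separatorRank : ℕ := l.getD 2 0 * 2 ^ (l.getD 0 0 ^ 2) + 1

/-- The bound on the lengths of the words `u` and `v` for which the separating sentence refers to
`u v v v ⋯`. -/
def separatorBound : ℕ := numTypes (l.getD 2 0) (separatorRank l) * l.getD 0 0

/-- The code of the separating sentence, `FOWord.lassoSentence` for the first set. -/
def separatorCode : List ℕ :=
  disjCode ((wordsUpTo (List.range (l.getD 2 0)) (separatorBound l)).flatMap fun u =>
    (wordsUpTo (List.range (l.getD 2 0)) (separatorBound l)).flatMap fun v =>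
      if lassoValue l u v = 1 then
        [hintikkaCode (2 ^ separatorRank l) (separatorRank l) 0 none none u v]
      else [])

end Input

section Primrec

variable {α : Type*} [Primcodable α]

@[fun_prop]
theorem primrec_numTypes {n k : α → ℕ} (hn : Primrec n) (hk : Primrec k) :
    Primrec fun a => numTypes (n a) (k a) := by
  have hstep : Primrec₂ fun (a : α) (p : ℕ × ℕ) => 2 ^ (p.2 * (n a * p.2)) :=
    Primrec₂.mk (by fun_prop)
  refine (Primrec.nat_rec' hk (Primrec.const 1) hstep).of_eq fun a => ?_
  generalize k a = k
  induction k with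
  | zero => rfl
  | succ k ih => exact congrArg (fun x => 2 ^ (x * (n a * x))) ih

@[fun_prop]
theorem primrec_wordsUpTo {L : α → List ℕ} {b : α → ℕ} (hL : Primrec L) (hb : Primrec b) :
    Primrec fun a => wordsUpTo (L a) (b a) := by
  have hstep : Primrec₂ fun (a : α) (p : ℕ × List (List ℕ)) =>
      [] :: p.2.flatMap fun w => (L a).map fun x => x :: w := Primrec₂.mk (by fun_prop)
  refine (Primrec.nat_rec' hb (Primrec.const [ [] ]) hstep).of_eq fun a => ?_
  generalize b a = b
  induction b with
  | zero => rfl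
  | succ b ih => exact congrArg (fun x => [] :: x.flatMap fun w => (L a).map (· :: w)) ih

@[fun_prop]
theorem primrec_wordValue {l u : α → List ℕ} (hl : Primrec l) (hu : Primrec u) :
    Primrec fun a => wordValue (l a) (u a) := by
  unfold wordValue mulEntry letterEntry; fun_prop

@[fun_prop]
theorem primrec_lassoValue {l u v : α → List ℕ} (hl : Primrec l) (hu : Primrec u)
    (hv : Primrec v) : Primrec fun a => lassoValue (l a) (u a) (v a) := by
  unfold lassoValue leftEntry smulEntry powerEntry; fun_prop

@[fun_prop]
theorem primrec_separatorRank {l : α → List ℕ} (hl : Primrec l) :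
    Primrec fun a => separatorRank (l a) := by
  unfold separatorRank; fun_prop

@[fun_prop]
theorem primrec_separatorBound {l : α → List ℕ} (hl : Primrec l) :
    Primrec fun a => separatorBound (l a) := by
  unfold separatorBound; fun_prop

theorem primrec_separatorCode : Primrec separatorCode := by
  unfold separatorCode; fun_prop

end Primrec

section Presented

variable {A S T : Type*} [Semigroup S] [OmegaSemigroup S T] {n m k : ℕ}
  {eA : A ≃ Fin n} {eS : S ≃ Fin m} {eT : T ≃ Fin k}
  {α : OmegaHom (FreeSemigroup A) (Stream' A) S T} {F₀ F₁ : Set T} {l : List ℕ}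

theorem mulEntry_eq (h : IsPresented eA eS eT α F₀ F₁ fun i => l.getD i 0) (s t : S) :
    mulEntry l (eS s) (eS t) = eS (s * t) := by
  rw [mulEntry, h.size_fin, h.mul]

theorem smulEntry_eq (h : IsPresented eA eS eT α F₀ F₁ fun i => l.getD i 0) (s : S) (t : T) :
    smulEntry l (eS s) (eT t) = eT (s • t) := by
  rw [smulEntry, h.size_fin, h.size_inf, h.smul]

theorem powerEntry_eq (h : IsPresented eA eS eT α F₀ F₁ fun i => l.getD i 0) (s : S) :
    powerEntry l (eS s) = eT (iprod (Stream'.const s)) := by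
  rw [powerEntry, h.size_fin, h.size_inf, h.power]

theorem letterEntry_eq (h : IsPresented eA eS eT α F₀ F₁ fun i => l.getD i 0) (a : A) :
    letterEntry l (eA a) = eS (letterImage α.fin a) := by
  rw [letterEntry, h.size_fin, h.size_inf, h.letter]

theorem leftEntry_eq_one_iff (h : IsPresented eA eS eT α F₀ F₁ fun i => l.getD i 0) (t : T) :
    leftEntry l (eT t) = 1 ↔ t ∈ F₀ := by
  rw [leftEntry, h.size_fin, h.size_inf, h.size_letters, h.left]

theorem wordValue_eq (h : IsPresented eA eS eT α F₀ F₁ fun i => l.getD i 0) (u : FreeSemigroup A) :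
    wordValue l ((letters u).map fun a => (eA a : ℕ)) = eS (α.fin u) := by
  obtain ⟨a, u⟩ := u
  rw [← foldl_letterImage]
  simp only [wordValue, letters, List.map_cons, List.drop_succ_cons, List.drop_zero,
    List.getD_cons_zero, letterEntry_eq h]
  generalize letterImage α.fin a = s
  induction u generalizing s with
  | nil => rfl
  | cons b u ih =>
    simp only [List.map_cons, List.foldl_cons, letterEntry_eq h, mulEntry_eq h]
    exact ih _

theorem lassoValue_eq_one_iff (h : IsPresented eA eS eT α F₀ F₁ fun i => l.getD i 0)
    (u v : List A) :
    lassoValue l (u.map fun a => (eA a : ℕ)) (v.map fun a => (eA a : ℕ)) = 1 ↔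
      ∃ u' v' : FreeSemigroup A, letters u' = u ∧ letters v' = v ∧
        α.fin u' • (iprod (Stream'.const (α.fin v')) : T) ∈ F₀ := by
  have lassoValue_letters (u v : FreeSemigroup A) :
      lassoValue l ((letters u).map fun a => (eA a : ℕ)) ((letters v).map fun a => (eA a : ℕ)) =
        leftEntry l (eT (α.fin u • iprod (Stream'.const (α.fin v)))) := by
    rw [lassoValue, if_neg (by simp [letters]), if_neg (by simp [letters]), wordValue_eq h,
      wordValue_eq h, powerEntry_eq h, smulEntry_eq h]
  constructor
  · intro hone
    rcases u with _ | ⟨a, u⟩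
    · simp [lassoValue] at hone
    rcases v with _ | ⟨b, v⟩
    · simp [lassoValue] at hone
    refine ⟨⟨a, u⟩, ⟨b, v⟩, rfl, rfl, ?_⟩
    rw [← leftEntry_eq_one_iff h, ← lassoValue_letters]
    exact hone
  · rintro ⟨u, v, rfl, rfl, hmem⟩
    rwa [lassoValue_letters, leftEntry_eq_one_iff h]

theorem map_wordsUpTo (c : A → ℕ) (L : List A) (b : ℕ) :
    (wordsUpTo L b).map (List.map c) = wordsUpTo (L.map c) b := by
  induction b with
  | zero => rfl
  | succ b ih => simp [wordsUpTo, ← ih, List.map_flatMap, List.flatMap_map, Function.comp_def]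

theorem code_lassoSentence (c : A → ℕ) (t k : ℕ) (W : List (List A)) (f : List ℕ → List ℕ → ℕ) :
    code c (lassoSentence t k W fun u v => decide (f (u.map c) (v.map c) = 1)) =
      disjCode ((W.map (List.map c)).flatMap fun u => (W.map (List.map c)).flatMap fun v =>
        if f u v = 1 then [hintikkaCode t k 0 none none u v] else []) := by
  rw [lassoSentence, code_disj]
  simp only [List.map_flatMap, List.flatMap_map]
  congr 1
  refine List.flatMap_congr fun u _ => List.flatMap_congr fun v _ => ?_
  by_cases hf : f (u.map c) (v.map c) = 1
  · simp [hf, code_hintikka]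
  · simp [hf]

theorem exists_separator [Finite S] (h : IsPresented eA eS eT α F₀ F₁ fun i => l.getD i 0)
    (hsep : Separable (α.inf ⁻¹' F₀) (α.inf ⁻¹' F₁)) : ∃ φ : (lang A).Sentence,
      separatorCode l = code (fun a => (eA a : ℕ)) φ ∧ qrank φ ≤ n * 2 ^ (m ^ 2) + 1 ∧
      Separates (langOf φ) (α.inf ⁻¹' F₀) (α.inf ⁻¹' F₁) := by
  have := Finite.of_equiv _ eA.symm
  have card_letters : Nat.card A = n := by rw [Nat.card_congr eA, Nat.card_fin]
  have card_fin : Nat.card S = m := by rw [Nat.card_congr eS, Nat.card_fin]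
  have rank_eq : separatorRank l = n * 2 ^ (m ^ 2) + 1 := by
    rw [separatorRank, h.size_fin, h.size_letters]
  have bound_eq : separatorBound l = numTypes (Nat.card A) (separatorRank l) * Nat.card S := by
    rw [separatorBound, h.size_fin, h.size_letters, card_letters, card_fin]
  let L := (List.finRange n).map eA.symm
  have map_L : L.map (fun a => (eA a : ℕ)) = List.range n := by
    simp [L, Function.comp_def]
  refine ⟨lassoSentence (2 ^ separatorRank l) (separatorRank l)
    (wordsUpTo L (separatorBound l)) fun u v =>
      decide (lassoValue l (u.map fun a => (eA a : ℕ)) (v.map fun a => (eA a : ℕ)) = 1), ?_, ?_, ?_⟩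
  · rw [code_lassoSentence, map_wordsUpTo, map_L, separatorCode, h.size_letters]
  · exact rank_eq ▸ qrank_lassoSentence_le _ _ _ _
  · rw [bound_eq]
    refine separates_lassoSentence α ((separable_iff α F₀ F₁).1 hsep)
      (by rw [card_letters, card_fin, rank_eq]) le_rfl
      (fun a => List.mem_map.2 ⟨eA a, List.mem_finRange _, eA.symm_apply_apply a⟩) fun u v => ?_
    rw [decide_eq_true_iff]
    exact lassoValue_eq_one_iff h u v

end Presented

end FOWord
/-! ## Programs that evaluate functions -/

namespace RAM

/-- The state `s'` agrees with `s` on the memory and on the registers below `e`. -/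
structure PreservesBelow (e : ℕ) (s s' : State) : Prop where
  mem_eq : s'.mem = s.mem
  reg_eq : ∀ i < e, s'.reg i = s.reg i

namespace PreservesBelow

variable {e e' j v : ℕ} {s s' s'' : State}

theorem refl (e : ℕ) (s : State) : PreservesBelow e s s := ⟨rfl, fun _ _ => rfl⟩

theorem trans (h : PreservesBelow e s s') (h' : PreservesBelow e s' s'') :
    PreservesBelow e s s'' :=
  ⟨h'.mem_eq.trans h.mem_eq, fun i hi => (h'.reg_eq i hi).trans (h.reg_eq i hi)⟩

theorem mono (h : PreservesBelow e s s') (he : e' ≤ e) : PreservesBelow e' s s' :=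
  ⟨h.mem_eq, fun i hi => h.reg_eq i (hi.trans_le he)⟩

theorem setReg (h : PreservesBelow e s s') (hj : e ≤ j) : PreservesBelow e s (s'.setReg j v) :=
  ⟨h.mem_eq, fun i hi => by simp [State.setReg, (hi.trans_le hj).ne, h.reg_eq i hi]⟩

end PreservesBelow

/-- The program `P` puts `v` into register `e` within `T` steps; it changes neither the memory nor
the registers below `e`. -/
def Outputs (P : Prog) (e : ℕ) (s : State) (T v : ℕ) : Prop :=
  ∃ t s', Runs P s t s' ∧ t ≤ T ∧ PreservesBelow e s s' ∧ s'.reg e = v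

theorem outputs_copy {e j : ℕ} (hj : j < e) (s : State) :
    Outputs (.seq (.const e 0) (.add e e j)) e s 2 (s.reg j) :=
  ⟨_, _, .seq (.const _ _ _) (.add _ _ _ _), le_rfl,
    ((PreservesBelow.refl e s).setReg le_rfl).setReg le_rfl, by simp [State.setReg, hj.ne]⟩

/-- The value that the map `f`, applied to the number of the turn and the current value, yields
from `a` in `n` turns. -/
def loop (n a : ℕ) (f : ℕ → ℕ → ℕ) : ℕ := Nat.rec a f n

theorem loop_zero (a : ℕ) (f : ℕ → ℕ → ℕ) : loop 0 a f = a := rfl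

theorem loop_succ (n a : ℕ) (f : ℕ → ℕ → ℕ) : loop (n + 1) a f = f n (loop n a f) := rfl

/-- The registers of a loop: `r` turns are left, `a` is the current value, `i` is the number of the
turn, and the constant `1` is at hand. -/
structure LoopState (e r i a : ℕ) (s : State) : Prop where
  turns : s.reg e = r
  value : s.reg (e + 1) = a
  turn : s.reg (e + 2) = i
  one : s.reg (e + 3) = 1

/-- One turn of a loop, where `R` puts the next value into register `e + 4`. -/
def loopBody (e : ℕ) (R : Prog) : Prog :=
  .seq R (.seq (.const (e + 5) 0) (.seq (.add (e + 1) (e + 4) (e + 5))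
    (.seq (.add (e + 2) (e + 2) (e + 3)) (.sub e e (e + 3)))))

/-- The preparation of a loop with `min (reg e) (reg 0)` turns, where `P` puts the number of turns
into register `e` and `Q` puts the initial value into register `e + 1`. -/
def loopInit (e : ℕ) (P Q : Prog) : Prog :=
  .seq (.seq P (.seq (.sub (e + 1) e 0) (.sub e e (e + 1))))
    (.seq Q (.seq (.const (e + 2) 0) (.const (e + 3) 1)))

/-- The program that iterates `R` for at most `reg 0` turns and puts the result into register
`e`. -/
def loopProg (e : ℕ) (P Q R : Prog) : Prog :=
  .seq (loopInit e P Q) (.seq (.loop e (loopBody e R))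
    (.seq (.const (e + 2) 0) (.add e (e + 1) (e + 2))))

section Loop

variable {P Q R : Prog} {e T U V n a : ℕ} {f : ℕ → ℕ → ℕ} {s : State}

theorem exists_runs_loopBody {r i : ℕ} (hs : LoopState e (r + 1) i a s)
    (hR : Outputs R (e + 4) s V n) : ∃ t s', Runs (loopBody e R) s t s' ∧ t ≤ V + 4 ∧
      PreservesBelow e s s' ∧ LoopState e r (i + 1) n s' := by
  obtain ⟨t, s', hrun, ht, hpres, hval⟩ := hR
  refine ⟨_, _, .seq hrun (.seq (.const _ _ _) (.seq (.add _ _ _ _)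
    (.seq (.add _ _ _ _) (.sub _ _ _ _)))), by omega, ?_, ?_⟩
  · exact ((((hpres.mono (by omega)).setReg (by omega)).setReg (by omega)).setReg
      (by omega)).setReg le_rfl
  · have hturns := (hpres.reg_eq e (by omega)).trans hs.turns
    have hturn := (hpres.reg_eq (e + 2) (by omega)).trans hs.turn
    have hone := (hpres.reg_eq (e + 3) (by omega)).trans hs.one
    constructor <;> simp [State.setReg, hturns, hturn, hone, hval]

theorem exists_runs_loop (hR : ∀ i x r s', PreservesBelow e s s' → LoopState e r i x s' →
      Outputs R (e + 4) s' V (f i x)) {r i : ℕ} {s' : State} (hs' : PreservesBelow e s s')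
    (hstate : LoopState e r i (loop i a f) s') :
    ∃ t s'', Runs (.loop e (loopBody e R)) s' t s'' ∧ t ≤ r * (V + 5) + 1 ∧
      PreservesBelow e s s'' ∧ s''.reg (e + 1) = loop (r + i) a f := by
  induction r generalizing i s' with
  | zero =>
    exact ⟨1, s', .loop_false hstate.turns, by omega, hs', by rw [hstate.value, Nat.zero_add]⟩
  | succ r ih =>
    obtain ⟨t, σ, hbody, ht, hpres, hσ⟩ := exists_runs_loopBody hstate (hR _ _ _ _ hs' hstate)
    obtain ⟨t', s'', hloop, ht', hs'', hval⟩ := ih (hs'.trans hpres) hσ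
    refine ⟨_, s'', .loop_true (by rw [hstate.turns]; omega) hbody hloop, ?_, hs'', ?_⟩
    · rw [Nat.succ_mul]
      omega
    · rw [hval, Nat.succ_add_eq_add_succ]

theorem exists_runs_loopInit (he : 0 < e) (hP : Outputs P e s T n)
    (hQ : ∀ s', PreservesBelow e s s' → Outputs Q (e + 1) s' U a) :
    ∃ t s', Runs (loopInit e P Q) s t s' ∧ t ≤ T + U + 4 ∧ PreservesBelow e s s' ∧
      LoopState e (min n (s.reg 0)) 0 a s' := by
  obtain ⟨t, s₁, hP, ht, hpres, hval⟩ := hP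
  have hmin : Runs (.seq P (.seq (.sub (e + 1) e 0) (.sub e e (e + 1)))) s (t + (1 + 1)) _ :=
    .seq hP (.seq (.sub _ _ _ _) (.sub _ _ _ _))
  set s₂ := (s₁.setReg (e + 1) (s₁.reg e - s₁.reg 0)).setReg e _ with hs₂
  have hpres₂ : PreservesBelow e s s₂ := (hpres.setReg (Nat.le_succ e)).setReg le_rfl
  have hturns : s₂.reg e = min n (s.reg 0) := by
    simp [hs₂, State.setReg, hval, hpres.reg_eq 0 he]
    omega
  obtain ⟨t', s₃, hQ, ht', hpres₃, hval₃⟩ := hQ s₂ hpres₂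
  refine ⟨_, _, .seq hmin (.seq hQ (.seq (.const _ _ _) (.const _ _ _))), by omega, ?_, ?_⟩
  · exact ((hpres₂.trans (hpres₃.mono (Nat.le_succ e))).setReg (by omega)).setReg (by omega)
  · have := (hpres₃.reg_eq e (Nat.lt_succ_self e)).trans hturns
    constructor <;> simp [State.setReg, this, hval₃]

theorem outputs_loop (he : 0 < e) (hP : Outputs P e s T n)
    (hQ : ∀ s', PreservesBelow e s s' → Outputs Q (e + 1) s' U a)
    (hR : ∀ i x r s', PreservesBelow e s s' → LoopState e r i x s' →
      Outputs R (e + 4) s' V (f i x)) :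
    Outputs (loopProg e P Q R) e s (T + U + 7 + s.reg 0 * (V + 5))
      (loop (min n (s.reg 0)) a f) := by
  obtain ⟨t, s₁, hinit, ht, hs₁, hstate⟩ := exists_runs_loopInit he hP hQ
  obtain ⟨t', s₂, hloop, ht', hs₂, hval⟩ := exists_runs_loop hR (a := a) hs₁ hstate
  refine ⟨_, _, .seq hinit (.seq hloop (.seq (.const _ _ _) (.add _ _ _ _))), ?_,
    (hs₂.setReg (by omega)).setReg le_rfl, by simp [State.setReg, hval]⟩
  have : min n (s.reg 0) * (V + 5) ≤ s.reg 0 * (V + 5) := Nat.mul_le_mul_right _ (min_le_right _ _)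
  omega

end Loop

/-- A memory, and a bound for the numbers of turns of loops, which stands in register `0`. -/
structure BoundedMemory where
  mem : ℕ → ℕ
  bound : ℕ

/-- The iteration of a map with at most `b.bound` turns. -/
def BoundedMemory.boundedLoop (b : BoundedMemory) (n a : ℕ) (f : ℕ → ℕ → ℕ) : ℕ :=
  loop (min n b.bound) a f

/-- The types of environments in which programs evaluate functions: a memory with a bound, and
further numbers in registers. -/
class Environment (α : Type) where
  /-- the possible assignments of registers -/
  Layout : Type
  memory : α → BoundedMemory
  /-- the state represents the environment in registers below a given one -/
  Represents : Layout → ℕ → α → State → Prop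
  represents_mono {L : Layout} {e e' : ℕ} {x : α} {s s' : State} (he : e ≤ e')
    (hs : PreservesBelow e s s') (h : Represents L e x s) : Represents L e' x s'
  represents_memory {L : Layout} {e : ℕ} {x : α} {s : State} (h : Represents L e x s) :
    0 < e ∧ s.mem = (memory x).mem ∧ s.reg 0 = (memory x).bound

open Environment

instance : Environment BoundedMemory where
  Layout := Unit
  memory := id
  Represents _ e b s := 0 < e ∧ s.mem = b.mem ∧ s.reg 0 = b.bound
  represents_mono he hs h :=
    ⟨h.1.trans_le he, hs.mem_eq.trans h.2.1, (hs.reg_eq 0 h.1).trans h.2.2⟩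
  represents_memory h := h

instance {α : Type} [Environment α] : Environment (α × ℕ) where
  Layout := Layout α × ℕ
  memory x := memory x.1
  Represents L e x s := Represents L.1 e x.1 s ∧ L.2 < e ∧ s.reg L.2 = x.2
  represents_mono he hs h :=
    ⟨represents_mono he hs h.1, h.2.1.trans_le he, (hs.reg_eq _ h.2.1).trans h.2.2⟩
  represents_memory h := represents_memory h.1

/-- The function `f` can be evaluated in a number of steps that is polynomial in the bound. -/
def Feasible {α : Type} [Environment α] (f : α → ℕ) : Prop :=
  ∃ T : Polynomial ℕ, ∀ (L : Layout α) (e : ℕ), ∃ P : Prog, ∀ (x : α) (s : State),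
    Represents L e x s → Outputs P e s (T.eval (memory x).bound) (f x)

namespace Feasible

variable {α : Type} [Environment α] {f g h : α → ℕ}

theorem snd : Feasible fun p : α × ℕ => p.2 := by
  refine ⟨2, fun L e => ⟨.seq (.const e 0) (.add e e L.2), fun x s hs => ?_⟩⟩
  simpa [hs.2.2] using outputs_copy hs.2.1 s

theorem bound : Feasible fun x : α => (memory x).bound := by
  refine ⟨2, fun L e => ⟨.seq (.const e 0) (.add e e 0), fun x s hs => ?_⟩⟩
  simpa [(represents_memory hs).2.2] using outputs_copy (represents_memory hs).1 s

theorem const (c : ℕ) : Feasible fun _ : α => c :=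
  ⟨1, fun _ e => ⟨.const e c, fun _ s _ => ⟨1, _, .const _ _ _, by simp,
    (PreservesBelow.refl e s).setReg le_rfl, by simp [State.setReg]⟩⟩⟩

theorem fst (hf : Feasible f) : Feasible fun p : α × ℕ => f p.1 := by
  obtain ⟨T, hT⟩ := hf
  refine ⟨T, fun L e => ?_⟩
  obtain ⟨P, hP⟩ := hT L.1 e
  exact ⟨P, fun x s hs => hP x.1 s hs.1⟩

theorem mem (hf : Feasible f) : Feasible fun x => (memory x).mem (f x) := by
  obtain ⟨T, hT⟩ := hf
  refine ⟨T + 1, fun L e => ?_⟩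
  obtain ⟨P, hP⟩ := hT L e
  refine ⟨.seq P (.load e e), fun x s hs => ?_⟩
  obtain ⟨t, s', hrun, ht, hpres, hval⟩ := hP x s hs
  exact ⟨_, _, .seq hrun (.load _ _ _), by simpa using ht, hpres.setReg le_rfl,
    by simp [State.setReg, hval, hpres.mem_eq, (represents_memory hs).2.1]⟩

theorem instruction {op : ℕ → ℕ → ℕ} {I : ℕ → ℕ → ℕ → Prog}
    (hI : ∀ x y z s, Runs (I x y z) s 1 (s.setReg x (op (s.reg y) (s.reg z))))
    (hf : Feasible f) (hg : Feasible g) : Feasible fun x => op (f x) (g x) := by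
  obtain ⟨T, hT⟩ := hf
  obtain ⟨U, hU⟩ := hg
  refine ⟨T + U + 1, fun L e => ?_⟩
  obtain ⟨P, hP⟩ := hT L e
  obtain ⟨Q, hQ⟩ := hU L (e + 1)
  refine ⟨.seq (.seq P Q) (I e e (e + 1)), fun x s hs => ?_⟩
  obtain ⟨t, s', hrun, ht, hpres, hval⟩ := hP x s hs
  obtain ⟨t', s'', hrun', ht', hpres', hval'⟩ := hQ x s' (represents_mono (Nat.le_succ e) hpres hs)
  refine ⟨_, _, .seq (.seq hrun hrun') (hI _ _ _ _), ?_,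
    (hpres.trans (hpres'.mono (Nat.le_succ e))).setReg le_rfl, ?_⟩
  · simpa using Nat.add_le_add ht ht'
  · simp [State.setReg, hval, hval', hpres'.reg_eq e (Nat.lt_succ_self e)]

theorem add (hf : Feasible f) (hg : Feasible g) : Feasible fun x => f x + g x :=
  instruction .add hf hg

theorem sub (hf : Feasible f) (hg : Feasible g) : Feasible fun x => f x - g x :=
  instruction .sub hf hg

theorem ite (hf : Feasible f) (hg : Feasible g) (hh : Feasible h) :
    Feasible fun x => if f x = 0 then g x else h x := by
  obtain ⟨T, hT⟩ := hf
  obtain ⟨U, hU⟩ := hg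
  obtain ⟨V, hV⟩ := hh
  refine ⟨T + U + V + 1, fun L e => ?_⟩
  obtain ⟨P, hP⟩ := hT L e
  obtain ⟨Q, hQ⟩ := hU L e
  obtain ⟨R, hR⟩ := hV L e
  refine ⟨.seq P (.cond e R Q), fun x s hs => ?_⟩
  obtain ⟨t, s', hrun, ht, hpres, hval⟩ := hP x s hs
  have hs' := represents_mono le_rfl hpres hs
  simp only [Polynomial.eval_add, Polynomial.eval_one]
  by_cases hfx : f x = 0
  · obtain ⟨t', s'', hrun', ht', hpres', hval'⟩ := hQ x s' hs'
    exact ⟨_, _, .seq hrun (.cond_false (hval.trans hfx) hrun'), by omega, hpres.trans hpres',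
      hval'.trans (if_pos hfx).symm⟩
  · obtain ⟨t', s'', hrun', ht', hpres', hval'⟩ := hR x s' hs'
    exact ⟨_, _, .seq hrun (.cond_true (by rwa [hval]) hrun'), by omega, hpres.trans hpres',
      hval'.trans (if_neg hfx).symm⟩

theorem boundedLoop {h : α → ℕ → ℕ → ℕ} (hf : Feasible f) (hg : Feasible g)
    (hh : Feasible fun p : (α × ℕ) × ℕ => h p.1.1 p.1.2 p.2) :
    Feasible fun x => (memory x).boundedLoop (f x) (g x) (h x) := by
  obtain ⟨T, hT⟩ := hf
  obtain ⟨U, hU⟩ := hg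
  obtain ⟨V, hV⟩ := hh
  refine ⟨T + U + 7 + .X * (V + 5), fun L e => ?_⟩
  obtain ⟨P, hP⟩ := hT L e
  obtain ⟨Q, hQ⟩ := hU L (e + 1)
  obtain ⟨R, hR⟩ := hV ((L, e + 2), e + 1) (e + 4)
  refine ⟨loopProg e P Q R, fun x s hs => ?_⟩
  obtain ⟨he, -, hbound⟩ := represents_memory hs
  have houtputs := outputs_loop (f := h x) (V := V.eval (memory x).bound) he (hP x s hs)
    (fun s' hs' => hQ x s' (represents_mono (Nat.le_succ e) hs' hs))
    (fun i y r s' hs' hstate => hR ((x, i), y) s' ⟨⟨represents_mono (by omega) hs' hs,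
      Nat.add_lt_add_left (by norm_num) e, hstate.turn⟩,
      Nat.add_lt_add_left (by norm_num) e, hstate.value⟩)
  rw [hbound] at houtputs
  simpa [BoundedMemory.boundedLoop] using houtputs

end Feasible

end RAM
/-! ## The saturation algorithm -/

namespace RAM

namespace BoundedMemory

/-- The number `2 ^ j`, for `j ≤ b.bound`. -/
def twoPow (b : BoundedMemory) (j : ℕ) : ℕ := b.boundedLoop j 1 fun _ a => a + a

/-- A truth value, with `0` for false: some `i < n` satisfies `c i`. -/
def any (b : BoundedMemory) (n : ℕ) (c : ℕ → ℕ) : ℕ :=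
  b.boundedLoop n 0 fun i a => if c i = 0 then a else 1

/-- The number whose binary digits are the truth values of `c i` for `i < n`. -/
def mask (b : BoundedMemory) (n : ℕ) (c : ℕ → ℕ) : ℕ :=
  b.boundedLoop n 0 fun i a => if c i = 0 then a else a + b.twoPow i

/-- The truth value of `x = y`. -/
def eqNat (x y : ℕ) : ℕ := 1 - ((x - y) + (y - x))

/-- The remainder of `Z` modulo `2 ^ (i + 1)`: the larger powers of `2` are subtracted in turn,
beginning with `2 ^ (b.bound - 1)`. -/
def low (b : BoundedMemory) (Z i : ℕ) : ℕ :=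
  b.boundedLoop (b.bound - (i + 1)) Z fun t r =>
    if b.twoPow (b.bound - (t + 1)) - r = 0 then r - b.twoPow (b.bound - (t + 1)) else r

/-- The binary digit of `Z` at place `i`. -/
def bit (b : BoundedMemory) (Z i : ℕ) : ℕ := 1 - (b.twoPow i - b.low Z i)

/-- The product of two numbers. -/
def times (b : BoundedMemory) (s k : ℕ) : ℕ := b.boundedLoop s 0 fun _ a => a + k

/-- The truth value of the existence of an element of the set `X`, given by its mask, that
satisfies `c`. -/
def anyIn (b : BoundedMemory) (n X : ℕ) (c : ℕ → ℕ) : ℕ :=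
  b.any n fun i => if b.bit X i = 0 then 0 else c i

/-- The address of the table of the mixed product. -/
def smulTable (b : BoundedMemory) : ℕ := 3 + b.times (b.mem 0) (b.mem 0)

/-- The address of the table of the infinite power. -/
def powerTable (b : BoundedMemory) : ℕ := b.smulTable + b.times (b.mem 0) (b.mem 1)

/-- The address of the images of the letters. -/
def letterTable (b : BoundedMemory) : ℕ := b.powerTable + b.mem 0

/-- The address of the characteristic sequence of `F₀`. -/
def leftTable (b : BoundedMemory) : ℕ := b.letterTable + b.mem 2

/-- The address of the characteristic sequence of `F₁`. -/
def rightTable (b : BoundedMemory) : ℕ := b.leftTable + b.mem 1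

/-- The product of two elements of the semigroup. -/
def mulAt (b : BoundedMemory) (s t : ℕ) : ℕ := b.mem (3 + (b.times s (b.mem 0) + t))

/-- The mixed product of two elements. -/
def smulAt (b : BoundedMemory) (s t : ℕ) : ℕ := b.mem (b.smulTable + (b.times s (b.mem 1) + t))

/-- The infinite power of an element of the semigroup. -/
def powerAt (b : BoundedMemory) (s : ℕ) : ℕ := b.mem (b.powerTable + s)

/-- The image of a letter. -/
def letterAt (b : BoundedMemory) (a : ℕ) : ℕ := b.mem (b.letterTable + a)

/-- The number of subsets of the semigroup. -/
def numSets (b : BoundedMemory) : ℕ := b.twoPow (b.mem 0)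

/-- The product of two subsets of the semigroup, given by their masks. -/
def mulMask (b : BoundedMemory) (X Y : ℕ) : ℕ :=
  b.mask (b.mem 0) fun u => b.anyIn (b.mem 0) X fun s => b.anyIn (b.mem 0) Y fun t =>
    eqNat (b.mulAt s t) u

/-- The power of a subset with exponent `i + 1`. -/
def succPowMask (b : BoundedMemory) (X i : ℕ) : ℕ := b.boundedLoop i X fun _ Z => b.mulMask Z X

/-- The union of the powers of a subset with exponents in `(2 ^ |S|, 2 ^ (|S| + 1)]`. -/
def unionPowMask (b : BoundedMemory) (X : ℕ) : ℕ :=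
  b.mask (b.mem 0) fun u => b.any b.numSets fun i =>
    b.bit (b.succPowMask X (b.numSets + i)) u

/-- The family of the singletons of the images of letters, as the mask of a set of masks. -/
def letterFamily (b : BoundedMemory) : ℕ :=
  b.mask b.numSets fun X => b.any (b.mem 2) fun a => eqNat (b.twoPow (b.letterAt a)) X

/-- One round of the saturation of a family of subsets. -/
def saturate (b : BoundedMemory) (Z : ℕ) : ℕ :=
  b.mask b.numSets fun V => b.bit Z V +
    (b.anyIn b.numSets Z (fun X => eqNat (b.unionPowMask X) V) +
    b.anyIn b.numSets Z fun X => b.anyIn b.numSets Z fun Y => eqNat (b.mulMask X Y) V)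

/-- The saturation of the family of the singletons of the images of letters. -/
def saturation (b : BoundedMemory) : ℕ :=
  b.boundedLoop b.numSets b.letterFamily fun _ Z => b.saturate Z

/-- The truth value of the existence of `x ∈ X` and `e ∈ E` such that `x e e e ⋯` belongs to the
set whose characteristic sequence begins at `table`. -/
def hits (b : BoundedMemory) (table X E : ℕ) : ℕ :=
  b.anyIn (b.mem 0) X fun x => b.anyIn (b.mem 0) E fun e =>
    eqNat (b.mem (table + b.smulAt x (b.powerAt e))) 1

/-- The truth value of the inseparability of the two languages. -/
def inseparable (b : BoundedMemory) : ℕ :=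
  b.anyIn b.numSets b.saturation fun X => b.anyIn b.numSets b.saturation fun E =>
    if b.hits b.leftTable X E = 0 then 0 else b.hits b.rightTable X E

end BoundedMemory

namespace Feasible

open Environment

variable {α : Type} [Environment α] {f g h : α → ℕ}

theorem twoPow (hf : Feasible f) : Feasible fun x => (memory x).twoPow (f x) :=
  boundedLoop hf (const 1) (add snd snd)

theorem any {c : α → ℕ → ℕ} (hf : Feasible f) (hc : Feasible fun p : α × ℕ => c p.1 p.2) :
    Feasible fun x => (memory x).any (f x) (c x) :=
  boundedLoop hf (const 0) (ite hc.fst snd (const 1))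

theorem mask {c : α → ℕ → ℕ} (hf : Feasible f) (hc : Feasible fun p : α × ℕ => c p.1 p.2) :
    Feasible fun x => (memory x).mask (f x) (c x) :=
  boundedLoop hf (const 0) (ite hc.fst snd (add snd snd.fst.twoPow))

theorem eqNat (hf : Feasible f) (hg : Feasible g) :
    Feasible fun x => BoundedMemory.eqNat (f x) (g x) :=
  sub (const 1) (add (sub hf hg) (sub hg hf))

theorem low (hf : Feasible f) (hg : Feasible g) : Feasible fun x => (memory x).low (f x) (g x) :=
  have hpow : Feasible fun p : (α × ℕ) × ℕ =>
      (memory p.1.1).twoPow ((memory p.1.1).bound - (p.1.2 + 1)) :=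
    twoPow (sub bound (add snd.fst (const 1)))
  boundedLoop (sub bound (add hg (const 1))) hf (ite (sub hpow snd) (sub snd hpow) snd)

theorem bit (hf : Feasible f) (hg : Feasible g) : Feasible fun x => (memory x).bit (f x) (g x) :=
  sub (const 1) (sub hg.twoPow (low hf hg))

theorem times (hf : Feasible f) (hg : Feasible g) :
    Feasible fun x => (memory x).times (f x) (g x) :=
  boundedLoop hf (const 0) (add snd hg.fst.fst)

theorem anyIn {c : α → ℕ → ℕ} (hf : Feasible f) (hg : Feasible g)
    (hc : Feasible fun p : α × ℕ => c p.1 p.2) :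
    Feasible fun x => (memory x).anyIn (f x) (g x) (c x) :=
  any hf (ite (bit hg.fst snd) (const 0) hc)

theorem smulTable : Feasible fun x : α => (memory x).smulTable :=
  add (const 3) (times (const 0).mem (const 0).mem)

theorem powerTable : Feasible fun x : α => (memory x).powerTable :=
  add smulTable (times (const 0).mem (const 1).mem)

theorem letterTable : Feasible fun x : α => (memory x).letterTable :=
  add powerTable (const 0).mem

theorem leftTable : Feasible fun x : α => (memory x).leftTable :=
  add letterTable (const 2).mem

theorem rightTable : Feasible fun x : α => (memory x).rightTable :=
  add leftTable (const 1).mem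

theorem mulAt (hf : Feasible f) (hg : Feasible g) :
    Feasible fun x => (memory x).mulAt (f x) (g x) :=
  mem (add (const 3) (add (times hf (const 0).mem) hg))

theorem smulAt (hf : Feasible f) (hg : Feasible g) :
    Feasible fun x => (memory x).smulAt (f x) (g x) :=
  mem (add smulTable (add (times hf (const 1).mem) hg))

theorem powerAt (hf : Feasible f) : Feasible fun x => (memory x).powerAt (f x) :=
  mem (add powerTable hf)

theorem letterAt (hf : Feasible f) : Feasible fun x => (memory x).letterAt (f x) :=
  mem (add letterTable hf)

theorem numSets : Feasible fun x : α => (memory x).numSets := (const 0).mem.twoPow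

theorem mulMask (hf : Feasible f) (hg : Feasible g) :
    Feasible fun x => (memory x).mulMask (f x) (g x) :=
  mask (const 0).mem (anyIn (const 0).mem hf.fst (anyIn (const 0).mem hg.fst.fst
    (eqNat (mulAt snd.fst snd) snd.fst.fst)))

theorem succPowMask (hf : Feasible f) (hg : Feasible g) :
    Feasible fun x => (memory x).succPowMask (f x) (g x) :=
  boundedLoop hg hf (mulMask snd hf.fst.fst)

theorem unionPowMask (hf : Feasible f) : Feasible fun x => (memory x).unionPowMask (f x) :=
  mask (const 0).mem (any numSets (bit (succPowMask hf.fst.fst (add numSets snd)) snd.fst))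

theorem letterFamily : Feasible fun x : α => (memory x).letterFamily :=
  mask numSets (any (const 2).mem (eqNat snd.letterAt.twoPow snd.fst))

theorem saturate (hf : Feasible f) : Feasible fun x => (memory x).saturate (f x) :=
  mask numSets (add (bit hf.fst snd) (add
    (anyIn numSets hf.fst (eqNat snd.unionPowMask snd.fst))
    (anyIn numSets hf.fst (anyIn numSets hf.fst.fst (eqNat (mulMask snd.fst snd) snd.fst.fst)))))

theorem saturation : Feasible fun x : α => (memory x).saturation :=
  boundedLoop numSets letterFamily (saturate snd)

theorem hits (hf : Feasible f) (hg : Feasible g) (hh : Feasible h) :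
    Feasible fun x => (memory x).hits (f x) (g x) (h x) :=
  anyIn (const 0).mem hg (anyIn (const 0).mem hh.fst
    (eqNat (mem (add hf.fst.fst (smulAt snd.fst snd.powerAt))) (const 1)))

theorem inseparable : Feasible fun x : α => (memory x).inseparable :=
  anyIn numSets saturation (anyIn numSets saturation
    (ite (hits leftTable snd.fst snd) (const 0) (hits rightTable snd.fst snd)))

end Feasible

end RAM
/-! ## Correctness of the saturation algorithm -/

namespace Saturation

open scoped Pointwise

theorem iterate_card_eq_of_forall_subset {β : Type*} [Finite β] {f : Set β → Set β}
    (hf : ∀ X, X ⊆ f X) (X : Set β) : f (f^[Nat.card β] X) = f^[Nat.card β] X := by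
  have hsubset (i : ℕ) : f^[i] X ⊆ f^[i + 1] X := by
    rw [Function.iterate_succ_apply']
    exact hf _
  have hstable (i : ℕ) (h : (f^[i] X).ncard = (f^[i + 1] X).ncard) : f^[i + 1] X = f^[i] X :=
    (Set.eq_of_subset_of_ncard_le (hsubset i) h.ge).symm
  rw [← Function.iterate_succ_apply' f]
  refine hstable _ (Nat.stabilises_of_monotone (f := fun i => (f^[i] X).ncard)
    (monotone_nat_of_le_succ fun i => Set.ncard_le_ncard (hsubset i))
    (fun i => Set.ncard_le_card _) (fun i h => ?_) (Nat.le_succ _)).symm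
  change _ = (f^[i + 1 + 1] X).ncard
  rw [Function.iterate_succ_apply' f (i + 1), hstable i h, ← Function.iterate_succ_apply' f,
    hstable i h]

variable {A S : Type*} [Semigroup S]

/-- One round of the saturation of a family of subsets. -/
def saturationStep (𝒳 : Set (Set S)) : Set (Set S) :=
  𝒳 ∪ (unionPow (2 ^ Nat.card S) '' 𝒳 ∪ Set.image2 (· * ·) 𝒳 𝒳)

theorem subset_saturationStep (𝒳 : Set (Set S)) : 𝒳 ⊆ saturationStep 𝒳 := Set.subset_union_left

theorem iterate_saturationStep [Finite S] (g : A → S) :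
    saturationStep^[Nat.card (Set S)] (Set.range fun a => {g a}) = {X | MemSaturation g X} := by
  refine Set.Subset.antisymm ?_ fun X hX => ?_
  · generalize Nat.card (Set S) = i
    induction i with
    | zero =>
      rintro _ ⟨a, rfl⟩
      exact .letter a
    | succ i ih =>
      rw [Function.iterate_succ_apply']
      rintro _ (hX | ⟨X, hX, rfl⟩ | ⟨X, hX, Y, hY, rfl⟩)
      exacts [ih hX, (ih hX).pow, (ih hX).mul (ih hY)]
  · have hfixed := iterate_card_eq_of_forall_subset subset_saturationStep
      (Set.range fun a => {g a})
    induction hX with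
    | letter a =>
      exact Function.id_le_iterate_of_id_le subset_saturationStep _ _ ⟨a, rfl⟩
    | mul _ _ hX hY =>
      rw [← hfixed]
      exact .inr (.inr ⟨_, hX, _, hY, rfl⟩)
    | pow _ hX =>
      rw [← hfixed]
      exact .inr (.inl ⟨_, hX, rfl⟩)

end Saturation

namespace RAM

section Numbers

variable {b : BoundedMemory} {n i Z : ℕ}

theorem boundedLoop_eq (h : n ≤ b.bound) (a : ℕ) (f : ℕ → ℕ → ℕ) :
    b.boundedLoop n a f = loop n a f := by
  rw [BoundedMemory.boundedLoop, min_eq_left h]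

theorem twoPow_eq (h : n ≤ b.bound) : b.twoPow n = 2 ^ n := by
  rw [BoundedMemory.twoPow, boundedLoop_eq h]
  clear h
  induction n with
  | zero => rfl
  | succ n ih => rw [loop_succ, ih, pow_succ, mul_two]

theorem times_eq (h : n ≤ b.bound) (k : ℕ) : b.times n k = n * k := by
  rw [BoundedMemory.times, boundedLoop_eq h]
  clear h
  induction n with
  | zero => rw [loop_zero, zero_mul]
  | succ n ih => rw [loop_succ, ih, Nat.succ_mul]

theorem eqNat_ne_zero {x y : ℕ} : BoundedMemory.eqNat x y ≠ 0 ↔ x = y := by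
  unfold BoundedMemory.eqNat
  omega

theorem any_ne_zero (h : n ≤ b.bound) (c : ℕ → ℕ) : b.any n c ≠ 0 ↔ ∃ i < n, c i ≠ 0 := by
  rw [BoundedMemory.any, boundedLoop_eq h]
  clear h
  induction n with
  | zero => simp [loop_zero]
  | succ n ih =>
    rw [loop_succ]
    split_ifs with hn
    · simp only [ih, Nat.lt_succ_iff_lt_or_eq, or_and_right, exists_or, exists_eq_left, hn, ne_eq,
        not_true_eq_false, or_false]
    · exact iff_of_true one_ne_zero ⟨n, Nat.lt_succ_self n, hn⟩

theorem testBit_mask (h : n ≤ b.bound) (c : ℕ → ℕ) (i : ℕ) :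
    (b.mask n c).testBit i = true ↔ i < n ∧ c i ≠ 0 := by
  rw [BoundedMemory.mask, boundedLoop_eq h]
  induction n generalizing i with
  | zero => simp [loop_zero]
  | succ n ih =>
    specialize ih (Nat.le_of_succ_le h)
    rw [loop_succ, twoPow_eq (Nat.le_of_succ_le h)]
    set Z := loop n 0 _
    have hZ : Z < 2 ^ n := Nat.lt_pow_two_of_testBit _ fun i hi =>
      Bool.eq_false_iff.2 fun hbit => (((ih i).1 hbit).1.trans_le hi).false
    have hor : Z + 2 ^ n = 2 ^ n ||| Z := by
      rw [add_comm]
      simpa using Nat.two_pow_add_eq_or_of_lt hZ 1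
    rcases eq_or_ne i n with rfl | hi
    · have hbit := Nat.testBit_lt_two_pow hZ
      split_ifs <;> simp_all
    · have hlt : i < n + 1 ↔ i < n := by omega
      rw [hlt, ← ih i]
      split_ifs
      · rfl
      · rw [hor, Nat.testBit_or, Nat.testBit_two_pow_of_ne hi.symm, Bool.false_or]

theorem low_eq (hZ : Z < 2 ^ b.bound) (hi : i < b.bound) : b.low Z i = Z % 2 ^ (i + 1) := by
  suffices hloop : ∀ k ≤ b.bound, (loop k Z fun t r =>
      if b.twoPow (b.bound - (t + 1)) - r = 0 then r - b.twoPow (b.bound - (t + 1)) else r) =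
        Z % 2 ^ (b.bound - k) by
    rw [BoundedMemory.low, boundedLoop_eq (Nat.sub_le _ _), hloop _ (Nat.sub_le _ _),
      Nat.sub_sub_self hi]
  intro k hk
  induction k with
  | zero => rw [loop_zero, Nat.sub_zero, Nat.mod_eq_of_lt hZ]
  | succ k ih =>
    rw [loop_succ, ih (Nat.le_of_succ_le hk), twoPow_eq (Nat.sub_le _ _),
      show b.bound - k = b.bound - (k + 1) + 1 by omega, pow_succ, Nat.mod_mul]
    have hmod : Z % 2 ^ (b.bound - (k + 1)) < 2 ^ (b.bound - (k + 1)) :=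
      Nat.mod_lt _ (by positivity)
    rcases Nat.mod_two_eq_zero_or_one (Z / 2 ^ (b.bound - (k + 1))) with h | h <;> rw [h]
    · rw [mul_zero, add_zero, if_neg (by omega)]
    · rw [mul_one, if_pos (by omega), Nat.add_sub_cancel]

theorem bit_ne_zero (hZ : Z < 2 ^ b.bound) (hi : i < b.bound) :
    b.bit Z i ≠ 0 ↔ Z.testBit i = true := by
  rw [BoundedMemory.bit, low_eq hZ hi, twoPow_eq hi.le, pow_succ, Nat.mod_mul,
    Nat.testBit_eq_decide_div_mod_eq, decide_eq_true_iff]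
  have hmod : Z % 2 ^ i < 2 ^ i := Nat.mod_lt _ (by positivity)
  rcases Nat.mod_two_eq_zero_or_one (Z / 2 ^ i) with h | h <;> rw [h] <;> omega

end Numbers

section Sets

variable {β : Type*} {m : ℕ} (e : β ≃ Fin m)

/-- The numbering of the subsets of a numbered type by masks: the binary digits of the number of a
subset indicate its elements. -/
noncomputable def setEquiv : Set β ≃ Fin (2 ^ m) where
  toFun X := open scoped Classical in
    ⟨Nat.ofBits fun i => decide (e.symm i ∈ X), Nat.ofBits_lt_two_pow _⟩
  invFun Z := {s | (Z : ℕ).testBit (e s) = true}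
  left_inv X := by
    ext s
    simp [Nat.testBit_ofBits_lt]
  right_inv Z := by
    ext
    simp [Nat.ofBits_testBit, Nat.mod_eq_of_lt Z.2]

theorem testBit_setEquiv (X : Set β) (s : β) :
    (setEquiv e X : ℕ).testBit (e s) = true ↔ s ∈ X := by
  simp [setEquiv]

theorem eq_setEquiv {Z : ℕ} {X : Set β} (hZ : Z < 2 ^ m)
    (h : ∀ s, Z.testBit (e s) = true ↔ s ∈ X) : Z = setEquiv e X := by
  have hX : (setEquiv e).symm ⟨Z, hZ⟩ = X := Set.ext h
  rw [← hX, Equiv.apply_symm_apply]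

variable {e}

theorem setEquiv_singleton (s : β) : (setEquiv e {s} : ℕ) = 2 ^ (e s : ℕ) :=
  (eq_setEquiv e (Nat.pow_lt_pow_right one_lt_two (e s).2) fun t => by
    simp [Nat.testBit_two_pow, Fin.val_inj, eq_comm]).symm

variable {b : BoundedMemory} (hm : m ≤ b.bound)
include hm

theorem any_equiv_ne_zero (c : ℕ → ℕ) : b.any m c ≠ 0 ↔ ∃ s, c (e s) ≠ 0 := by
  rw [any_ne_zero hm, ← e.surjective.exists (p := fun i : Fin m => c i ≠ 0), Fin.exists_iff]
  simp only [exists_prop]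

theorem mask_eq (c : ℕ → ℕ) : b.mask m c = setEquiv e {s | c (e s) ≠ 0} := by
  refine eq_setEquiv e (Nat.lt_pow_two_of_testBit _ fun i hi => ?_) fun s => ?_
  · exact Bool.eq_false_iff.2 fun hbit => (((testBit_mask hm c i).1 hbit).1.trans_le hi).false
  · simp [testBit_mask hm]

theorem bit_setEquiv_ne_zero (X : Set β) (s : β) : b.bit (setEquiv e X) (e s) ≠ 0 ↔ s ∈ X := by
  rw [bit_ne_zero ((setEquiv e X).2.trans_le (Nat.pow_le_pow_right two_pos hm))
    ((e s).2.trans_le hm), testBit_setEquiv]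

theorem anyIn_setEquiv_ne_zero (X : Set β) (c : ℕ → ℕ) :
    b.anyIn m (setEquiv e X) c ≠ 0 ↔ ∃ s ∈ X, c (e s) ≠ 0 := by
  rw [BoundedMemory.anyIn, any_equiv_ne_zero (e := e) hm]
  simp [← bit_setEquiv_ne_zero (e := e) hm]

end Sets

open Saturation OmegaSemigroup BoundedMemory
open scoped Pointwise

/-- The tables of an input stand in the memory, and the bound is large enough for the loops of the
saturation algorithm. -/
structure Adequate {A S T : Type*} [Semigroup S] [OmegaSemigroup S T] {n m k : ℕ}
    (eA : A ≃ Fin n) (eS : S ≃ Fin m) (eT : T ≃ Fin k)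
    (α : OmegaHom (FreeSemigroup A) (Stream' A) S T) (F₀ F₁ : Set T) (b : BoundedMemory) : Prop
    extends IsPresented eA eS eT α F₀ F₁ b.mem where
  two_mul_le : 2 * 2 ^ m ≤ b.bound
  letters_le : n ≤ b.bound

namespace Adequate

variable {A S T : Type*} [Semigroup S] [OmegaSemigroup S T] {n m k : ℕ}
  {eA : A ≃ Fin n} {eS : S ≃ Fin m} {eT : T ≃ Fin k}
  {α : OmegaHom (FreeSemigroup A) (Stream' A) S T} {F₀ F₁ : Set T} {b : BoundedMemory}
  (h : Adequate eA eS eT α F₀ F₁ b)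
include h

theorem two_pow_le : 2 ^ m ≤ b.bound := (Nat.le_mul_of_pos_left _ two_pos).trans h.two_mul_le

theorem size_le : m ≤ b.bound := Nat.lt_two_pow_self.le.trans h.two_pow_le

theorem smulTable_eq : b.smulTable = 3 + m * m := by
  rw [smulTable, h.size_fin, times_eq h.size_le]

theorem powerTable_eq : b.powerTable = 3 + m * m + m * k := by
  rw [powerTable, h.smulTable_eq, h.size_fin, h.size_inf, times_eq h.size_le]

theorem letterTable_eq : b.letterTable = 3 + m * m + m * k + m := by
  rw [letterTable, h.powerTable_eq, h.size_fin]

theorem leftTable_eq : b.leftTable = 3 + m * m + m * k + m + n := by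
  rw [leftTable, h.letterTable_eq, h.size_letters]

theorem rightTable_eq : b.rightTable = 3 + m * m + m * k + m + n + k := by
  rw [rightTable, h.leftTable_eq, h.size_inf]

theorem mulAt_eq (s t : S) : b.mulAt (eS s) (eS t) = eS (s * t) := by
  rw [mulAt, times_eq ((eS s).2.le.trans h.size_le), h.size_fin, h.mul]

theorem smulAt_eq (s : S) (t : T) : b.smulAt (eS s) (eT t) = eT (s • t) := by
  rw [smulAt, times_eq ((eS s).2.le.trans h.size_le), h.smulTable_eq, h.size_inf, h.smul]

theorem powerAt_eq (s : S) : b.powerAt (eS s) = eT (iprod (Stream'.const s)) := by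
  rw [powerAt, h.powerTable_eq, h.power]

theorem letterAt_eq (a : A) : b.letterAt (eA a) = eS (letterImage α.fin a) := by
  rw [letterAt, h.letterTable_eq, h.letter]

theorem numSets_eq : b.numSets = 2 ^ m := by
  rw [numSets, h.size_fin, twoPow_eq h.size_le]

theorem mulMask_eq (X Y : Set S) :
    b.mulMask (setEquiv eS X) (setEquiv eS Y) = setEquiv eS (X * Y) := by
  rw [mulMask, h.size_fin, mask_eq (e := eS) h.size_le]
  congr 2
  ext u
  simp only [Set.mem_ofPred_eq, anyIn_setEquiv_ne_zero h.size_le, h.mulAt_eq, eqNat_ne_zero,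
    Fin.val_inj, eS.injective.eq_iff, Set.mem_mul]

theorem succPowMask_eq (X : Set S) {i : ℕ} (hi : i ≤ b.bound) :
    b.succPowMask (setEquiv eS X) i = setEquiv eS (succPow X i) := by
  rw [succPowMask, boundedLoop_eq hi]
  clear hi
  induction i with
  | zero => rfl
  | succ i ih => rw [loop_succ, ih, h.mulMask_eq, succPow]

theorem unionPowMask_eq (X : Set S) :
    b.unionPowMask (setEquiv eS X) = setEquiv eS (unionPow (2 ^ m) X) := by
  rw [unionPowMask, h.size_fin, h.numSets_eq, mask_eq (e := eS) h.size_le]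
  congr 2
  ext u
  rw [Set.mem_ofPred_eq, any_ne_zero h.two_pow_le, unionPow, Set.mem_ofPred_eq]
  refine exists_congr fun i => and_congr_right fun hi => ?_
  have hbound := h.two_mul_le
  rw [h.succPowMask_eq X (by omega), bit_setEquiv_ne_zero h.size_le]

theorem letterFamily_eq : b.letterFamily =
    setEquiv (setEquiv eS) (Set.range fun a => {letterImage α.fin a}) := by
  rw [letterFamily, h.numSets_eq, h.size_letters, mask_eq (e := setEquiv eS) h.two_pow_le]
  congr 2
  ext X
  rw [Set.mem_ofPred_eq, any_equiv_ne_zero (e := eA) h.letters_le]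
  refine exists_congr fun a => ?_
  rw [eqNat_ne_zero, h.letterAt_eq, twoPow_eq ((eS _).2.le.trans h.size_le), ← setEquiv_singleton,
    Fin.val_inj, (setEquiv eS).injective.eq_iff]

theorem saturate_eq (𝒳 : Set (Set S)) : b.saturate (setEquiv (setEquiv eS) 𝒳) =
    setEquiv (setEquiv eS) (saturationStep 𝒳) := by
  have hcard : Nat.card S = m := by rw [Nat.card_congr eS, Nat.card_fin]
  rw [saturate, h.numSets_eq, mask_eq (e := setEquiv eS) h.two_pow_le]
  congr 2
  ext V
  rw [Set.mem_ofPred_eq, ne_eq, Nat.add_eq_zero_iff, not_and_or, Nat.add_eq_zero_iff, not_and_or,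
    ← ne_eq, ← ne_eq, ← ne_eq, saturationStep, hcard, bit_setEquiv_ne_zero h.two_pow_le]
  simp only [anyIn_setEquiv_ne_zero h.two_pow_le, h.unionPowMask_eq, h.mulMask_eq, eqNat_ne_zero,
    Fin.val_inj, (setEquiv eS).injective.eq_iff, Set.mem_union, Set.mem_image, Set.mem_image2]

theorem saturation_eq :
    b.saturation = setEquiv (setEquiv eS) {X | MemSaturation (letterImage α.fin) X} := by
  have := Finite.of_equiv _ eS.symm
  have hiterate (i : ℕ) : loop i b.letterFamily (fun _ Z => b.saturate Z) =
      setEquiv (setEquiv eS) (saturationStep^[i] (Set.range fun a => {letterImage α.fin a})) := by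
    induction i with
    | zero => exact h.letterFamily_eq
    | succ i ih => rw [loop_succ, ih, h.saturate_eq, Function.iterate_succ_apply']
  rw [saturation, h.numSets_eq, boundedLoop_eq h.two_pow_le, hiterate, ← iterate_saturationStep,
    Nat.card_congr (setEquiv eS), Nat.card_fin]

theorem hits_ne_zero {F : Set T} {table : ℕ} (htable : ∀ t, b.mem (table + eT t) = 1 ↔ t ∈ F)
    (X E : Set S) : b.hits table (setEquiv eS X) (setEquiv eS E) ≠ 0 ↔
      ∃ x ∈ X, ∃ e ∈ E, x • (iprod (Stream'.const e) : T) ∈ F := by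
  rw [hits, h.size_fin]
  simp only [anyIn_setEquiv_ne_zero h.size_le, h.powerAt_eq, h.smulAt_eq, eqNat_ne_zero, htable]

theorem inseparable_eq_zero :
    b.inseparable = 0 ↔ ∀ p ∈ F₀, ∀ q ∈ F₁, ¬ Close (letterImage α.fin) p q := by
  have hleft := h.hits_ne_zero (table := b.leftTable) (by simpa only [h.leftTable_eq] using h.left)
  have hright :=
    h.hits_ne_zero (table := b.rightTable) (by simpa only [h.rightTable_eq] using h.right)
  rw [← not_iff_not, ← ne_eq, inseparable, h.numSets_eq, h.saturation_eq]
  simp only [anyIn_setEquiv_ne_zero h.two_pow_le, ne_eq, ite_eq_left_iff, Set.mem_ofPred_eq]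
  push Not
  simp only [hleft, hright]
  constructor
  · rintro ⟨U, hU, V, hV, ⟨x, hx, e, he, hp⟩, y, hy, f, hf, hq⟩
    exact ⟨_, hp, _, hq, U, V, hU, hV, x, hx, y, hy, e, he, f, hf, rfl, rfl⟩
  · rintro ⟨p, hp, q, hq, U, V, hU, hV, x, hx, y, hy, e, he, f, hf, rfl, rfl⟩
    exact ⟨U, hU, V, hV, ⟨x, hx, e, he, hp⟩, y, hy, f, hf, hq⟩

end Adequate

end RAM
/-! ## The random access machine -/

namespace RAM

theorem eval_le_eval_one_mul_pow (T : Polynomial ℕ) (c : ℕ) :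
    T.eval c ≤ T.eval 1 * (c + 1) ^ T.natDegree := by
  simp only [Polynomial.eval_eq_sum_range, one_pow, mul_one, Finset.sum_mul]
  refine Finset.sum_le_sum fun i hi => Nat.mul_le_mul_left _ ?_
  exact (Nat.pow_le_pow_left c.le_succ i).trans
    (Nat.pow_le_pow_right c.succ_pos (Finset.mem_range_succ_iff.1 hi))

theorem exists_eval_le_two_pow_mul (T : Polynomial ℕ) : ∃ p q : Polynomial ℕ,
    ∀ m n, T.eval (2 * 2 ^ m + n) ≤ 2 ^ p.eval m * q.eval n := by
  refine ⟨.X * .C T.natDegree, .C (T.eval 1) * (.X + .C 3) ^ T.natDegree, fun m n => ?_⟩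
  have hbase : 2 * 2 ^ m + n + 1 ≤ 2 ^ m * (n + 3) := by
    have : 1 ≤ 2 ^ m := Nat.one_le_two_pow
    nlinarith
  calc T.eval (2 * 2 ^ m + n)
      ≤ T.eval 1 * (2 * 2 ^ m + n + 1) ^ T.natDegree := eval_le_eval_one_mul_pow T _
    _ ≤ T.eval 1 * (2 ^ m * (n + 3)) ^ T.natDegree := by gcongr
    _ = _ := by
      simp only [Polynomial.eval_mul, Polynomial.eval_C, Polynomial.eval_X, Polynomial.eval_pow,
        Polynomial.eval_add, mul_pow, ← pow_mul]
      ring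

/-- The program that doubles register `6` as many times as register `2` says. -/
def doublingProg : Prog := .loop 2 (.seq (.add 6 6 6) (.sub 2 2 5))

theorem exists_runs_doublingProg {r : ℕ} {s : State} (hturns : s.reg 2 = r) (hone : s.reg 5 = 1) :
    ∃ s', Runs doublingProg s (3 * r + 1) s' ∧ s'.mem = s.mem ∧ s'.reg 4 = s.reg 4 ∧
      s'.reg 6 = 2 ^ r * s.reg 6 := by
  induction r generalizing s with
  | zero => exact ⟨s, .loop_false hturns, rfl, rfl, by simp⟩
  | succ r ih =>
    obtain ⟨σ, hbody, hmem, h4, h6, hturns', hone'⟩ :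
        ∃ σ, Runs (.seq (.add 6 6 6) (.sub 2 2 5)) s 2 σ ∧ σ.mem = s.mem ∧ σ.reg 4 = s.reg 4 ∧
          σ.reg 6 = 2 * s.reg 6 ∧ σ.reg 2 = r ∧ σ.reg 5 = 1 :=
      ⟨_, .seq (.add _ _ _ _) (.sub _ _ _ _), rfl, by simp [State.setReg],
        by simp [State.setReg, two_mul], by simp [State.setReg, hturns, hone],
        by simp [State.setReg, hone]⟩
    obtain ⟨s', hloop, hmem', h4', h6'⟩ := ih hturns' hone'
    have hrun := Runs.loop_true (by omega) hbody hloop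
    rw [show 2 + (3 * r + 1) + 1 = 3 * (r + 1) + 1 by omega] at hrun
    exact ⟨s', hrun, hmem'.trans hmem, h4'.trans h4, by rw [h6', h6, pow_succ, mul_assoc]⟩

/-- The program that puts the bound `2 * 2 ^ |S| + |A|` for the numbers of turns of loops into
register `0`. -/
def boundProg : Prog :=
  .seq (.seq (.seq (.const 1 0) (.load 2 1)) (.seq (.const 3 2) (.load 4 3)))
    (.seq (.seq (.const 5 1) (.const 6 2)) (.seq doublingProg (.add 0 6 4)))

theorem exists_runs_boundProg (s : State) : ∃ s', Runs boundProg s (3 * s.mem 0 + 8) s' ∧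
    s'.mem = s.mem ∧ s'.reg 0 = 2 * 2 ^ s.mem 0 + s.mem 2 := by
  have hload : Runs (.seq (.seq (.const 1 0) (.load 2 1)) (.seq (.const 3 2) (.load 4 3))) s 4 _ :=
    .seq (.seq (.const _ _ _) (.load _ _ _)) (.seq (.const _ _ _) (.load _ _ _))
  have hconst (σ : State) : Runs (.seq (.const 5 1) (.const 6 2)) σ 2 _ :=
    .seq (.const _ _ _) (.const _ _ _)
  obtain ⟨s', hdouble, hmem, h4, h6⟩ := exists_runs_doublingProg (r := s.mem 0)
    (s := ((((((s.setReg 1 0).setReg 2 (s.mem 0)).setReg 3 2).setReg 4 (s.mem 2)).setReg 5 1).setReg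
      6 2)) (by simp [State.setReg]) (by simp [State.setReg])
  have hrun := Runs.seq hload (.seq (hconst _) (.seq hdouble (.add 0 6 4 s')))
  rw [show 4 + (2 + (3 * s.mem 0 + 1 + 1)) = 3 * s.mem 0 + 8 by omega] at hrun
  refine ⟨_, hrun, hmem, ?_⟩
  simp [State.setReg, h4, h6, mul_comm]

theorem exists_prog_decides : ∃ (P : Prog) (p q : Polynomial ℕ),
    ∀ {A S T : Type*} [Semigroup S] [OmegaSemigroup S T] {n m k : ℕ}
      (eA : A ≃ Fin n) (eS : S ≃ Fin m) (eT : T ≃ Fin k)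
      (α : OmegaHom (FreeSemigroup A) (Stream' A) S T) (F₀ F₁ : Set T),
      DecidesWithin P (presentation eA eS eT α F₀ F₁) (2 ^ p.eval m * q.eval n)
        (∀ p ∈ F₀, ∀ q ∈ F₁, ¬ Saturation.Close (Saturation.letterImage α.fin) p q) := by
  obtain ⟨T, hT⟩ := Feasible.inseparable (α := BoundedMemory)
  obtain ⟨P, hP⟩ := hT () 1
  obtain ⟨p, q, hpq⟩ := exists_eval_le_two_pow_mul (T + (3 * .X + 10))
  refine ⟨.seq boundProg (.seq P (.seq (.const 0 1) (.sub 0 0 1))), p, q, ?_⟩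
  intro A S T' _ _ n m k eA eS eT α F₀ F₁
  have hpresented := isPresented_presentation eA eS eT α F₀ F₁
  obtain ⟨s, hbound, hmem, hreg⟩ := exists_runs_boundProg (init (presentation eA eS eT α F₀ F₁))
  have hsize : (init (presentation eA eS eT α F₀ F₁)).mem 0 = m := hpresented.size_fin
  have hletters : (init (presentation eA eS eT α F₀ F₁)).mem 2 = n := hpresented.size_letters
  rw [hsize] at hbound
  rw [hsize, hletters] at hreg
  have hadequate : Adequate eA eS eT α F₀ F₁ ⟨s.mem, 2 * 2 ^ m + n⟩ :=
    { toIsPresented := hmem ▸ hpresented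
      two_mul_le := Nat.le_add_right _ _
      letters_le := Nat.le_add_left _ _ }
  obtain ⟨t, s', hrun, ht, -, hvalue⟩ := hP ⟨s.mem, 2 * 2 ^ m + n⟩ s ⟨Nat.one_pos, rfl, hreg⟩
  refine ⟨_, _, .seq hbound (.seq hrun (.seq (.const _ _ _) (.sub _ _ _ _))), ?_, ?_⟩
  · refine le_trans ?_ (hpq m n)
    simp only [Polynomial.eval_add, Polynomial.eval_mul, Polynomial.eval_X, Polynomial.eval_ofNat]
    have hm : m < 2 ^ m := Nat.lt_two_pow_self
    change t ≤ T.eval (2 * 2 ^ m + n) at ht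
    omega
  · rw [← hadequate.inseparable_eq_zero]
    change s'.reg 1 = BoundedMemory.inseparable ⟨s.mem, 2 * 2 ^ m + n⟩ at hvalue
    rw [← hvalue]
    simp only [State.setReg, Function.update_self, ne_eq, one_ne_zero, not_false_eq_true,
      Function.update_of_ne, Function.update_idem]
    omega

end RAM

theorem mainTheorem5 :
    (∃ (P : RAM.Prog) (p q : Polynomial ℕ),
      ∀ (A S T : Type*) [Fintype A] [Fintype S] [Fintype T] [Semigroup S] [OmegaSemigroup S T]
        (eA : A ≃ Fin (Fintype.card A)) (eS : S ≃ Fin (Fintype.card S))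
        (eT : T ≃ Fin (Fintype.card T))
        (α : OmegaHom (FreeSemigroup A) (Stream' A) S T) (F₀ F₁ : Set T),
        RAM.DecidesWithin P (presentation eA eS eT α F₀ F₁)
          (2 ^ p.eval (Fintype.card S) * q.eval (Fintype.card A))
          (FOWord.Separable (α.inf ⁻¹' F₀) (α.inf ⁻¹' F₁))) ∧
    (∃ f : List ℕ → List ℕ, Computable f ∧
      ∀ (A S T : Type*) [Fintype A] [Fintype S] [Fintype T] [Semigroup S] [OmegaSemigroup S T]
        (eA : A ≃ Fin (Fintype.card A)) (eS : S ≃ Fin (Fintype.card S))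
        (eT : T ≃ Fin (Fintype.card T))
        (α : OmegaHom (FreeSemigroup A) (Stream' A) S T) (F₀ F₁ : Set T),
        FOWord.Separable (α.inf ⁻¹' F₀) (α.inf ⁻¹' F₁) →
          ∃ φ : (FOWord.lang A).Sentence,
            f (presentation eA eS eT α F₀ F₁) = FOWord.code (fun a => (eA a : ℕ)) φ ∧
            FOWord.qrank φ ≤ Fintype.card A * 2 ^ (Fintype.card S ^ 2) + 1 ∧
            FOWord.Separates (FOWord.langOf φ) (α.inf ⁻¹' F₀) (α.inf ⁻¹' F₁)) := by
  obtain ⟨P, p, q, h⟩ := RAM.exists_prog_decides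
  refine ⟨⟨P, p, q, ?_⟩, FOWord.separatorCode, FOWord.primrec_separatorCode.to_comp, ?_⟩
  · intro A S T _ _ _ _ _ eA eS eT α F₀ F₁
    rw [FOWord.separable_iff]
    exact h eA eS eT α F₀ F₁
  · intro A S T _ _ _ _ _ eA eS eT α F₀ F₁ hsep
    exact FOWord.exists_separator (isPresented_presentation eA eS eT α F₀ F₁) hsep
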